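/- For integers $n\ge m\ge 0$ let $(t)_k=t(t+1)\cdots(t+k-1)$ and define the rational functions $$R_{n,m}(t)=(-1)^m\Bigl(t+\frac n2\Bigr)\frac{(t-n)_m}{m!}\,\frac{(t-2n+m)_{2n-m}}{(2n-m)!}\,\frac{(t+n+1)_n}{(t)_{n+1}}\,\frac{(t+n+1)_{2n-m}}{(t)_{2n-m+1}}\Bigl(\frac{n!}{(t)_{n+1}}\Bigr)^2,$$ $$\tilde R_{n,m}(t)=\frac{n!\,(t-n)_{2n-m}}{(t)_{n+1}(t)_{2n-m+1}}\sum_{j=0}^n\binom nj^2\binom{2n-m+j}{n}\frac{(t-j)_n}{n!}.$$ Put $$Z_l(n,m)=-\frac13\sum_{\nu=n-m+1}^\infty R_{n,m}'(\nu),\qquad Z_r(n,m)=\frac16\sum_{\nu=1}^\infty\tilde R_{n,m}''(\nu),\qquad U_k(n)=\sum_{i=0}^n\frac{\binom{4i}{2i}}{(2i+1)^k\binom{2i}{i}^8}.$$ Define, recursively in $m$, rational functions $P_m(x),Q_m(x)$ by $$P_0=\frac1{30720},\qquad P_1=-\frac{x}{40960},\qquad Q_0=\frac{(4x+1)(5460x^4+13499x^3+12601x^2+5265x+831)}{768(2x+1)^9},$$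 $$Q_1=\frac{16x^9+116544x^8+398115x^7+587145x^6+490329x^5+255555x^4+86016x^3+18432x^2+2304x+128}{3072\,x^3(2x+1)^9},$$ where both sequences $(P_m)$ and $(Q_m)$ satisfy the recurrence $a_0(x,m)F_m+a_1(x,m)F_{m+1}+a_2(x,m)F_{m+2}=0$ with $$a_0(n,m)=(2n-m)^5,\qquad a_2(n,m)=-(2n-m-1)^3(4n-m)(m+2),$$ $$a_1(n,m)=-(4n-2m-1)\bigl(6n^4-24n^3m+22n^2m^2-8nm^3+m^4-24n^3+30n^2m-14nm^2+2m^3+8n^2-10nm+2m^2-4n+m\bigr).$$ Theorem. (1) For all integers $n\ge m\ge0$ both series converge (absolutely), and $$Z_l(n,m)=Z_r(n,m)=(-1)^n\binom{2n}{n}^4P_m(n)\bigl(30720\,\zeta(4)+105U_9(n)+955U_8(n)+3095U_7(n)+2045U_6(n)-12140U_5(n)-27300U_4(n)\bigr)+(-1)^n\frac{\binom{4n}{2n}}{\binom{2n}{n}^4}Q_m(n).$$ (2) These expressions can be computed in linear time: there are an absolute constant $C$ and a single program (over rational registers, using integer constants, the four field operations, tests for zero and loops, each load, operation and test counting as one step)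 which, on input $(n,m)$ with $n\ge m\ge0$, terminates after at most $C(n+1)$ steps and outputs the rational coefficients of $\zeta(4)$ and of $U_4(n),\dots,U_9(n)$ and the remaining rational summand in this expression, the values $U_4(n),\dots,U_9(n)$, and the rational number $B$ for which $Z_l(n,m)=Z_r(n,m)=A\,\zeta(4)+B$, where $A$ is the coefficient of $\zeta(4)$. -/

import Mathlib

open Finset

noncomputable section

/-- The Pochhammer symbol `(t)_k = t (t+1) ⋯ (t+k-1)`. -/
def poch (t : ℝ) (k : ℕ) : ℝ := (ascPochhammer ℝ k).eval t

/-- The rational function `R_{n,m}(t)` (used for `m ≤ n`; its poles are integers `≤ 0`). -/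
def ratR (n m : ℕ) (t : ℝ) : ℝ :=
  (-1) ^ m * (t + (n : ℝ) / 2)
    * (poch (t - n) m / (m.factorial : ℝ))
    * (poch (t - 2 * n + m) (2 * n - m) / ((2 * n - m).factorial : ℝ))
    * (poch (t + n + 1) n / poch t (n + 1))
    * (poch (t + n + 1) (2 * n - m) / poch t (2 * n - m + 1))
    * ((n.factorial : ℝ) / poch t (n + 1)) ^ 2

/-- The rational function `R̃_{n,m}(t)` (used for `m ≤ n`; its poles are integers `≤ 0`). -/
def ratRTilde (n m : ℕ) (t : ℝ) : ℝ :=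
  ((n.factorial : ℝ) * poch (t - n) (2 * n - m)) / (poch t (n + 1) * poch t (2 * n - m + 1))
    * ∑ j ∈ range (n + 1), ((n.choose j : ℝ) ^ 2 * ((2 * n - m + j).choose n : ℝ)
        * (poch (t - j) n / (n.factorial : ℝ)))

/-- The terms `R'(ν)`, `ν = n - m + 1 + i`, `i = 0, 1, 2, …`, of the left-hand series. -/
def termL (n m : ℕ) (i : ℕ) : ℝ := deriv (ratR n m) ((n : ℝ) - m + 1 + i)

/-- The terms `R̃''(ν)`, `ν = 1 + i`, `i = 0, 1, 2, …`, of the right-hand series. -/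
def termR (n m : ℕ) (i : ℕ) : ℝ := iteratedDeriv 2 (ratRTilde n m) (1 + i)

/-- `Z_l(n,m) = -(1/3) ∑_{ν ≥ n-m+1} R'(ν)`. -/
def Zl (n m : ℕ) : ℝ := -(1 / 3) * ∑' i, termL n m i

/-- `Z_r(n,m) = (1/6) ∑_{ν ≥ 1} R̃''(ν)`. -/
def Zr (n m : ℕ) : ℝ := 1 / 6 * ∑' i, termR n m i

/-- The real number `ζ(4)`. -/
def zetaFour : ℝ := (riemannZeta 4).re

end

/-- The nested sums `U_k(n) = ∑_{i=0}^n C(4i,2i) / ((2i+1)^k C(2i,i)^8)`. -/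
def nestedU (k n : ℕ) : ℚ :=
  ∑ i ∈ range (n + 1),
    ((4 * i).choose (2 * i) : ℚ) / ((2 * (i : ℚ) + 1) ^ k * ((2 * i).choose i : ℚ) ^ 8)

/-- Coefficients of the recurrence `a₀ Z(m) + a₁ Z(m+1) + a₂ Z(m+2) = 0`. -/
def recA0 (n m : ℚ) : ℚ := (2 * n - m) ^ 5

def recA1 (n m : ℚ) : ℚ :=
  -(4 * n - 2 * m - 1) *
    (6 * n ^ 4 - 24 * n ^ 3 * m + 22 * n ^ 2 * m ^ 2 - 8 * n * m ^ 3 + m ^ 4 - 24 * n ^ 3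
      + 30 * n ^ 2 * m - 14 * n * m ^ 2 + 2 * m ^ 3 + 8 * n ^ 2 - 10 * n * m + 2 * m ^ 2
      - 4 * n + m)

def recA2 (n m : ℚ) : ℚ := -(2 * n - m - 1) ^ 3 * (4 * n - m) * (m + 2)

/-- For each `m`, an explicit rational function of `x`; the solution of the recurrence in `m`
that multiplies the transcendental part. -/
def ratP (x : ℚ) : ℕ → ℚ
  | 0 => 1 / 30720
  | 1 => -x / 40960
  | m + 2 => -(recA0 x m * ratP x m + recA1 x m * ratP x (m + 1)) / recA2 x m

/-- For each `m`, an explicit rational function of `x`; the solution of the recurrence in `m`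
that gives the purely hypergeometric part. -/
def ratQ (x : ℚ) : ℕ → ℚ
  | 0 => (4 * x + 1) * (5460 * x ^ 4 + 13499 * x ^ 3 + 12601 * x ^ 2 + 5265 * x + 831)
      / (768 * (2 * x + 1) ^ 9)
  | 1 => (16 * x ^ 9 + 116544 * x ^ 8 + 398115 * x ^ 7 + 587145 * x ^ 6 + 490329 * x ^ 5
      + 255555 * x ^ 4 + 86016 * x ^ 3 + 18432 * x ^ 2 + 2304 * x + 128)
      / (3072 * x ^ 3 * (2 * x + 1) ^ 9)
  | m + 2 => -(recA0 x m * ratQ x m + recA1 x m * ratQ x (m + 1)) / recA2 x m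

/-- The hypergeometric product `(-1)^n C(2n,n)^4`. -/
def hypA (n : ℕ) : ℚ := (-1) ^ n * ((2 * n).choose n : ℚ) ^ 4

/-- The hypergeometric product `(-1)^n C(4n,2n) / C(2n,n)^4`. -/
def hypB (n : ℕ) : ℚ := (-1) ^ n * ((4 * n).choose (2 * n) : ℚ) / ((2 * n).choose n : ℚ) ^ 4

/-- Integer weights of `U_4, …, U_9`. -/
def weightU : ℕ → ℚ
  | 4 => -27300
  | 5 => -12140
  | 6 => 2045
  | 7 => 3095
  | 8 => 955
  | 9 => 105
  | _ => 0

/-- The coefficient of `ζ(4)`. -/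
def coefZeta (n m : ℕ) : ℚ := 30720 * (ratP n m * hypA n)

/-- The coefficient of `U_k(n)`. -/
def coefU (k n m : ℕ) : ℚ := weightU k * (ratP n m * hypA n)

/-- The remaining, purely hypergeometric, summand. -/
def coefOne (n m : ℕ) : ℚ := ratQ n m * hypB n

/-- Programs of a rational arithmetic machine with registers `0, 1, 2, …`: load an integer
constant, one field operation, sequencing, test for zero, loop while a register is nonzero. -/
inductive Prog : Type
  | const (r : ℕ) (q : ℤ)
  | add (r a b : ℕ)
  | sub (r a b : ℕ)
  | mul (r a b : ℕ)
  | div (r a b : ℕ)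
  | seq (c d : Prog)
  | ifZero (r : ℕ) (c d : Prog)
  | whileNonzero (r : ℕ) (c : Prog)

/-- `Exec c s t s'`: started with register contents `s`, the program `c` terminates after
exactly `t` steps with register contents `s'`. Every load, field operation and test is one
step. A division by zero has no successor, so a computation that attempts one never terminates. -/
inductive Exec : Prog → (ℕ → ℚ) → ℕ → (ℕ → ℚ) → Prop
  | const (r : ℕ) (q : ℤ) (s : ℕ → ℚ) : Exec (.const r q) s 1 (Function.update s r (q : ℚ))
  | add (r a b : ℕ) (s : ℕ → ℚ) : Exec (.add r a b) s 1 (Function.update s r (s a + s b))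
  | sub (r a b : ℕ) (s : ℕ → ℚ) : Exec (.sub r a b) s 1 (Function.update s r (s a - s b))
  | mul (r a b : ℕ) (s : ℕ → ℚ) : Exec (.mul r a b) s 1 (Function.update s r (s a * s b))
  | div (r a b : ℕ) (s : ℕ → ℚ) (h : s b ≠ 0) :
      Exec (.div r a b) s 1 (Function.update s r (s a / s b))
  | seq {c d : Prog} {s s' s'' : ℕ → ℚ} {t t' : ℕ}
      (h : Exec c s t s') (h' : Exec d s' t' s'') : Exec (.seq c d) s (t + t') s''
  | ifTrue {c d : Prog} {r : ℕ} {s s' : ℕ → ℚ} {t : ℕ}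
      (h₀ : s r = 0) (h : Exec c s t s') : Exec (.ifZero r c d) s (1 + t) s'
  | ifFalse {c d : Prog} {r : ℕ} {s s' : ℕ → ℚ} {t : ℕ}
      (h₀ : s r ≠ 0) (h : Exec d s t s') : Exec (.ifZero r c d) s (1 + t) s'
  | whileDone {c : Prog} {r : ℕ} {s : ℕ → ℚ}
      (h₀ : s r = 0) : Exec (.whileNonzero r c) s 1 s
  | whileStep {c : Prog} {r : ℕ} {s s' s'' : ℕ → ℚ} {t t' : ℕ}
      (h₀ : s r ≠ 0) (h : Exec c s t s') (h' : Exec (.whileNonzero r c) s' t' s'') :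
      Exec (.whileNonzero r c) s (1 + t + t') s''

/-- Initial registers: `n` in register `0`, `m` in register `1`, and `0` in all others. -/
def inputNM (n m : ℕ) : ℕ → ℚ
  | 0 => n
  | 1 => m
  | _ => 0

/-! Both series are treated by creative telescoping with explicit certificates. Put N = 2n - m.
Certain combinations of R, and likewise of R̃, at neighbouring (n, m) have the form κ(g(t+1) - g(t))
with g rational, without poles on t > 0 and of degree at most 0. After one differentiation (left) or
two (right), the sum reduces to -κ times the derivative of g at the starting point, because
derivatives of g vanish at infinity (`sum_deriv_telescope`, `sum_deriv_deriv_telescope`).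

Left series. R has double zeros at n-m+1, ..., n, so all the series involved may start at n + 1.
When the certificate also has a double zero there, the relation is homogeneous: `Zl_rec` (three
consecutive m) and `Zl_row` (rows n and n + 1). At the edge m = 0 the zero is only simple, and a
multiple of `hypB` survives: `Zl_one`, `Zl_rowZero`. These two combine into a first-order
inhomogeneous recurrence in n for m = 0, with initial value ζ(4). Its homogeneous solution is
`hypA`, and the quotients `hypB`/`hypA` are the numerators' part of the U_k, so the closed form
follows by induction (`Zl_zero`). The recurrence in m, shared by P and Q, then gives all m ≤ n.

Right series. The inner sum is a balanced sum Φ_n(a, b) whose contiguous relations (`Phi_contig`,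
`Phi_contig_diag`, `Phi_succ`) reduce all shifts needed to two basis functions. The certificates are
combinations of these two and give the same two homogeneous relations (`Zr_rec`, `Zr_row`). The
delicate point is that the second derivative of a certificate vanishes at 1: the certificate is (t -
1)H(t), and H'(1) = 0 follows from the expansion `Phi_expand` and the symmetry t ↦ 2 - t of a
product of rising factorials.

Equality. The homogeneous relations determine both arrays from the entries (0,0), (1,0), (1,1),
(2,1), where the right side is evaluated by partial fractions.

Complexity. A program with one loop of n passes for the sums and one of m passes for P and Q
suffices, since each pass has a constant cost. -/

/-! ### Rational functions on the positive axis, their order at infinity, and telescoping sums. -/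

section RationalOrder

open Polynomial Filter Topology

/-- On `(0, ∞)` the function is a rational function without poles, of degree at most `d`. -/
def RatOrd (d : ℤ) (f : ℝ → ℝ) : Prop :=
  ∃ p q : ℝ[X], (∀ t > 0, q.eval t ≠ 0) ∧ (p.natDegree : ℤ) ≤ q.natDegree + d ∧
    ∀ t > 0, f t = p.eval t / q.eval t

namespace RatOrd

variable {f g : ℝ → ℝ} {d e : ℤ}

theorem mono (h : RatOrd d f) (hde : d ≤ e) : RatOrd e f := by
  obtain ⟨p, q, hq, hd, hf⟩ := h
  exact ⟨p, q, hq, by omega, hf⟩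

theorem congr (h : RatOrd d f) (hfg : ∀ t > 0, g t = f t) : RatOrd d g := by
  obtain ⟨p, q, hq, hd, hf⟩ := h
  exact ⟨p, q, hq, hd, fun t ht => (hfg t ht).trans (hf t ht)⟩

theorem ne_zero_of_eval {q : ℝ[X]} (hq : ∀ t > 0, q.eval t ≠ 0) : q ≠ 0 := by
  rintro rfl
  exact hq 1 one_pos (by simp)

/-- Extending the fraction by X makes the denominator nonconstant. `deriv` needs this because the
zero polynomial has `natDegree` 0: for a constant written over 1, the numerator 0 of the derivative
would not meet the lowered degree bound. -/
theorem exists_large (h : RatOrd d f) : ∃ p q : ℝ[X], (∀ t > 0, q.eval t ≠ 0) ∧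
    (p.natDegree : ℤ) ≤ q.natDegree + d ∧ 1 ≤ q.natDegree ∧ ∀ t > 0, f t = p.eval t / q.eval t := by
  obtain ⟨p, q, hq, hd, hf⟩ := h
  have hq0 := ne_zero_of_eval hq
  refine ⟨p * X, q * X, fun t ht => by simpa using ⟨hq t ht, ht.ne'⟩, ?_, ?_, fun t ht => ?_⟩
  · rw [natDegree_mul_X hq0]
    have := natDegree_mul_le (p := p) (q := (X : ℝ[X]))
    rw [natDegree_X] at this
    push_cast
    omega
  · rw [natDegree_mul_X hq0]; omega
  · rw [hf t ht, eval_mul, eval_mul, eval_X, mul_div_mul_right _ _ ht.ne']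

theorem mul (hf : RatOrd d f) (hg : RatOrd e g) : RatOrd (d + e) (fun t => f t * g t) := by
  obtain ⟨p, q, hq, hd, hf⟩ := hf
  obtain ⟨p', q', hq', hd', hg⟩ := hg
  refine ⟨p * p', q * q', fun t ht => by simpa using ⟨hq t ht, hq' t ht⟩, ?_, fun t ht => ?_⟩
  · rw [natDegree_mul (ne_zero_of_eval hq) (ne_zero_of_eval hq')]
    have := natDegree_mul_le (p := p) (q := p')
    push_cast
    omega
  · simp only [hf t ht, hg t ht, eval_mul, div_mul_div_comm]

theorem add (hf : RatOrd d f) (hg : RatOrd d g) : RatOrd d (fun t => f t + g t) := by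
  obtain ⟨p, q, hq, hd, hf⟩ := hf
  obtain ⟨p', q', hq', hd', hg⟩ := hg
  refine ⟨p * q' + q * p', q * q', fun t ht => by simpa using ⟨hq t ht, hq' t ht⟩, ?_,
    fun t ht => ?_⟩
  · rw [natDegree_mul (ne_zero_of_eval hq) (ne_zero_of_eval hq')]
    have h1 := natDegree_mul_le (p := p) (q := q')
    have h2 := natDegree_mul_le (p := q) (q := p')
    have h3 := natDegree_add_le (p * q') (q * p')
    rcases max_cases (p * q').natDegree (q * p').natDegree with h | h <;> push_cast <;> omega
  · simp only [hf t ht, hg t ht, eval_add, eval_mul, div_add_div _ _ (hq t ht) (hq' t ht)]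

theorem const (c : ℝ) : RatOrd 0 (fun _ => c) :=
  ⟨C c, 1, by simp, by simp, by simp⟩

theorem const_mul (c : ℝ) (hf : RatOrd d f) : RatOrd d (fun t => c * f t) := by
  simpa using (const c).mul hf

theorem linear (c : ℝ) : RatOrd 1 (fun t => t + c) :=
  ⟨X + C c, 1, by simp, by simp, by simp⟩

theorem inv_linear {c : ℝ} (hc : 0 ≤ c) : RatOrd (-1) (fun t => (t + c)⁻¹) :=
  ⟨1, X + C c, fun t ht => by simpa using (by positivity : t + c ≠ 0), by simp, by simp⟩

theorem sum {ι : Type*} (s : Finset ι) (f : ι → ℝ → ℝ) (h : ∀ i ∈ s, RatOrd d (f i))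
    (hd : 0 ≤ d) : RatOrd d (fun t => ∑ i ∈ s, f i t) := by
  classical
  induction s using Finset.induction_on with
  | empty => simpa using (const 0).mono hd
  | insert a s ha ih =>
    simp only [Finset.sum_insert ha]
    exact (h a (by simp)).add (ih fun i hi => h i (by simp [hi]))

theorem hasDerivAt_div (p q : ℝ[X]) {t : ℝ} (hq : q.eval t ≠ 0) :
    HasDerivAt (fun t => p.eval t / q.eval t)
      ((derivative p * q - p * derivative q).eval t / (q * q).eval t) t := by
  convert! (p.hasDerivAt t).div (q.hasDerivAt t) hq using 1
  simp [sq]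

theorem deriv (h : RatOrd d f) : RatOrd (d - 1) (_root_.deriv f) := by
  obtain ⟨p, q, hq, hd, hq1, hf⟩ := h.exists_large
  refine ⟨derivative p * q - p * derivative q, q * q, fun t ht => by simpa using hq t ht, ?_,
    fun t ht => ?_⟩
  · have hq0 := ne_zero_of_eval hq
    rw [natDegree_mul hq0 hq0]
    have h1 : (derivative p * q - p * derivative q).natDegree ≤ p.natDegree + q.natDegree - 1 := by
      refine (natDegree_sub_le _ _).trans (max_le ?_ ?_)
      · by_cases hp : p.natDegree = 0
        · rw [natDegree_eq_zero.1 hp |>.choose_spec.symm]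
          simp
        · refine natDegree_mul_le.trans ?_
          have := natDegree_derivative_lt hp
          omega
      · refine natDegree_mul_le.trans ?_
        have := natDegree_derivative_lt (p := q) (by omega)
        omega
    push_cast
    omega
  · have heq : f =ᶠ[𝓝 t] fun t => p.eval t / q.eval t := by
      filter_upwards [lt_mem_nhds ht] with s hs using hf s hs
    rw [heq.deriv_eq, (hasDerivAt_div p q (hq t ht)).deriv]

theorem differentiableAt (h : RatOrd d f) {t : ℝ} (ht : 0 < t) : DifferentiableAt ℝ f t := by
  obtain ⟨p, q, hq, hd, hf⟩ := h
  have heq : f =ᶠ[𝓝 t] fun t => p.eval t / q.eval t := by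
    filter_upwards [lt_mem_nhds ht] with s hs using hf s hs
  exact ((hasDerivAt_div p q (hq t ht)).congr_of_eventuallyEq heq).differentiableAt

theorem tendsto (h : RatOrd d f) (hd : d ≤ -1) : Tendsto f atTop (𝓝 0) := by
  obtain ⟨p, q, hq, hpq, hf⟩ := h
  have h1 : p.degree < q.degree := by
    refine lt_of_le_of_lt degree_le_natDegree ?_
    rw [degree_eq_natDegree (ne_zero_of_eval hq)]
    exact_mod_cast (by omega : p.natDegree < q.natDegree)
  refine (div_tendsto_atTop_zero_of_degree_lt p q h1).congr' ?_
  filter_upwards [eventually_gt_atTop 0] with t ht using (hf t ht).symm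

theorem summable (h : RatOrd d f) (hd : d ≤ -2) (k : ℕ) :
    Summable (fun i : ℕ => f ((i + k : ℕ) : ℝ)) := by
  obtain ⟨p, q, hq, hpq, hf⟩ := h
  rw [summable_nat_add_iff (f := fun i : ℕ => f (i : ℝ))]
  have h1 : (p * X ^ 2).degree ≤ q.degree := by
    rw [degree_eq_natDegree (ne_zero_of_eval hq)]
    refine degree_le_natDegree.trans ?_
    have := natDegree_mul_le (p := p) (q := (X : ℝ[X]) ^ 2)
    rw [natDegree_X_pow] at this
    exact_mod_cast (by omega : (p * X ^ 2).natDegree ≤ q.natDegree)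
  have h2 : f =O[atTop] fun t : ℝ => 1 / t ^ 2 := by
    obtain ⟨C, hC⟩ := ((isBigO_atTop_of_degree_le _ _ h1)).bound
    refine Asymptotics.IsBigO.of_bound C ?_
    filter_upwards [eventually_gt_atTop 0, hC] with t ht hCt
    rw [hf t ht, norm_div, norm_div, norm_one, mul_one_div]
    have hq' : 0 < ‖q.eval t‖ := norm_pos_iff.2 (hq t ht)
    have ht' : 0 < ‖t ^ 2‖ := norm_pos_iff.2 (by positivity)
    rw [div_le_div_iff₀ hq' ht', ← norm_mul]
    simpa using hCt
  exact summable_of_isBigO_nat (Real.summable_one_div_nat_pow.2 one_lt_two)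
    (h2.comp_tendsto tendsto_natCast_atTop_atTop)

end RatOrd

theorem hasSum_of_telescope {f g : ℝ → ℝ} {d e : ℤ} (hg : RatOrd d g) (hd : d ≤ -1)
    (hf : RatOrd e f) (he : e ≤ -2) (h : ∀ t > 0, f t = g (t + 1) - g t) {k : ℕ} (hk : 0 < k) :
    HasSum (fun i : ℕ => f ((i + k : ℕ) : ℝ)) (-g k) := by
  rw [(hf.summable he k).hasSum_iff_tendsto_nat]
  have h1 : ∀ N : ℕ, ∑ i ∈ range N, f ((i + k : ℕ) : ℝ) = g ((N + k : ℕ) : ℝ) - g k := by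
    intro N
    have : ∀ i : ℕ, f ((i + k : ℕ) : ℝ)
        = (fun j : ℕ => g ((j + k : ℕ) : ℝ)) (i + 1) - (fun j : ℕ => g ((j + k : ℕ) : ℝ)) i := by
      intro i
      rw [h _ (by positivity)]
      simp only [Nat.cast_add, Nat.cast_one]
      rw [add_right_comm]
    simp only [this]
    exact (Finset.sum_range_sub (fun j : ℕ => g ((j + k : ℕ) : ℝ)) N).trans (by simp)
  simp only [h1]
  have h2 : Tendsto (fun N : ℕ => g ((N + k : ℕ) : ℝ)) atTop (𝓝 0) :=
    (hg.tendsto hd).comp (tendsto_natCast_atTop_atTop.comp (tendsto_add_atTop_nat k))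
  simpa using h2.sub_const (g k)

variable {f₀ f₁ f₂ g : ℝ → ℝ} {a₀ a₁ a₂ κ b₀ b₁ b₂ : ℝ} {d₀ d₁ d₂ d : ℤ}

theorem sum_telescope (h₀ : RatOrd d₀ f₀) (h₁ : RatOrd d₁ f₁) (h₂ : RatOrd d₂ f₂)
    (hg : RatOrd d g) (hd : d ≤ -1) (hd₀ : d₀ ≤ -2) (hd₁ : d₁ ≤ -2) (hd₂ : d₂ ≤ -2)
    (h : ∀ t > 0, a₀ * f₀ t + a₁ * f₁ t + a₂ * f₂ t = κ * (g (t + 1) - g t)) {k : ℕ} (hk : 0 < k)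
    (s₀ : HasSum (fun i : ℕ => f₀ ((i + k : ℕ) : ℝ)) b₀)
    (s₁ : HasSum (fun i : ℕ => f₁ ((i + k : ℕ) : ℝ)) b₁)
    (s₂ : HasSum (fun i : ℕ => f₂ ((i + k : ℕ) : ℝ)) b₂) :
    a₀ * b₀ + a₁ * b₁ + a₂ * b₂ = -(κ * g k) :=
  (((s₀.mul_left a₀).add (s₁.mul_left a₁)).add (s₂.mul_left a₂)).unique <|
    hasSum_of_telescope (hg.const_mul κ) hd ((((h₀.mono hd₀).const_mul a₀).add
      ((h₁.mono hd₁).const_mul a₁)).add ((h₂.mono hd₂).const_mul a₂)) le_rfl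
      (fun t ht => by rw [h t ht]; ring) hk

theorem deriv_telescope (h₀ : RatOrd d₀ f₀) (h₁ : RatOrd d₁ f₁) (h₂ : RatOrd d₂ f₂)
    (hg : RatOrd d g)
    (h : ∀ t > 0, a₀ * f₀ t + a₁ * f₁ t + a₂ * f₂ t = κ * (g (t + 1) - g t)) :
    ∀ t > 0, a₀ * deriv f₀ t + a₁ * deriv f₁ t + a₂ * deriv f₂ t
      = κ * (deriv g (t + 1) - deriv g t) := by
  intro t ht
  have heq : (fun t => a₀ * f₀ t + a₁ * f₁ t + a₂ * f₂ t)
      =ᶠ[𝓝 t] fun t => κ * (g (t + 1) - g t) := by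
    filter_upwards [lt_mem_nhds ht] with s hs using h s hs
  have hl := (((h₀.differentiableAt ht).hasDerivAt.const_mul a₀).add
    ((h₁.differentiableAt ht).hasDerivAt.const_mul a₁)).add
    ((h₂.differentiableAt ht).hasDerivAt.const_mul a₂)
  have h1 : HasDerivAt (fun t => g (t + 1)) (deriv g (t + 1)) t :=
    (hg.differentiableAt (by positivity : 0 < t + 1)).hasDerivAt.comp_add_const t 1
  exact hl.unique (((h1.sub (hg.differentiableAt ht).hasDerivAt).const_mul κ).congr_of_eventuallyEq
    heq)

/-- It is enough that g stays bounded: the differentiated relation telescopes g', which has order -1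
and therefore no contribution at infinity. -/
theorem sum_deriv_telescope (h₀ : RatOrd d₀ f₀) (h₁ : RatOrd d₁ f₁) (h₂ : RatOrd d₂ f₂)
    (hg : RatOrd 0 g) (hd₀ : d₀ ≤ -1) (hd₁ : d₁ ≤ -1) (hd₂ : d₂ ≤ -1)
    (h : ∀ t > 0, a₀ * f₀ t + a₁ * f₁ t + a₂ * f₂ t = κ * (g (t + 1) - g t)) {k : ℕ} (hk : 0 < k)
    (s₀ : HasSum (fun i : ℕ => deriv f₀ ((i + k : ℕ) : ℝ)) b₀)
    (s₁ : HasSum (fun i : ℕ => deriv f₁ ((i + k : ℕ) : ℝ)) b₁)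
    (s₂ : HasSum (fun i : ℕ => deriv f₂ ((i + k : ℕ) : ℝ)) b₂) :
    a₀ * b₀ + a₁ * b₁ + a₂ * b₂ = -(κ * deriv g k) :=
  sum_telescope h₀.deriv h₁.deriv h₂.deriv hg.deriv (by omega) (by omega) (by omega) (by omega)
    (deriv_telescope h₀ h₁ h₂ hg h) hk s₀ s₁ s₂

theorem sum_deriv_deriv_telescope (h₀ : RatOrd d₀ f₀) (h₁ : RatOrd d₁ f₁) (h₂ : RatOrd d₂ f₂)
    (hg : RatOrd 0 g) (hd₀ : d₀ ≤ 0) (hd₁ : d₁ ≤ 0) (hd₂ : d₂ ≤ 0)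
    (h : ∀ t > 0, a₀ * f₀ t + a₁ * f₁ t + a₂ * f₂ t = κ * (g (t + 1) - g t)) {k : ℕ} (hk : 0 < k)
    (s₀ : HasSum (fun i : ℕ => deriv (deriv f₀) ((i + k : ℕ) : ℝ)) b₀)
    (s₁ : HasSum (fun i : ℕ => deriv (deriv f₁) ((i + k : ℕ) : ℝ)) b₁)
    (s₂ : HasSum (fun i : ℕ => deriv (deriv f₂) ((i + k : ℕ) : ℝ)) b₂) :
    a₀ * b₀ + a₁ * b₁ + a₂ * b₂ = -(κ * deriv (deriv g) k) :=
  sum_telescope h₀.deriv.deriv h₁.deriv.deriv h₂.deriv.deriv hg.deriv.deriv (by omega) (by omega)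
    (by omega) (by omega)
    (deriv_telescope h₀.deriv h₁.deriv h₂.deriv hg.deriv (deriv_telescope h₀ h₁ h₂ hg h))
    hk s₀ s₁ s₂

end RationalOrder

/-! ### Rising factorials. -/

section Pochhammer

theorem poch_zero (t : ℝ) : poch t 0 = 1 := by simp [poch]

theorem poch_succ (t : ℝ) (k : ℕ) : poch t (k + 1) = poch t k * (t + k) :=
  ascPochhammer_succ_eval k t

theorem poch_succ_left (t : ℝ) (k : ℕ) : poch t (k + 1) = t * poch (t + 1) k := by
  simp [poch, ascPochhammer_succ_left]

theorem poch_one_right (t : ℝ) : poch t 1 = t := by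
  simpa [poch_zero] using poch_succ t 0

theorem poch_natCast_succ (a k : ℕ) : poch ((a : ℝ) + 1) k = (a + k).factorial / a.factorial := by
  induction k with
  | zero => simp [poch_zero, Nat.factorial_ne_zero]
  | succ k ih =>
    rw [poch_succ, ih, ← add_assoc, Nat.factorial_succ]
    push_cast
    ring

theorem poch_pos {t : ℝ} (ht : 0 < t) (k : ℕ) : 0 < poch t k := ascPochhammer_pos k t ht

theorem poch_neg_eq_zero {j k : ℕ} (h : j < k) : poch (-(j : ℝ)) k = 0 :=
  ascPochhammer_eval_neg_coe_nat_of_lt h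

theorem poch_one (k : ℕ) : poch 1 k = k.factorial := by
  simp [poch, ascPochhammer_eval_one]

theorem ratOrd_poch (c : ℝ) (k : ℕ) : RatOrd k (fun t => poch (t + c) k) := by
  induction k with
  | zero => simpa [poch_zero] using RatOrd.const 1
  | succ k ih =>
    simp only [poch_succ, add_assoc]
    exact_mod_cast ih.mul (RatOrd.linear (c + k))

theorem ratOrd_inv_poch {c : ℝ} (hc : 0 ≤ c) (k : ℕ) :
    RatOrd (-k) (fun t => (poch (t + c) k)⁻¹) := by
  induction k with
  | zero => simpa [poch_zero] using RatOrd.const 1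
  | succ k ih =>
    simp only [poch_succ, add_assoc, mul_inv]
    convert! ih.mul (RatOrd.inv_linear (by positivity : 0 ≤ c + k)) using 1
    push_cast; ring

end Pochhammer

/-! ### The left series: decay, double zeros and freedom in the starting index. -/

section LeftSeries

theorem ratR_eq {n m N : ℕ} (h : m + N = 2 * n) (t : ℝ) : ratR n m t =
    (-1) ^ m * (t + (n : ℝ) / 2) * (poch (t - n) m / (m.factorial : ℝ))
    * (poch (t - N) N / (N.factorial : ℝ)) * (poch (t + n + 1) n / poch t (n + 1))
    * (poch (t + n + 1) N / poch t (N + 1)) * ((n.factorial : ℝ) / poch t (n + 1)) ^ 2 := by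
  have hN : 2 * n - m = N := by omega
  have hN' : t - 2 * n + m = t - N := by
    have : (m : ℝ) + N = 2 * n := by exact_mod_cast h
    linarith
  rw [ratR, hN, hN']

theorem ratOrd_poch_sub (c : ℝ) (k : ℕ) : RatOrd k (fun t => poch (t - c) k) := by
  simpa [sub_eq_add_neg] using ratOrd_poch (-c) k

theorem ratOrd_inv_poch_self (k : ℕ) : RatOrd (-k) (fun t => (poch t k)⁻¹) := by
  simpa using ratOrd_inv_poch le_rfl k

/-- Degree count: 1 + m + N + n + N - 3(n+1) - (N+1) = -3. -/
theorem ratOrd_ratR {n m N : ℕ} (h : m + N = 2 * n) : RatOrd (-3) (ratR n m) := by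
  have hE := ratOrd_inv_poch_self (n + 1)
  have h1 := (((((((RatOrd.linear ((n : ℝ) / 2)).mul (ratOrd_poch_sub n m)).mul
    (ratOrd_poch_sub N N)).mul (ratOrd_poch (n + 1) n)).mul (ratOrd_poch (n + 1) N)).mul hE).mul
    (hE.mul hE)).mul (ratOrd_inv_poch_self (N + 1))
  refine ((h1.const_mul ((-1) ^ m / (m.factorial : ℝ) / N.factorial * (n.factorial : ℝ) ^ 2)).mono
    (by push_cast; omega)).congr fun t ht => ?_
  rw [ratR_eq h]
  simp only [← add_assoc]
  ring

theorem deriv_double_zero {f u v w : ℝ → ℝ} {ν : ℝ} (hν : 0 < ν)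
    (hf : ∀ t > 0, f t = u t * v t * w t) (hu : u ν = 0) (hv : v ν = 0) {d₁ d₂ d₃ : ℤ}
    (hu' : RatOrd d₁ u) (hv' : RatOrd d₂ v) (hw' : RatOrd d₃ w) : deriv f ν = 0 := by
  have heq : f =ᶠ[nhds ν] fun t => u t * v t * w t := by
    filter_upwards [lt_mem_nhds hν] with s hs using hf s hs
  have h := ((hu'.differentiableAt hν).hasDerivAt.mul (hv'.differentiableAt hν).hasDerivAt).mul
    (hw'.differentiableAt hν).hasDerivAt
  rw [heq.deriv_eq]
  convert! h.deriv using 1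
  simp [hu, hv]

theorem deriv_simple_zero {f u w : ℝ → ℝ} {ν : ℝ} (hν : 0 < ν)
    (hf : ∀ t > 0, f t = u t * w t) (hu : u ν = 0) {d₁ d₂ : ℤ}
    (hu' : RatOrd d₁ u) (hw' : RatOrd d₂ w) : deriv f ν = deriv u ν * w ν := by
  have heq : f =ᶠ[nhds ν] fun t => u t * w t := by
    filter_upwards [lt_mem_nhds hν] with s hs using hf s hs
  have h := (hu'.differentiableAt hν).hasDerivAt.mul (hw'.differentiableAt hν).hasDerivAt
  rw [heq.deriv_eq]
  convert! h.deriv using 1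
  simp [hu]

theorem poch_sub_eq_zero {a b k : ℕ} (h1 : b ≤ a) (h2 : a < b + k) :
    poch ((b : ℝ) - a) k = 0 := by
  obtain ⟨j, rfl⟩ := Nat.exists_eq_add_of_le h1
  have : (b : ℝ) - ((b + j : ℕ) : ℝ) = -(j : ℝ) := by push_cast; ring
  rw [this]
  exact poch_neg_eq_zero (by omega)

/-- In this range (t - n)_m and (t - N)_N vanish simultaneously, so the zero is at least double. -/
theorem deriv_ratR_eq_zero {n m ν : ℕ} (hm : m ≤ n) (h1 : n < m + ν) (h2 : ν ≤ n) :
    deriv (ratR n m) ν = 0 := by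
  obtain ⟨N, hN⟩ := Nat.exists_eq_add_of_le (show m ≤ 2 * n by omega)
  have hE := ratOrd_inv_poch_self (n + 1)
  have hw := ((((((RatOrd.linear ((n : ℝ) / 2))).mul (ratOrd_poch (n + 1) n)).mul
    (ratOrd_poch (n + 1) N)).mul hE).mul (hE.mul hE)).mul (ratOrd_inv_poch_self (N + 1))
  refine deriv_double_zero (by exact_mod_cast (by omega : 0 < ν)) ?_
    (poch_sub_eq_zero (a := n) (k := m) h2 (by omega))
    (poch_sub_eq_zero (a := N) (k := N) (by omega) (by omega))
    (ratOrd_poch_sub n m) (ratOrd_poch_sub N N)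
    (hw.const_mul ((-1) ^ m / (m.factorial : ℝ) / N.factorial * (n.factorial : ℝ) ^ 2))
  intro t ht
  rw [ratR_eq hN.symm]
  simp only [← add_assoc]
  ring

theorem summable_deriv_ratR {n m : ℕ} (hm : m ≤ n) (k : ℕ) :
    Summable fun i : ℕ => deriv (ratR n m) ((i + k : ℕ) : ℝ) := by
  obtain ⟨N, hN⟩ := Nat.exists_eq_add_of_le (show m ≤ 2 * n by omega)
  exact (ratOrd_ratR hN.symm).deriv.summable (by norm_num) k

theorem termL_eq {n m : ℕ} (hm : m ≤ n) :
    termL n m = fun i : ℕ => deriv (ratR n m) ((i + (n - m + 1) : ℕ) : ℝ) := by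
  funext i
  rw [termL]
  congr 1
  push_cast [Nat.cast_sub hm]
  ring

/-- The skipped terms are zero. Hence series with different m, and even from rows n and n + 1, can
be summed from the common index n + 1. -/
theorem hasSum_deriv_ratR {n m k : ℕ} (hm : m ≤ n) (hk : n < m + k) (hk' : k ≤ n + 1) :
    HasSum (fun i : ℕ => deriv (ratR n m) ((i + k : ℕ) : ℝ)) (-3 * Zl n m) := by
  have h1 := (summable_deriv_ratR hm k).hasSum
  have h2 : ∑' i, termL n m i = ∑' i : ℕ, deriv (ratR n m) ((i + k : ℕ) : ℝ) := by
    obtain ⟨d, rfl⟩ := Nat.exists_eq_add_of_le (show n - m + 1 ≤ k by omega)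
    rw [termL_eq hm, ← (summable_deriv_ratR hm (n - m + 1)).sum_add_tsum_nat_add d,
      Finset.sum_eq_zero, zero_add]
    · congr 1
      funext i
      congr 2
      omega
    · intro i hi
      rw [Finset.mem_range] at hi
      exact deriv_ratR_eq_zero hm (by omega) (by omega)
  rw [Zl, h2]
  convert! h1 using 1
  ring


end LeftSeries

/-! ### The recurrence in m for the left-hand summand. -/

section LeftRecurrence

theorem poch_add (t : ℝ) (j k : ℕ) : poch t (j + k) = poch t j * poch (t + j) k := by
  induction k with
  | zero => simp [poch_zero]
  | succ k ih => rw [← add_assoc, poch_succ, ih, poch_succ]; push_cast; ring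

theorem poch_neg_self (j : ℕ) : poch (-(j : ℝ)) j = (-1) ^ j * j.factorial := by
  induction j with
  | zero => simp [poch_zero]
  | succ j ih =>
    rw [poch_succ_left, show -((j + 1 : ℕ) : ℝ) + 1 = -(j : ℝ) by push_cast; ring, ih,
      Nat.factorial_succ]
    push_cast; ring

/-- At a simple zero the derivative is the product of the other factors, here -j, ..., -1 and 1,
..., l. -/
theorem deriv_poch_sub {c ν : ℝ} (j l : ℕ) (h : ν - c = -(j : ℝ)) :
    deriv (fun t => poch (t - c) (j + 1 + l)) ν = (-1) ^ j * j.factorial * l.factorial := by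
  have hp : ∀ (a : ℝ) (k : ℕ) (s : ℝ), DifferentiableAt ℝ (fun t => poch (t + a) k) s := by
    intro a k s
    have : (fun t => poch (t + a) k) = fun t =>
        (((ascPochhammer ℝ k).comp (Polynomial.X + Polynomial.C a)).eval t) := by
      funext t; simp [poch]
    rw [this]
    exact Polynomial.differentiableAt _
  have heq : (fun t => poch (t - c) (j + 1 + l)) = fun t =>
      (t + (j - c)) * (poch (t + (-c)) j * poch (t + (j + 1 - c)) l) := by
    funext t
    rw [poch_add, poch_succ, ← sub_eq_add_neg]
    push_cast
    rw [show t - c + (j + 1 : ℝ) = t + (j + 1 - c) by ring]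
    ring
  have hd := ((hasDerivAt_id ν).add_const ((j : ℝ) - c)).mul
    (((hp (-c) j ν).hasDerivAt).mul (hp (j + 1 - c) l ν).hasDerivAt)
  rw [heq]
  convert! hd.deriv using 1
  simp only [id, Pi.mul_apply]
  rw [show ν + ((j : ℝ) - c) = 0 by linarith, show ν + -c = -(j : ℝ) by linarith,
    show ν + ((j : ℝ) + 1 - c) = 1 by linarith, poch_neg_self, poch_one]
  ring

theorem poch_shift {t : ℝ} (ht : 0 < t) (k : ℕ) : poch (t + 1) k = poch t k * (t + k) / t := by
  rw [eq_div_iff ht.ne', ← poch_succ, poch_succ_left, mul_comm]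

theorem factorial_add_two (k : ℕ) :
    ((k + 2).factorial : ℝ) = (k + 2) * ((k + 1) * k.factorial) := by
  rw [Nat.factorial_succ, Nat.factorial_succ]; push_cast; ring

theorem factorial_add_one (k : ℕ) : ((k + 1).factorial : ℝ) = (k + 1) * k.factorial := by
  rw [Nat.factorial_succ]; push_cast; ring

theorem ratOrd_pow {d : ℤ} {f : ℝ → ℝ} (h : RatOrd d f) (j : ℕ) :
    RatOrd (d * j) (fun t => f t ^ j) := by
  induction j with
  | zero => simpa using RatOrd.const 1
  | succ j ih =>
    simp only [pow_succ]
    exact (ih.mul h).mono (by push_cast; linarith)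

/-- The part of the certificates for the left-hand series that has no zeros. -/
noncomputable def certLTail (n k l : ℕ) (t : ℝ) : ℝ :=
  poch (t + n + 1) n * poch (t + n + 1) k
    * ((poch t (n + 1))⁻¹ * ((poch t (n + 1))⁻¹ * (poch t (n + 1))⁻¹) * (poch t l)⁻¹)

theorem certLTail_ratOrd (n k l : ℕ) :
    RatOrd ((k : ℤ) - l - 2 * n - 3) (certLTail n k l) := by
  have hE := ratOrd_inv_poch_self (n + 1)
  refine ((((ratOrd_poch (n + 1) n).mul
    (ratOrd_poch (n + 1) k)).mul ((hE.mul (hE.mul hE)).mul (ratOrd_inv_poch_self l)))).mono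
    (by push_cast; linarith) |>.congr fun t ht => ?_
  simp only [← add_assoc, certLTail]

theorem certLTail_shift (n k l : ℕ) {t : ℝ} (ht : 0 < t) :
    certLTail n k l (t + 1) = certLTail n k l t
      * ((t + 2 * n + 1) * (t + n + 1 + k) * t ^ 4 / ((t + n + 1) ^ 5 * (t + l))) := by
  have hn : 0 < t + n + 1 := by positivity
  have hl : 0 < t + l := by positivity
  have h1 := (poch_pos ht (n + 1)).ne'
  have h2 := (poch_pos ht l).ne'
  simp only [certLTail]
  rw [show t + 1 + n + 1 = t + n + 1 + 1 by ring, poch_shift hn, poch_shift hn, poch_shift ht,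
    poch_shift ht]
  push_cast
  field_simp
  ring

/-- The certificate of the recurrence in `m` for the left-hand series. -/
noncomputable def certL (n m k : ℕ) (t : ℝ) : ℝ :=
  poch (t - (n + 1 : ℕ)) (m + 1) * poch (t - (k + 1 : ℕ)) (k + 1)
    * ((t + n) ^ 5 * certLTail n k (k + 2) t)

theorem recA_real (n m : ℕ) : ((recA0 n m : ℚ) : ℝ) = (2 * (n : ℝ) - m) ^ 5
    ∧ ((recA1 n m : ℚ) : ℝ) = -(4 * (n : ℝ) - 2 * m - 1) *
    (6 * (n : ℝ) ^ 4 - 24 * n ^ 3 * m + 22 * n ^ 2 * m ^ 2 - 8 * n * m ^ 3 + m ^ 4 - 24 * n ^ 3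
      + 30 * n ^ 2 * m - 14 * n * m ^ 2 + 2 * m ^ 3 + 8 * n ^ 2 - 10 * n * m + 2 * m ^ 2
      - 4 * n + m)
    ∧ ((recA2 n m : ℚ) : ℝ) = -(2 * (n : ℝ) - m - 1) ^ 3 * (4 * n - m) * (m + 2) := by
  refine ⟨?_, ?_, ?_⟩ <;> simp only [recA0, recA1, recA2] <;> push_cast <;> ring

/-- This is what the telescoping identity becomes once the common hypergeometric factor is removed.
-/
theorem certL_telescope_poly (n m N t : ℝ) (h : m = 2 * n - N) :
    (t + n / 2) * ((2 * n - m) ^ 5 * ((m + 1) * (t - N) * (t - N + 1) * (t + n + N - 1) * (t + n + N))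
      - (-(4 * n - 2 * m - 1) *
    (6 * n ^ 4 - 24 * n ^ 3 * m + 22 * n ^ 2 * m ^ 2 - 8 * n * m ^ 3 + m ^ 4 - 24 * n ^ 3
      + 30 * n ^ 2 * m - 14 * n * m ^ 2 + 2 * m ^ 3 + 8 * n ^ 2 - 10 * n * m + 2 * m ^ 2
      - 4 * n + m)) * (N * (t - n + m) * (t - N + 1) * (t + n + N - 1) * (t + N))
      + (-(2 * n - m - 1) ^ 3 * (4 * n - m)) *
        (N * (N - 1) * (t - n + m) * (t - n + m + 1) * (t + N) * (t + N - 1)))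
    = -(n * (2 * N - 1) * N) * ((t - n + m) * t ^ 5 * (t + 2 * n + 1) * (t + n + N - 1)
      - (t - n - 1) * (t - N + 1) * (t + n) ^ 5 * (t + N)) := by
  subst h
  ring

theorem certLTail_succ (n k l : ℕ) (t : ℝ) :
    certLTail n (k + 1) l t = certLTail n k l t * (t + n + 1 + k) := by
  simp only [certLTail, poch_succ]; ring

theorem certLTail_eq_succ (n k l : ℕ) {t : ℝ} (ht : 0 < t) :
    certLTail n k l t = certLTail n k (l + 1) t * (t + l) := by
  have hl : t + l ≠ 0 := by positivity
  have h2 := (poch_pos ht l).ne'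
  simp only [certLTail, poch_succ]
  field_simp

theorem ratR_eq_tail {n m N : ℕ} (h : m + N = 2 * n) (t : ℝ) : ratR n m t =
    (-1) ^ m * (n.factorial : ℝ) ^ 2 / (m.factorial * N.factorial) * ((t + n / 2)
      * (poch (t - n) m * poch (t - N) N * certLTail n N (N + 1) t)) := by
  rw [ratR_eq h, certLTail]
  ring

theorem poch_sub_succ_left (t : ℝ) (c k : ℕ) :
    poch (t - (c + 1 : ℕ)) (k + 1) = (t - c - 1) * poch (t - c) k := by
  rw [poch_succ_left]
  push_cast
  rw [show t - (c + 1 : ℝ) + 1 = t - c by ring]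
  ring

theorem poch_sub_succ_shift (t : ℝ) (c k : ℕ) :
    poch (t + 1 - (c + 1 : ℕ)) (k + 1) = poch (t - c) k * (t - c + k) := by
  rw [← poch_succ]; congr 1; push_cast; ring

theorem certL_telescope {n m k : ℕ} (h : m + (k + 2) = 2 * n) {t : ℝ} (ht : 0 < t) :
    ((recA0 n m : ℚ) : ℝ) * ratR n m t + ((recA1 n m : ℚ) : ℝ) * ratR n (m + 1) t
      + ((recA2 n m : ℚ) : ℝ) * ratR n (m + 2) t
    = -((-1) ^ m * (n.factorial : ℝ) ^ 2 * (n * (2 * k + 3)) / ((m + 1).factorial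
        * (k + 1).factorial)) * (certL n m k (t + 1) - certL n m k t) := by
  obtain ⟨h0, h1, h2⟩ := recA_real n m
  have hm : (m : ℝ) = 2 * n - (k + 2) := by
    have : (m : ℝ) + (k + 2) = 2 * n := by exact_mod_cast h
    linarith
  have hpoly := certL_telescope_poly n m (k + 2) t hm
  have hm1 : (m : ℝ) + 1 ≠ 0 := by positivity
  have hm2 : (m : ℝ) + 2 ≠ 0 := by positivity
  have hk1 : (k : ℝ) + 1 ≠ 0 := by positivity
  have hk2 : (k : ℝ) + 2 ≠ 0 := by positivity
  have hmf : (m.factorial : ℝ) ≠ 0 := by positivity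
  have hkf : (k.factorial : ℝ) ≠ 0 := by positivity
  -- K combines the shortest numerator and the longest denominator factorials that occur, so every
  -- term below is c * K times a polynomial. The existential keeps c and K opaque to the ring
  -- normalisation.
  obtain ⟨c, hc⟩ : ∃ c : ℝ, c = (-1) ^ m * (n.factorial : ℝ) ^ 2
    / ((m + 1) * m.factorial * ((k + 2) * ((k + 1) * k.factorial))) := ⟨_, rfl⟩
  obtain ⟨K, hK⟩ : ∃ K : ℝ, K = poch (t - n) m * poch (t - k) k * certLTail n k (k + 3) t :=
    ⟨_, rfl⟩
  have r0 : ratR n m t = c * K * ((m + 1) * ((t + n / 2) * ((t - k - 2) * (t - k - 1)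
      * (t + n + 1 + k) * (t + n + 2 + k)))) := by
    rw [ratR_eq_tail h, hc, hK, poch_sub_succ_left, poch_sub_succ_left, certLTail_succ,
      certLTail_succ, factorial_add_two]
    push_cast
    field_simp
    ring
  have r1 : ratR n (m + 1) t = -(c * K * ((k + 2) * ((t + n / 2) * ((t - n + m) * (t - k - 1)
      * (t + n + 1 + k) * (t + k + 2))))) := by
    rw [ratR_eq_tail (show m + 1 + (k + 1) = 2 * n by omega), hc, hK, poch_sub_succ_left,
      certLTail_eq_succ n _ _ ht, certLTail_succ, factorial_add_one, factorial_add_one, poch_succ]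
    push_cast
    field_simp
    ring
  have r2 : ((m : ℝ) + 2) * ratR n (m + 2) t = c * K * ((k + 2) * (k + 1) * ((t + n / 2)
      * ((t - n + m) * (t - n + m + 1) * (t + k + 2) * (t + k + 1)))) := by
    rw [ratR_eq_tail (show m + 2 + k = 2 * n by omega), hc, hK,
      certLTail_eq_succ n _ _ ht, certLTail_eq_succ n _ (k + 1 + 1) ht, factorial_add_two,
      poch_succ, poch_succ]
    push_cast
    field_simp
    ring
  have g0 : certL n m k t = K * ((t - n - 1) * (t - k - 1) * (t + n) ^ 5 * (t + k + 2)) := by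
    rw [certL, hK, poch_sub_succ_left, poch_sub_succ_left, certLTail_eq_succ n _ _ ht]
    push_cast
    ring
  have g1 : certL n m k (t + 1) = K * ((t - n + m) * t ^ 5 * (t + 2 * n + 1) * (t + n + 1 + k)) := by
    have : t + n + 1 ≠ 0 := by positivity
    have : t + k + 2 ≠ 0 := by positivity
    rw [certL, hK, poch_sub_succ_shift, poch_sub_succ_shift, certLTail_shift n _ _ ht,
      certLTail_eq_succ n _ _ ht]
    push_cast
    rw [← add_assoc]
    field_simp
    ring
  have hκ : (-1) ^ m * (n.factorial : ℝ) ^ 2 * (n * (2 * k + 3)) / ((m + 1).factorial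
        * (k + 1).factorial) = c * (n * (2 * k + 3) * (k + 2)) := by
    rw [hc, factorial_add_one, factorial_add_one]
    field_simp
  rw [hκ, g0, g1, h0, h1, h2, r0, r1]
  linear_combination c * K * hpoly + (-(2 * (n : ℝ) - m - 1) ^ 3 * (4 * n - m)) * r2

theorem certL_ratOrd {n m k : ℕ} (h : m + (k + 2) = 2 * n) : RatOrd 0 (certL n m k) :=
  (((ratOrd_poch_sub (n + 1 : ℕ) (m + 1)).mul (ratOrd_poch_sub (k + 1 : ℕ) (k + 1))).mul
    ((ratOrd_pow (RatOrd.linear (n : ℝ)) 5).mul (certLTail_ratOrd n k (k + 2)))).mono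
    (by push_cast; omega)

/-- Here k ≥ n, so both rising factorials with negative shift vanish at n + 1; this is why `Zl_rec`
is homogeneous. -/
theorem deriv_certL {n m k : ℕ} (h : m + (k + 2) = 2 * n) (hm : m + 2 ≤ n) :
    deriv (certL n m k) (n + 1 : ℕ) = 0 :=
  deriv_double_zero (by positivity) (fun _ _ => rfl)
    (poch_sub_eq_zero le_rfl (by omega)) (poch_sub_eq_zero (by omega) (by omega))
    (ratOrd_poch_sub (n + 1 : ℕ) (m + 1)) (ratOrd_poch_sub (k + 1 : ℕ) (k + 1))
    ((ratOrd_pow (RatOrd.linear (n : ℝ)) 5).mul (certLTail_ratOrd n k (k + 2)))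

end LeftRecurrence

/-! ### Relations among the left series within a row, and the polynomial data for changing rows. -/

section LeftRelations

theorem Zl_rec {n m : ℕ} (hm : m + 2 ≤ n) :
    ((recA0 n m : ℚ) : ℝ) * Zl n m + ((recA1 n m : ℚ) : ℝ) * Zl n (m + 1)
      + ((recA2 n m : ℚ) : ℝ) * Zl n (m + 2) = 0 := by
  obtain ⟨k, hk⟩ := Nat.exists_eq_add_of_le (show m + 2 ≤ 2 * n by omega)
  have hk' : m + (k + 2) = 2 * n := by omega
  have h := sum_deriv_telescope (ratOrd_ratR hk')
    (ratOrd_ratR (show m + 1 + (k + 1) = 2 * n by omega))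
    (ratOrd_ratR (show m + 2 + k = 2 * n by omega)) (certL_ratOrd hk') (by norm_num)
    (by norm_num) (by norm_num) (fun t ht => certL_telescope hk' ht) (k := n + 1) (by omega)
    (hasSum_deriv_ratR (by omega) (by omega) (by omega))
    (hasSum_deriv_ratR (by omega) (by omega) (by omega))
    (hasSum_deriv_ratR (by omega) (by omega) (by omega))
  rw [deriv_certL hk' hm] at h
  linear_combination (-1 / 3) * h

/-- The certificate relating `m = 0` and `m = 1`. -/
noncomputable def certLOne (n k : ℕ) (t : ℝ) : ℝ :=
  poch (t - (k + 1 : ℕ)) (k + 1) * ((t + n) ^ 5 * certLTail n k (k + 1 + 1) t)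

theorem certLOne_ratOrd {n k : ℕ} (h : k + 1 = 2 * n) : RatOrd 0 (certLOne n k) :=
  ((ratOrd_poch_sub (k + 1 : ℕ) (k + 1)).mul
    ((ratOrd_pow (RatOrd.linear (n : ℝ)) 5).mul (certLTail_ratOrd n k (k + 1 + 1)))).mono
    (by push_cast; omega)

/-- The dummy summand with coefficient 0 brings this two-term relation into the three-term shape of
`sum_deriv_telescope`. -/
theorem certLOne_telescope {n k : ℕ} (h : k + 1 = 2 * n) {t : ℝ} (ht : 0 < t) :
    (3 * n / 4 : ℝ) * ratR n 0 t + 1 * ratR n 1 t + 0 * ratR n 0 t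
    = -((n.factorial : ℝ) ^ 2 / ((2 * n).factorial * (8 * n ^ 2)))
      * (certLOne n k (t + 1) - certLOne n k t) := by
  have hn : 0 < n := by omega
  have hn0 : (n : ℝ) ≠ 0 := by positivity
  have hk1 : (k : ℝ) + 1 ≠ 0 := by positivity
  have hkf : (k.factorial : ℝ) ≠ 0 := by positivity
  have hkn : (k : ℝ) = 2 * n - 1 := by
    have : (k : ℝ) + 1 = 2 * n := by exact_mod_cast h
    linarith
  obtain ⟨c, hc⟩ : ∃ c : ℝ, c = (n.factorial : ℝ) ^ 2 / ((k + 1) * k.factorial) := ⟨_, rfl⟩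
  obtain ⟨K, hK⟩ : ∃ K : ℝ, K = poch (t - k) k * certLTail n k (k + 1 + 1) t :=
    ⟨_, rfl⟩
  have r0 : ratR n 0 t = c * K * ((t + n / 2) * ((t - k - 1) * (t + n + 1 + k))) := by
    rw [ratR_eq_tail (show 0 + (k + 1) = 2 * n by omega), hc, hK, poch_sub_succ_left,
      certLTail_succ, factorial_add_one, poch_zero]
    simp only [pow_zero, Nat.factorial_zero]
    push_cast
    field_simp
  have r1 : ratR n 1 t = -(c * K * ((k + 1) * ((t + n / 2) * ((t - n) * (t + k + 1))))) := by
    rw [ratR_eq_tail (show 1 + k = 2 * n by omega), hc, hK,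
      certLTail_eq_succ n _ _ ht, poch_one_right, pow_one, Nat.factorial_one]
    push_cast
    field_simp
    ring
  have g0 : certLOne n k t = K * ((t - k - 1) * (t + n) ^ 5) := by
    rw [certLOne, hK, poch_sub_succ_left]
    ring
  have g1 : certLOne n k (t + 1) = K * (t ^ 5 * (t + 2 * n + 1) * (t + n + 1 + k) / (t + k + 2)) := by
    have : t + n + 1 ≠ 0 := by positivity
    have : t + k + 2 ≠ 0 := by positivity
    rw [certLOne, hK, poch_sub_succ_shift, certLTail_shift n _ _ ht]
    push_cast
    rw [show t + 1 + (n : ℝ) = t + n + 1 by ring, show t + ((k : ℝ) + 1 + 1) = t + k + 2 by ring]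
    field_simp
    ring
  have hκ : (n.factorial : ℝ) ^ 2 / ((2 * n).factorial * (8 * n ^ 2)) = c / (8 * n ^ 2) := by
    rw [hc, ← h, factorial_add_one]
    field_simp
  rw [hκ, g0, g1, r0, r1, hkn]
  have : t + 2 * n + 1 ≠ 0 := by positivity
  rw [show t + (2 * (n : ℝ) - 1) + 2 = t + 2 * n + 1 by ring]
  field_simp
  ring

theorem hypB_real (n : ℕ) : ((hypB n : ℚ) : ℝ)
    = (-1) ^ n * (4 * n).factorial * (n.factorial : ℝ) ^ 8 / ((2 * n).factorial : ℝ) ^ 6 := by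
  have h1 : ((4 * n).choose (2 * n) : ℝ) = (4 * n).factorial / ((2 * n).factorial : ℝ) ^ 2 := by
    rw [Nat.cast_choose ℝ (by omega), show 4 * n - 2 * n = 2 * n by omega, sq]
  have h2 : ((2 * n).choose n : ℝ) = (2 * n).factorial / (n.factorial : ℝ) ^ 2 := by
    rw [Nat.cast_choose ℝ (by omega), show 2 * n - n = n by omega, sq]
  have h3 : ((2 * n).factorial : ℝ) ≠ 0 := by positivity
  have h4 : (n.factorial : ℝ) ≠ 0 := by positivity
  rw [hypB]
  push_cast
  rw [h1, h2]
  field_simp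

theorem certLTail_at (n k l : ℕ) : certLTail n k l ((n + 1 : ℕ) : ℝ)
    = (3 * n + 1).factorial * (2 * n + 1 + k).factorial * (n.factorial : ℝ) ^ 4
      / (((2 * n + 1).factorial : ℝ) ^ 5 * (n + l).factorial) := by
  have h1 : ((2 * n + 1).factorial : ℝ) ≠ 0 := by positivity
  have h2 : (n.factorial : ℝ) ≠ 0 := by positivity
  have h3 : ((n + l).factorial : ℝ) ≠ 0 := by positivity
  rw [certLTail, show (((n + 1 : ℕ) : ℝ) + n + 1) = ((2 * n + 1 : ℕ) : ℝ) + 1 by push_cast; ring,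
    show (((n + 1 : ℕ) : ℝ)) = (n : ℝ) + 1 by push_cast; ring, poch_natCast_succ, poch_natCast_succ, poch_natCast_succ, poch_natCast_succ,
    show 2 * n + 1 + n = 3 * n + 1 by ring, show n + (n + 1) = 2 * n + 1 by ring]
  field_simp

/-- The certificate has only one vanishing factor at n + 1; its derivative there is a product of
factorials, namely a rational multiple of `hypB`. -/
theorem Zl_one {n : ℕ} (hn : 0 < n) :
    (3 * n / 4 : ℝ) * Zl n 0 + Zl n 1 = ((hypB n : ℚ) : ℝ) / (24 * n ^ 3) := by
  obtain ⟨k, hk⟩ := Nat.exists_eq_add_of_le (show 1 ≤ 2 * n by omega)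
  have hk' : k + 1 = 2 * n := by omega
  have h := sum_deriv_telescope (ratOrd_ratR (show 0 + 2 * n = 2 * n by omega))
    (ratOrd_ratR (show 1 + k = 2 * n by omega)) (ratOrd_ratR (show 0 + 2 * n = 2 * n by omega))
    (certLOne_ratOrd hk') (by norm_num)
    (by norm_num) (by norm_num) (fun t ht => certLOne_telescope hk' ht) (k := n + 1) (by omega)
    (hasSum_deriv_ratR (by omega) (by omega) (by omega))
    (hasSum_deriv_ratR (by omega) (by omega) (by omega))
    (hasSum_deriv_ratR (by omega) (by omega) (by omega))
  -- At t = j + 2 the vanishing factor of (t - 2j - 2)_(2j+2) is preceded by j factors and followed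
  -- by j + 1, the shape required by `deriv_poch_sub`.
  obtain ⟨j, rfl⟩ : ∃ j, n = j + 1 := ⟨n - 1, by omega⟩
  have hd : deriv (certLOne (j + 1) k) ((j + 1 + 1 : ℕ) : ℝ)
      = deriv (fun t => poch (t - (k + 1 : ℕ)) (k + 1)) ((j + 1 + 1 : ℕ) : ℝ)
        * ((((j + 1 + 1 : ℕ) : ℝ) + (j + 1 : ℕ)) ^ 5
          * certLTail (j + 1) k (k + 1 + 1) ((j + 1 + 1 : ℕ) : ℝ)) :=
    deriv_simple_zero (by positivity) (fun _ _ => rfl)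
      (poch_sub_eq_zero (by omega) (by omega)) (ratOrd_poch_sub (k + 1 : ℕ) (k + 1))
      ((ratOrd_pow (RatOrd.linear ((j + 1 : ℕ) : ℝ)) 5).mul (certLTail_ratOrd (j + 1) k (k + 1 + 1)))
  obtain rfl : k = 2 * j + 1 := by omega
  rw [hd, certLTail_at, show deriv (fun t => poch (t - (2 * j + 1 + 1 : ℕ)) (2 * j + 1 + 1))
      ((j + 1 + 1 : ℕ) : ℝ) = (-1) ^ j * j.factorial * (j + 1).factorial by
    rw [show 2 * j + 1 + 1 = j + 1 + (j + 1) by omega]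
    exact deriv_poch_sub j (j + 1) (by push_cast; ring)] at h
  have e1 : ((2 * (j + 1) + 1).factorial : ℝ) = (2 * j + 3) * (2 * (j + 1)).factorial := by
    rw [factorial_add_one]; push_cast; ring
  rw [e1, show 2 * (j + 1) + 1 + (2 * j + 1) = 4 * (j + 1) by omega,
    show 3 * (j + 1) + 1 = 3 * j + 4 by omega,
    show j + 1 + (2 * j + 1 + 1 + 1) = 3 * j + 4 by omega] at h
  have f1 : ((2 * (j + 1)).factorial : ℝ) ≠ 0 := by positivity
  have f2 : (j.factorial : ℝ) ≠ 0 := by positivity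
  have f3 : ((3 * j + 4).factorial : ℝ) ≠ 0 := by positivity
  have f4 : (2 * (j : ℝ) + 3) ≠ 0 := by positivity
  have f5 : ((j : ℝ) + 1) ≠ 0 := by positivity
  trans (-1 / 3 : ℝ) * (3 * ((j + 1 : ℕ) : ℝ) / 4 * (-3 * Zl (j + 1) 0)
    + 1 * (-3 * Zl (j + 1) 1) + 0 * (-3 * Zl (j + 1) 0))
  · ring
  rw [h, hypB_real, pow_succ (-1 : ℝ) j, factorial_add_one j]
  push_cast
  rw [show (j : ℝ) + 1 + 1 + (j + 1) = 2 * j + 3 by ring]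
  field_simp
  ring

/-- The polynomial factor of the certificate of the relation between the rows `n` and `n + 1`. -/
def rowPoly (n N t : ℝ) : ℝ :=
  (12 * n ^ 5 + 33 * n ^ 4 * N + 33 * n ^ 4 + 33 * n ^ 3 * N ^ 2 + 65 * n ^ 3 * N + 32 * n ^ 3
    + 32 * n ^ 2 * N ^ 2 + 45 * n ^ 2 * N + 13 * n ^ 2 + 13 * n * N ^ 2 + 15 * n * N + 2 * n
    + 2 * N ^ 2 + 2 * N)
  + (27 * n ^ 4 + 67 * n ^ 3 * N + 68 * n ^ 3 + 67 * n ^ 2 * N ^ 2 + 105 * n ^ 2 * N + 57 * n ^ 2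
    + 38 * n * N ^ 2 + 45 * n * N + 18 * n + 7 * N ^ 2 + 7 * N + 2) * t
  + (20 * n ^ 3 + 48 * n ^ 2 * N + 45 * n ^ 2 + 48 * n * N ^ 2 + 60 * n * N + 30 * n + 12 * N ^ 2
    + 12 * N + 5) * t ^ 2
  + (5 * n ^ 2 + 12 * n * N + 10 * n + 12 * N ^ 2 + 12 * N + 5) * t ^ 3

/-- The coefficient of `Z(n, m)` in the relation giving `Z(n + 1, m + 2)`. -/
def rowCoefA (n N : ℝ) : ℝ :=
  2 * n ^ 4 + 7 * n ^ 3 * N + 8 * n ^ 3 + 12 * n ^ 2 * N ^ 2 + 21 * n ^ 2 * N + 12 * n ^ 2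
    + 12 * n * N ^ 3 + 24 * n * N ^ 2 + 21 * n * N + 8 * n + 6 * N ^ 4 + 12 * N ^ 3 + 12 * N ^ 2
    + 7 * N + 2

/-- The step from (n, m) to (n + 1, m + 2) preserves N, so (t - N)_N and (t)_(N+1) are the same in
both rows. After division by the common factor, a certificate with a cubic polynomial in t suffices.
-/
theorem row_poly_identity (n m N t : ℝ) (h : m = 2 * n - N) :
    2 * (n + 1) ^ 5 * ((t + (n + 1) / 2) * (t - n - 1) * (t - n + m) * (t - N) * (t + 2 * n + 1)
      * (t + 2 * n + 2) * (t + n + N) * (t + n + N + 1))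
    + 2 * (t + n + 1) ^ 5 * (t + n / 2) * (rowCoefA n N * (m + 1) * (t - N) * (t + n + N)
      - -(6 * N ^ 3 * (2 * n + N + 1)) * N * (t - n + m) * (t + N))
    = t ^ 5 * (t - n + m) * (t + 2 * n + 1) * (t + n + N) * rowPoly n N (t + 1)
      - (t + n + 1) ^ 5 * (t - N) * (t - n - 1) * (t + N) * rowPoly n N t := by
  subst h
  rw [rowCoefA, rowPoly, rowPoly]
  ring

end LeftRelations

/-! ### Relations between the rows n and n + 1 for the left series. -/

section RowRelation

theorem certLTail_row (n k l : ℕ) {t : ℝ} (ht : 0 < t) :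
    certLTail (n + 1) k l t = certLTail n k l t * ((t + 2 * n + 1) * (t + 2 * n + 2)
      * (t + n + 1 + k) / (t + n + 1) ^ 5) := by
  have hn : 0 < t + n + 1 := by positivity
  have h1 := (poch_pos ht (n + 1)).ne'
  have h2 := (poch_pos ht l).ne'
  simp only [certLTail]
  rw [show t + ((n + 1 : ℕ) : ℝ) + 1 = t + n + 1 + 1 by push_cast; ring, poch_shift hn,
    poch_shift hn, poch_succ _ n, poch_succ t (n + 1)]
  have h3 : t + ((n + 1 : ℕ) : ℝ) = t + n + 1 := by push_cast; ring
  rw [h3]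
  push_cast
  field_simp
  ring

theorem rowPoly_ratOrd (n N : ℝ) : RatOrd 3 (rowPoly n N) := by
  have h1 : RatOrd 1 fun t : ℝ => t := by simpa using RatOrd.linear 0
  exact (((((RatOrd.const _).mono (by norm_num)).add ((h1.const_mul _).mono (by norm_num))).add
    (((ratOrd_pow h1 2).const_mul _).mono (by norm_num))).add
    (((ratOrd_pow h1 3).const_mul _).mono (by norm_num))).congr fun t _ => by rw [rowPoly]

/-- The certificate of the relation between the rows `n` and `n + 1`, left-hand series. -/
noncomputable def certRow (n m k : ℕ) (t : ℝ) : ℝ :=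
  poch (t - (n + 1 : ℕ)) (m + 1) * poch (t - (k + 1 : ℕ)) (k + 1)
    * (rowPoly n (k + 1) t * certLTail n k (k + 1) t)

theorem certRow_ratOrd {n m k : ℕ} (h : m + (k + 1) = 2 * n) : RatOrd 0 (certRow n m k) :=
  (((ratOrd_poch_sub (n + 1 : ℕ) (m + 1)).mul (ratOrd_poch_sub (k + 1 : ℕ) (k + 1))).mul
    ((rowPoly_ratOrd n (k + 1)).mul (certLTail_ratOrd n k (k + 1)))).mono
    (by push_cast; omega)

theorem deriv_certRow {n m k : ℕ} (h : m + (k + 1) = 2 * n) (hm : m + 1 ≤ n) :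
    deriv (certRow n m k) (n + 1 : ℕ) = 0 :=
  deriv_double_zero (by positivity) (fun _ _ => rfl)
    (poch_sub_eq_zero le_rfl (by omega)) (poch_sub_eq_zero (by omega) (by omega))
    (ratOrd_poch_sub (n + 1 : ℕ) (m + 1)) (ratOrd_poch_sub (k + 1 : ℕ) (k + 1))
    ((rowPoly_ratOrd n (k + 1)).mul (certLTail_ratOrd n k (k + 1)))

set_option maxHeartbeats 1000000 in
theorem certRow_telescope {n m k : ℕ} (h : m + (k + 1) = 2 * n) {t : ℝ} (ht : 0 < t) :
    ((n + 1) ^ 3 * (m + 2) : ℝ) * ratR (n + 1) (m + 2) t + rowCoefA n (k + 1) * ratR n m t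
      + -(6 * (k + 1) ^ 3 * (2 * n + (k + 1) + 1) : ℝ) * ratR n (m + 1) t
    = ((-1) ^ m * (n.factorial : ℝ) ^ 2 / (2 * ((m + 1).factorial * (k + 1).factorial)))
      * (certRow n m k (t + 1) - certRow n m k t) := by
  have hm : (m : ℝ) = 2 * n - (k + 1) := by
    have : (m : ℝ) + (k + 1) = 2 * n := by exact_mod_cast h
    linarith
  have hpoly := row_poly_identity n m (k + 1) t hm
  have hm1 : (m : ℝ) + 1 ≠ 0 := by positivity
  have hm2 : (m : ℝ) + 2 ≠ 0 := by positivity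
  have hk1 : (k : ℝ) + 1 ≠ 0 := by positivity
  have hmf : (m.factorial : ℝ) ≠ 0 := by positivity
  have hkf : (k.factorial : ℝ) ≠ 0 := by positivity
  have hn1 : t + n + 1 ≠ 0 := by positivity
  obtain ⟨c, hc⟩ : ∃ c : ℝ, c = (-1) ^ m * (n.factorial : ℝ) ^ 2
    / ((m + 1) * m.factorial * ((k + 1) * k.factorial)) := ⟨_, rfl⟩
  obtain ⟨K, hK⟩ : ∃ K : ℝ, K = poch (t - n) m * poch (t - k) k * certLTail n k (k + 2) t
    / (t + n + 1) ^ 5 := ⟨_, rfl⟩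
  have r0 : ratR n m t = c * K * ((t + n + 1) ^ 5 * ((m + 1) * ((t + n / 2) * ((t - k - 1)
      * (t + n + 1 + k))))) := by
    rw [ratR_eq_tail h, hc, hK, poch_sub_succ_left, certLTail_succ, factorial_add_one]
    field_simp
  have r1 : ratR n (m + 1) t = -(c * K * ((t + n + 1) ^ 5 * ((k + 1) * ((t + n / 2)
      * ((t - n + m) * (t + k + 1)))))) := by
    rw [ratR_eq_tail (show m + 1 + k = 2 * n by omega), hc, hK,
      certLTail_eq_succ n _ _ ht, factorial_add_one, poch_succ]
    push_cast
    field_simp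
    ring
  have r2 : ((m : ℝ) + 2) * ratR (n + 1) (m + 2) t = c * K * ((n + 1) ^ 2 * ((t + (n + 1) / 2)
      * ((t - n - 1) * (t - n + m) * (t - k - 1) * (t + 2 * n + 1) * (t + 2 * n + 2)
        * (t + n + 1 + k) * (t + n + k + 2)))) := by
    rw [ratR_eq_tail (show m + 2 + (k + 1) = 2 * (n + 1) by omega), hc, hK,
      poch_sub_succ_left, poch_sub_succ_left, certLTail_row n _ _ ht, certLTail_succ,
      factorial_add_two, factorial_add_one, factorial_add_one, poch_succ]
    push_cast
    field_simp
    ring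
  have g0 : certRow n m k t = K * ((t + n + 1) ^ 5 * (t - (k + 1)) * (t - n - 1) * (t + (k + 1))
      * rowPoly n (k + 1) t) := by
    rw [certRow, hK, poch_sub_succ_left, poch_sub_succ_left, certLTail_eq_succ n _ _ ht]
    push_cast
    field_simp
    ring
  have g1 : certRow n m k (t + 1) = K * (t ^ 5 * (t - n + m) * (t + 2 * n + 1) * (t + n + (k + 1))
      * rowPoly n (k + 1) (t + 1)) := by
    have h2 : t + ((k + 1 : ℕ) : ℝ) ≠ 0 := by positivity
    rw [certRow, hK, poch_sub_succ_shift, poch_sub_succ_shift, certLTail_shift n _ _ ht,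
      certLTail_eq_succ n _ _ ht]
    field_simp
    ring
  have hκ : (-1) ^ m * (n.factorial : ℝ) ^ 2 / (2 * ((m + 1).factorial * (k + 1).factorial))
      = c / 2 := by
    rw [hc, factorial_add_one, factorial_add_one]
    field_simp
  rw [hκ, g0, g1, r0, r1]
  linear_combination c * K / 2 * hpoly + ((n : ℝ) + 1) ^ 3 * r2

theorem Zl_row {n m k : ℕ} (h : m + (k + 1) = 2 * n) (hm : m + 1 ≤ n) :
    ((n + 1) ^ 3 * (m + 2) : ℝ) * Zl (n + 1) (m + 2) + rowCoefA n (k + 1) * Zl n m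
      + -(6 * (k + 1) ^ 3 * (2 * n + (k + 1) + 1) : ℝ) * Zl n (m + 1) = 0 := by
  have h := sum_deriv_telescope (ratOrd_ratR (show m + 2 + (k + 1) = 2 * (n + 1) by omega))
    (ratOrd_ratR h) (ratOrd_ratR (show m + 1 + k = 2 * n by omega)) (certRow_ratOrd h)
    (by norm_num)
    (by norm_num) (by norm_num) (fun t ht => certRow_telescope h ht) (k := n + 1) (by omega)
    (hasSum_deriv_ratR (by omega) (by omega) (by omega))
    (hasSum_deriv_ratR (by omega) (by omega) (by omega))
    (hasSum_deriv_ratR (by omega) (by omega) (by omega))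
  rw [deriv_certRow (by assumption) hm] at h
  linear_combination (-1 / 3) * h

/-- The certificate of the relation giving `Z(n + 1, 1)` from `Z(n, 0)`. -/
noncomputable def certRowZero (n : ℕ) (t : ℝ) : ℝ :=
  poch (t - (2 * n + 1 : ℕ)) (2 * n + 1)
    * (rowPoly n (2 * n + 1) t * certLTail n (2 * n) (2 * n + 1) t)

theorem certRowZero_ratOrd (n : ℕ) : RatOrd 0 (certRowZero n) :=
  ((ratOrd_poch_sub (2 * n + 1 : ℕ) (2 * n + 1)).mul
    ((rowPoly_ratOrd n (2 * n + 1)).mul (certLTail_ratOrd n (2 * n) (2 * n + 1)))).mono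
    (by push_cast; omega)

/-- This is the formal case m = -1, N = 2n + 1 of the row relation, in which the term with index (n,
m) drops out (formally 1/m! = 0). -/
theorem certRowZero_telescope (n : ℕ) {t : ℝ} (ht : 0 < t) :
    ((n + 1) ^ 3 : ℝ) * ratR (n + 1) 1 t + -(12 * (2 * n + 1) ^ 4 : ℝ) * ratR n 0 t
      + 0 * ratR n 0 t
    = -((n.factorial : ℝ) ^ 2 / (2 * (2 * n + 1).factorial))
      * (certRowZero n (t + 1) - certRowZero n t) := by
  have hk1 : 2 * (n : ℝ) + 1 ≠ 0 := by positivity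
  have hkf : ((2 * n).factorial : ℝ) ≠ 0 := by positivity
  have hn1 : t + n + 1 ≠ 0 := by positivity
  have h2 : t + 2 * n + 1 ≠ 0 := by positivity
  obtain ⟨c, hc⟩ : ∃ c : ℝ, c = (n.factorial : ℝ) ^ 2 / ((2 * n + 1) * (2 * n).factorial) :=
    ⟨_, rfl⟩
  obtain ⟨K, hK⟩ : ∃ K : ℝ, K = poch (t - (2 * n : ℕ)) (2 * n) * certLTail n (2 * n) (2 * n + 2) t
    / (t + n + 1) ^ 5 := ⟨_, rfl⟩
  have r0 : ratR n 0 t = c * K * ((t + n + 1) ^ 5 * ((2 * n + 1) * ((t + n / 2)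
      * (t + 2 * n + 1)))) := by
    rw [ratR_eq_tail (show 0 + 2 * n = 2 * n by omega), hc, hK,
      certLTail_eq_succ n _ _ ht, poch_zero, pow_zero, Nat.factorial_zero]
    push_cast
    field_simp
    ring
  have r1 : ratR (n + 1) 1 t = -(c * K * ((n + 1) ^ 2 * ((t + (n + 1) / 2)
      * ((t - n - 1) * (t - 2 * n - 1) * (t + 2 * n + 1) * (t + 2 * n + 2)
        * (t + 3 * n + 1) * (t + 3 * n + 2))))) := by
    rw [ratR_eq_tail (show 1 + (2 * n + 1) = 2 * (n + 1) by omega), hc, hK,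
      poch_sub_succ_left, poch_sub_succ_left, poch_zero, certLTail_row n _ _ ht, certLTail_succ,
      factorial_add_one n, factorial_add_one (2 * n), pow_one, Nat.factorial_one]
    push_cast
    field_simp
    ring
  have g0 : certRowZero n t = K * ((t + n + 1) ^ 5 * (t - 2 * n - 1) * (t + 2 * n + 1)
      * rowPoly n (2 * n + 1) t) := by
    rw [certRowZero, hK, poch_sub_succ_left, certLTail_eq_succ n _ _ ht]
    push_cast
    field_simp
    ring
  have g1 : certRowZero n (t + 1) = K * (t ^ 5 * (t + 2 * n + 1) * (t + 3 * n + 1)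
      * rowPoly n (2 * n + 1) (t + 1)) := by
    rw [certRowZero, hK, poch_sub_succ_shift, certLTail_shift n _ _ ht,
      certLTail_eq_succ n _ _ ht]
    push_cast
    rw [← add_assoc]
    field_simp
    ring
  have hκ : (n.factorial : ℝ) ^ 2 / (2 * (2 * n + 1).factorial) = c / 2 := by
    rw [hc, factorial_add_one]
    push_cast
    field_simp
  rw [hκ, g0, g1, r0, r1, rowPoly, rowPoly]
  ring

/-- For m = -1 the factor (t - n - 1)_(m+1) is empty, so one of the two zeros at n + 1 is lost and a
boundary term remains. -/
theorem Zl_rowZero (n : ℕ) :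
    ((n + 1) ^ 3 : ℝ) * Zl (n + 1) 1 - (12 * (2 * n + 1) ^ 4 : ℝ) * Zl n 0
      = -(((hypB n : ℚ) : ℝ) * (4 * n + 1) / (6 * (2 * n + 1) ^ 6))
        * rowPoly n (2 * n + 1) (n + 1) := by
  have h := sum_deriv_telescope (ratOrd_ratR (show 1 + (2 * n + 1) = 2 * (n + 1) by omega))
    (ratOrd_ratR (show 0 + 2 * n = 2 * n by omega)) (ratOrd_ratR (show 0 + 2 * n = 2 * n by omega))
    (certRowZero_ratOrd n) (by norm_num)
    (by norm_num) (by norm_num) (fun t ht => certRowZero_telescope n ht) (k := n + 1) (by omega)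
    (hasSum_deriv_ratR (by omega) (by omega) (by omega))
    (hasSum_deriv_ratR (by omega) (by omega) (by omega))
    (hasSum_deriv_ratR (by omega) (by omega) (by omega))
  have hd : deriv (certRowZero n) ((n + 1 : ℕ) : ℝ)
      = deriv (fun t => poch (t - (2 * n + 1 : ℕ)) (2 * n + 1)) ((n + 1 : ℕ) : ℝ)
        * (rowPoly n (2 * n + 1) ((n + 1 : ℕ) : ℝ)
          * certLTail n (2 * n) (2 * n + 1) ((n + 1 : ℕ) : ℝ)) :=
    deriv_simple_zero (by positivity) (fun _ _ => rfl)
      (poch_sub_eq_zero (by omega) (by omega)) (ratOrd_poch_sub (2 * n + 1 : ℕ) (2 * n + 1))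
      ((rowPoly_ratOrd n (2 * n + 1)).mul (certLTail_ratOrd n (2 * n) (2 * n + 1)))
  rw [hd, certLTail_at, show deriv (fun t => poch (t - (2 * n + 1 : ℕ)) (2 * n + 1))
      ((n + 1 : ℕ) : ℝ) = (-1) ^ n * n.factorial * n.factorial by
    rw [show 2 * n + 1 = n + 1 + n by omega]
    exact deriv_poch_sub n n (by push_cast; ring),
    show 2 * n + 1 + 2 * n = 4 * n + 1 by omega, show n + (2 * n + 1) = 3 * n + 1 by omega,
    factorial_add_one (2 * n), factorial_add_one (4 * n)] at h
  have f1 : ((2 * n).factorial : ℝ) ≠ 0 := by positivity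
  have f2 : (n.factorial : ℝ) ≠ 0 := by positivity
  have f3 : ((3 * n + 1).factorial : ℝ) ≠ 0 := by positivity
  have f4 : (2 * (n : ℝ) + 1) ≠ 0 := by positivity
  trans (-1 / 3 : ℝ) * (((n + 1) ^ 3 : ℝ) * (-3 * Zl (n + 1) 1)
    + -(12 * (2 * n + 1) ^ 4 : ℝ) * (-3 * Zl n 0) + 0 * (-3 * Zl n 0))
  · ring
  rw [h, hypB_real]
  push_cast
  field_simp
  ring

end RowRelation

/-! ### The closed form of the left series. -/

section ClosedForm

/-- The transcendental part of the closed form. -/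
noncomputable def transPart (n : ℕ) : ℝ :=
  (hypA n : ℝ) * (30720 * zetaFour + ∑ k ∈ Icc 4 9, (weightU k : ℝ) * (nestedU k n : ℝ))

/-- The closed form of both series. -/
noncomputable def closedForm (n m : ℕ) : ℝ :=
  (ratP n m : ℝ) * transPart n + (ratQ n m : ℝ) * (hypB n : ℝ)

theorem closedForm_eq (n m : ℕ) : closedForm n m = (coefZeta n m : ℝ) * zetaFour
    + ∑ k ∈ Icc 4 9, (coefU k n m : ℝ) * (nestedU k n : ℝ) + (coefOne n m : ℝ) := by
  have : ∑ k ∈ Icc 4 9, (coefU k n m : ℝ) * (nestedU k n : ℝ)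
      = (ratP n m * hypA n : ℝ) * ∑ k ∈ Icc 4 9, (weightU k : ℝ) * (nestedU k n : ℝ) := by
    rw [Finset.mul_sum]
    refine Finset.sum_congr rfl fun k _ => ?_
    rw [coefU]
    push_cast
    ring
  rw [this, closedForm, transPart, coefZeta, coefOne]
  push_cast
  ring

theorem hypB_succ (n : ℕ) : (hypB (n + 1) : ℝ)
    = -((n + 1) ^ 3 * (4 * n + 3) * (4 * n + 1) / (8 * (2 * n + 1) ^ 5)) * hypB n := by
  have f1 : ((2 * n).factorial : ℝ) ≠ 0 := by positivity
  have f4 : (2 * (n : ℝ) + 1) ≠ 0 := by positivity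
  have f5 : (n : ℝ) + 1 ≠ 0 := by positivity
  rw [hypB_real, hypB_real, show 4 * (n + 1) = 4 * n + 1 + 1 + 1 + 1 by ring,
    show 2 * (n + 1) = 2 * n + 1 + 1 by ring]
  simp only [factorial_add_one, pow_succ (-1 : ℝ) n]
  push_cast
  rw [show (2 * (n : ℝ) + 1 + 1) = 2 * (n + 1) by ring,
    show (4 * (n : ℝ) + 3 + 1) = 4 * (n + 1) by ring,
    show (4 * (n : ℝ) + 2 + 1) = 4 * n + 3 by ring,
    show (4 * (n : ℝ) + 1 + 1 ) = 2 * (2 * n + 1) by ring]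
  field_simp
  ring

theorem hypA_succ (n : ℕ) : (hypA (n + 1) : ℝ)
    = -(16 * (2 * n + 1) ^ 4 / (n + 1) ^ 4) * hypA n := by
  have h : ((n + 1 : ℕ) : ℝ) * ((2 * (n + 1)).choose (n + 1) : ℝ)
      = 2 * (2 * n + 1) * ((2 * n).choose n : ℝ) := by
    have := Nat.succ_mul_centralBinom_succ n
    simp only [Nat.centralBinom] at this
    exact_mod_cast this
  have f5 : (n : ℝ) + 1 ≠ 0 := by positivity
  have h' : ((2 * (n + 1)).choose (n + 1) : ℝ) = 2 * (2 * n + 1) * ((2 * n).choose n : ℝ) / (n + 1) := by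
    rw [← h]; push_cast; field_simp
  rw [hypA, hypA]
  push_cast
  rw [h']
  field_simp
  ring

/-- This links the two hypergeometric products: a new summand of a nested sum, multiplied by `hypA`,
is a rational multiple of `hypB`. -/
theorem hypA_mul_summand (k n : ℕ) : (hypA n : ℝ) * ((((4 * n).choose (2 * n) : ℚ)
    / ((2 * (n : ℚ) + 1) ^ k * ((2 * n).choose n : ℚ) ^ 8) : ℚ) : ℝ)
    = (hypB n : ℝ) / (2 * n + 1) ^ k := by
  have h : ((2 * n).choose n : ℝ) ≠ 0 := by
    exact_mod_cast (Nat.choose_pos (by omega)).ne'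
  have f4 : (2 * (n : ℝ) + 1) ≠ 0 := by positivity
  rw [hypA, hypB]
  push_cast
  field_simp

theorem sum_weightU (f : ℕ → ℝ) : ∑ k ∈ Icc 4 9, (weightU k : ℝ) * f k
    = -27300 * f 4 - 12140 * f 5 + 2045 * f 6 + 3095 * f 7 + 955 * f 8 + 105 * f 9 := by
  rw [show Icc 4 9 = ({4, 5, 6, 7, 8, 9} : Finset ℕ) by rfl]
  simp [weightU]
  ring

theorem transPart_succ (n : ℕ) : transPart (n + 1)
    = -(16 * (2 * n + 1) ^ 4 / (n + 1) ^ 4) * transPart n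
      + hypB (n + 1) * (-27300 / (2 * n + 3) ^ 4 - 12140 / (2 * n + 3) ^ 5 + 2045 / (2 * n + 3) ^ 6
        + 3095 / (2 * n + 3) ^ 7 + 955 / (2 * n + 3) ^ 8 + 105 / (2 * n + 3) ^ 9) := by
  have hU : ∀ k, (hypA (n + 1) : ℝ) * (nestedU k (n + 1) : ℝ)
      = -(16 * (2 * n + 1) ^ 4 / (n + 1) ^ 4) * hypA n * (nestedU k n : ℝ)
        + hypB (n + 1) / (2 * n + 3) ^ k := by
    intro k
    have h := hypA_mul_summand k (n + 1)
    rw [nestedU, Finset.sum_range_succ, ← nestedU, Rat.cast_add, mul_add, h, hypA_succ]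
    push_cast
    rw [show 2 * ((n : ℝ) + 1) + 1 = 2 * n + 3 by ring]
  have e : ∀ j, transPart j = 30720 * zetaFour * hypA j + ∑ k ∈ Icc 4 9, (weightU k : ℝ)
      * (hypA j * (nestedU k j : ℝ)) := by
    intro j
    rw [transPart, mul_add, Finset.mul_sum]
    congr 1
    · ring
    · exact Finset.sum_congr rfl fun k _ => by ring
  rw [e, e, sum_weightU, sum_weightU]
  simp only [hU]
  rw [hypA_succ]
  ring

theorem zetaFour_hasSum : HasSum (fun i : ℕ => 1 / ((i + 1 : ℕ) : ℝ) ^ 4) zetaFour := by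
  have h1 : Summable fun i : ℕ => 1 / (i : ℝ) ^ 4 :=
    Real.summable_one_div_nat_pow.2 (by norm_num)
  have h2 := (summable_nat_add_iff 1).2 h1
  convert! h2.hasSum using 1
  rw [zetaFour, show (4 : ℂ) = ((4 : ℕ) : ℂ) by norm_num, zeta_nat_eq_tsum_of_gt_one (by norm_num)]
  have : ∑' n : ℕ, 1 / (n : ℂ) ^ 4 = ((∑' n : ℕ, 1 / (n : ℝ) ^ 4 : ℝ) : ℂ) := by
    push_cast; rfl
  -- The term with index 0 is 1 / 0 ^ 4 = 0 and may be split off.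
  rw [this, Complex.ofReal_re, h1.tsum_eq_zero_add]
  simp

theorem Zl_zero_zero : Zl 0 0 = zetaFour := by
  have h : ∀ i : ℕ, termL 0 0 i = -3 * (1 / ((i + 1 : ℕ) : ℝ) ^ 4) := by
    intro i
    have hi : (0 : ℝ) < (i + 1 : ℕ) := by positivity
    have heq : ratR 0 0 =ᶠ[nhds ((i + 1 : ℕ) : ℝ)] fun t => t ^ (-3 : ℤ) := by
      filter_upwards [lt_mem_nhds hi] with t ht
      simp [ratR, poch_zero, poch_one_right]
      field_simp
    rw [termL_eq le_rfl]
    simp only [Nat.sub_self, zero_add]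
    rw [heq.deriv_eq, deriv_zpow]
    rw [show (-3 - 1 : ℤ) = -(4 : ℕ) by norm_num, zpow_neg, zpow_natCast]
    push_cast
    ring
  rw [Zl]
  simp only [h]
  rw [(zetaFour_hasSum.mul_left (-3)).tsum_eq]
  ring

theorem closedForm_zero_zero : closedForm 0 0 = zetaFour := by
  rw [closedForm, transPart, sum_weightU]
  simp [ratP, ratQ, hypA, hypB, nestedU]
  ring

theorem closedForm_zero (n : ℕ) : closedForm n 0 = 1 / 30720 * transPart n +
    (4 * n + 1) * (5460 * n ^ 4 + 13499 * n ^ 3 + 12601 * n ^ 2 + 5265 * n + 831)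
      / (768 * (2 * n + 1) ^ 9) * hypB n := by
  rw [closedForm, ratP, ratQ]
  push_cast
  ring

theorem closedForm_one {n : ℕ} (hn : 0 < n) :
    closedForm n 1 = (hypB n : ℝ) / (24 * n ^ 3) - 3 * n / 4 * closedForm n 0 := by
  have hn' : (n : ℝ) ≠ 0 := by positivity
  have f4 : (2 * (n : ℝ) + 1) ≠ 0 := by positivity
  rw [closedForm_zero, closedForm, ratP, ratQ]
  push_cast
  field_simp
  ring

/-- The induction passes from (n, 0) to (n + 1, 1) by `Zl_rowZero` and on to (n + 1, 0) by `Zl_one`.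
The resulting factor of the homogeneous part is the quotient of consecutive `hypA`, so the claim
reduces to an identity between rational multiples of `hypB n`. -/
theorem Zl_zero (n : ℕ) : Zl n 0 = closedForm n 0 := by
  induction n with
  | zero => rw [Zl_zero_zero, closedForm_zero_zero]
  | succ n ih =>
    have h1 := Zl_one (n := n + 1) (by omega)
    have h2 := Zl_rowZero n
    have f4 : (2 * (n : ℝ) + 1) ≠ 0 := by positivity
    have f5 : (n : ℝ) + 1 ≠ 0 := by positivity
    have f6 : 2 * (n : ℝ) + 3 ≠ 0 := by positivity
    rw [ih, closedForm_zero] at h2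
    -- `Zl_one` in row n + 1, solved for the entry with m = 0.
    have h3 : Zl (n + 1) 0 = -(4 / (3 * (n + 1) ^ 4)) * (((n + 1) ^ 3 : ℝ) * Zl (n + 1) 1
        - (hypB (n + 1) : ℝ) / 24) := by
      push_cast at h1
      field_simp at h1 ⊢
      linear_combination h1
    rw [h3, closedForm_zero, transPart_succ, eq_add_of_sub_eq h2, hypB_succ, rowPoly]
    push_cast
    rw [show 2 * ((n : ℝ) + 1) + 1 = 2 * n + 3 by ring]
    field_simp
    ring

theorem recA2_ne_zero {n m : ℕ} (h : m + 2 ≤ n) : recA2 n m ≠ 0 := by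
  have h' : (m : ℚ) + 2 ≤ n := by exact_mod_cast h
  have hm : (0 : ℚ) ≤ m := by positivity
  have h1 : (0 : ℚ) < 2 * n - m - 1 := by linarith
  have h2 : (0 : ℚ) < 4 * n - m := by linarith
  rw [recA2]
  exact mul_ne_zero (mul_ne_zero (neg_ne_zero.2 h1.ne' |> fun _ => by
    simpa using h1.ne') h2.ne') (by positivity)

theorem Zl_eq_closedForm {n m : ℕ} (hm : m ≤ n) : Zl n m = closedForm n m := by
  induction m using Nat.twoStepInduction with
  | zero => exact Zl_zero n
  | one =>
    have := Zl_one (n := n) (by omega)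
    rw [closedForm_one (by omega), ← Zl_zero]
    linarith
  | more m ih1 ih2 =>
    have h := Zl_rec hm
    have h2 : ((recA2 n m : ℚ) : ℝ) ≠ 0 := by exact_mod_cast recA2_ne_zero hm
    rw [ih1 (by omega), ih2 (by omega)] at h
    refine mul_left_cancel₀ h2 ?_
    simp only [closedForm] at h ⊢
    rw [ratP, ratQ]
    push_cast
    field_simp
    linear_combination h

end ClosedForm

/-! ### Contiguous relations of the inner sum of the right series. -/

section ContiguousRelations

/-- The summands of the inner sum, up to normalisation. -/
noncomputable def phiTerm (n : ℕ) (a b : ℝ) (j : ℕ) : ℝ :=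
  (n.choose j : ℝ) ^ 2 * poch (a + j - n + 1) n * poch (b - j + 1) n

/-- The balanced terminating sum `∑ C(n,j)² C(a+j,n) C(b+n-j,n)`. -/
noncomputable def Phi (n : ℕ) (a b : ℝ) : ℝ :=
  (∑ j ∈ range (n + 1), phiTerm n a b j) / (n.factorial : ℝ) ^ 2

theorem choose_succ_mul (n j : ℕ) :
    ((j : ℝ) + 1) * (n.choose (j + 1) : ℝ) = (n - j) * (n.choose j : ℝ) := by
  rcases le_or_gt j n with h | h
  · have := Nat.choose_succ_right_eq n j
    have h2 : (n.choose (j + 1) : ℝ) * (j + 1) = n.choose j * ((n - j : ℕ) : ℝ) := by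
      exact_mod_cast this
    rw [Nat.cast_sub h] at h2
    linarith
  · rw [Nat.choose_eq_zero_of_lt h, Nat.choose_eq_zero_of_lt (by omega)]
    simp

theorem succ_choose_mul (n j : ℕ) :
    ((n : ℝ) + 1) * (n.choose j : ℝ) = (n + 1 - j) * ((n + 1).choose j : ℝ) := by
  rcases le_or_gt j (n + 1) with h | h
  · have := Nat.add_one_mul_choose_eq n j
    have h3 := choose_succ_mul (n + 1) j
    have h2 : ((n : ℝ) + 1) * n.choose j = (n + 1).choose (j + 1) * (j + 1) := by
      exact_mod_cast this
    push_cast at h3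
    linarith
  · rw [Nat.choose_eq_zero_of_lt h, Nat.choose_eq_zero_of_lt (by omega)]
    simp

/-- The certificate, in the summation index, of the contiguous relations. -/
noncomputable def phiCert (n : ℕ) (a b : ℝ) (j : ℕ) : ℝ :=
  (j : ℝ) ^ 2 * (n.choose j : ℝ) ^ 2 * poch (a + j - n + 1) n * poch (b - j + 2) n

theorem sum_phiCert (n : ℕ) (a b : ℝ) :
    ∑ j ∈ range (n + 1), (phiCert n a b (j + 1) - phiCert n a b j) = 0 := by
  rw [Finset.sum_range_sub]
  simp [phiCert]

/-- A and B are the rising factorials shared by all shifted terms; relative to them, the contiguous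
relations are polynomial identities. The index n + 1 guarantees a factor to split off. -/
theorem phiTerm_forms (n : ℕ) (a b : ℝ) (j : ℕ) : ∃ A B : ℝ,
    phiTerm (n + 1) a b j = ((n + 1).choose j : ℝ) ^ 2 * A * B * ((a + j - n) * (b - j + 1)) ∧
    phiTerm (n + 1) (a + 1) b j = ((n + 1).choose j : ℝ) ^ 2 * A * B
      * ((a + j + 1) * (b - j + 1)) ∧
    phiTerm (n + 1) a (b + 1) j = ((n + 1).choose j : ℝ) ^ 2 * A * B
      * ((a + j - n) * (b - j + n + 2)) ∧
    phiTerm (n + 1) (a + 1) (b + 1) j = ((n + 1).choose j : ℝ) ^ 2 * A * B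
      * ((a + j + 1) * (b - j + n + 2)) ∧
    phiCert (n + 1) a b j = ((n + 1).choose j : ℝ) ^ 2 * A * B
      * (j ^ 2 * ((a + j - n) * (b - j + n + 2))) ∧
    phiCert (n + 1) a b (j + 1) = ((n + 1).choose j : ℝ) ^ 2 * A * B
      * ((n + 1 - j) ^ 2 * ((a + j + 1) * (b - j + 1))) := by
  have hA : poch (a + j - (n + 1 : ℕ) + 1) (n + 1) = (a + j - n) * poch (a + j - n + 1) n := by
    rw [poch_succ_left, show a + j - ((n + 1 : ℕ) : ℝ) + 1 = a + j - n by push_cast; ring]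
  have hA' : poch (a + j - n + 1) (n + 1) = poch (a + j - n + 1) n * (a + j + 1) := by
    rw [poch_succ]; ring
  have hB : poch (b - j + 1) (n + 1) = (b - j + 1) * poch (b - j + 2) n := by
    rw [poch_succ_left]; congr 2; ring
  have hB' : poch (b - j + 2) (n + 1) = poch (b - j + 2) n * (b - j + n + 2) := by
    rw [poch_succ]; ring
  have e1 : a + 1 + j - (n + 1 : ℕ) + 1 = a + j - n + 1 := by push_cast; ring
  have e2 : b + 1 - j + 1 = b - j + 2 := by ring
  have e3 : a + (j + 1 : ℕ) - (n + 1 : ℕ) + 1 = a + j - n + 1 := by push_cast; ring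
  have e4 : b - (j + 1 : ℕ) + 2 = b - j + 1 := by push_cast; ring
  refine ⟨poch (a + j - n + 1) n, poch (b - j + 2) n, ?_, ?_, ?_, ?_, ?_, ?_⟩
  · rw [phiTerm, hA, hB]; ring
  · rw [phiTerm, e1, hA', hB]; ring
  · rw [phiTerm, e2, hA, hB']; ring
  · rw [phiTerm, e1, e2, hA', hB']; ring
  · rw [phiCert, hA, hB']; ring
  · have h := choose_succ_mul (n + 1) j
    rw [phiCert, e3, e4, hA', hB]
    push_cast at h ⊢
    rw [← mul_pow, h]
    ring

theorem Phi_zero (a b : ℝ) : Phi 0 a b = 1 := by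
  simp [Phi, phiTerm, poch_zero]

/-- Summand by summand the combination is a difference of `phiCert`, which vanishes at j = 0 (factor
j²) and just past the range (binomial coefficient). -/
theorem Phi_contig (n : ℕ) (a b : ℝ) :
    (a - b) * (a + b + n + 2) * Phi n a b - (a + 1) ^ 2 * Phi n (a + 1) b
      + (b + 1) ^ 2 * Phi n a (b + 1) = 0 := by
  cases n with
  | zero => simp only [Phi_zero]; push_cast; ring
  | succ n =>
    have h : ∑ j ∈ range (n + 1 + 1), ((a - b) * (a + b + (n + 1 : ℕ) + 2) * phiTerm (n + 1) a b j
        - (a + 1) ^ 2 * phiTerm (n + 1) (a + 1) b j + (b + 1) ^ 2 * phiTerm (n + 1) a (b + 1) j)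
        = -∑ j ∈ range (n + 1 + 1), (phiCert (n + 1) a b (j + 1) - phiCert (n + 1) a b j) := by
      rw [← Finset.sum_neg_distrib]
      refine Finset.sum_congr rfl fun j _ => ?_
      obtain ⟨A, B, h1, h2, h3, -, h5, h6⟩ := phiTerm_forms n a b j
      rw [h1, h2, h3, h5, h6]
      push_cast
      ring
    rw [sum_phiCert, Finset.sum_add_distrib, Finset.sum_sub_distrib, ← Finset.mul_sum,
      ← Finset.mul_sum, ← Finset.mul_sum] at h
    simp only [Phi]
    linear_combination h / ((n + 1).factorial : ℝ) ^ 2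

theorem Phi_contig_diag (n : ℕ) (a b : ℝ) :
    (a + 1) ^ 2 * (a + b + n + 2) * Phi n a b
      - (a + b + 2) * ((a + 1) ^ 2 + (b + 1) ^ 2) * Phi n (a + 1) b
      + (b + 1) ^ 2 * (a + b + 2 - n) * Phi n (a + 1) (b + 1) = 0 := by
  cases n with
  | zero => simp only [Phi_zero]; push_cast; ring
  | succ n =>
    have h : ∑ j ∈ range (n + 1 + 1),
        ((a + 1) ^ 2 * (a + b + (n + 1 : ℕ) + 2) * phiTerm (n + 1) a b j
        - (a + b + 2) * ((a + 1) ^ 2 + (b + 1) ^ 2) * phiTerm (n + 1) (a + 1) b j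
        + (b + 1) ^ 2 * (a + b + 2 - (n + 1 : ℕ)) * phiTerm (n + 1) (a + 1) (b + 1) j)
        = -(a + b + 2) * ∑ j ∈ range (n + 1 + 1),
          (phiCert (n + 1) a b (j + 1) - phiCert (n + 1) a b j) := by
      rw [Finset.mul_sum]
      refine Finset.sum_congr rfl fun j _ => ?_
      obtain ⟨A, B, h1, h2, -, h4, h5, h6⟩ := phiTerm_forms n a b j
      rw [h1, h2, h4, h5, h6]
      push_cast
      ring
    rw [sum_phiCert, Finset.sum_add_distrib, Finset.sum_sub_distrib, ← Finset.mul_sum,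
      ← Finset.mul_sum, ← Finset.mul_sum] at h
    simp only [Phi]
    linear_combination h / ((n + 1).factorial : ℝ) ^ 2

/-- The coefficient of `Φ_n(a, b)` in the relation for `Φ_{n+1}(a, b)`. -/
def phiCoef (n a b : ℝ) : ℝ :=
  (n ^ 2 + 1) * (n + 2) + (n ^ 2 + 1) * b - (n ^ 2 + 2 * n - 5) * a - (2 * n - 2) * a * b
    + 6 * a ^ 2 + 2 * a ^ 2 * b + 2 * a ^ 3

theorem Phi_succ (n : ℕ) (a b : ℝ) :
    ((n : ℝ) + 1) ^ 3 * Phi (n + 1) a b + phiCoef n a b * Phi n a b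
      + 2 * (a + 1) ^ 2 * (n - 1 - a - b) * Phi n (a + 1) b = 0 := by
  have hn1 : (n : ℝ) + 1 ≠ 0 := by positivity
  let g : ℕ → ℝ := fun j => (j : ℝ) ^ 2 * ((n + 1).choose j : ℝ) ^ 2 * poch (a + j - n + 1) n
    * poch (b - j + 1) (n + 1) * ((n + 1) * (n - 2 - 3 * a) + (2 * a + 1 - n) * j)
  -- The summand identity without the common binomial and the factor (b - j + 1)_n. For n ≥ 1 the
  -- two remaining rising factorials share n - 1 factors; n = 0 is separate.
  have key : ∀ j : ℝ, ((n + 1) ^ 3 * (a + j - n) * (b - j + 1 + n) + phiCoef n a b * (n + 1 - j) ^ 2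
      + j ^ 2 * (b - j + 1 + n) * ((n + 1) * (n - 2 - 3 * a) + (2 * a + 1 - n) * j))
        * poch (a + j - n + 1) n
      + (2 * (a + 1) ^ 2 * (n - 1 - a - b) * (n + 1 - j) ^ 2 - (n + 1 - j) ^ 2 * (b - j)
        * ((n + 1) * (n - 2 - 3 * a) + (2 * a + 1 - n) * (j + 1))) * poch (a + j - n + 2) n = 0 := by
    intro j
    cases n with
    | zero => simp only [poch_zero, phiCoef]; push_cast; ring
    | succ k =>
      rw [poch_succ_left, poch_succ, phiCoef,
        show a + j - ((k + 1 : ℕ) : ℝ) + 1 + 1 = a + j - ((k + 1 : ℕ) : ℝ) + 2 by ring]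
      push_cast
      ring
  -- The weight (n + 1)² converts C(n, j)² into (n + 1 - j)² C(n + 1, j)², so that all terms carry
  -- the same binomial.
  have h : ∀ j ∈ range (n + 2), ((n : ℝ) + 1) ^ 2 * ((n + 1) * phiTerm (n + 1) a b j
      + phiCoef n a b * phiTerm n a b j
      + 2 * (a + 1) ^ 2 * (n - 1 - a - b) * phiTerm n (a + 1) b j) = g (j + 1) - g j := by
    intro j _
    have hc := succ_choose_mul n j
    have hc' := choose_succ_mul (n + 1) j
    have e1 : poch (a + j - (n + 1 : ℕ) + 1) (n + 1) = (a + j - n) * poch (a + j - n + 1) n := by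
      rw [poch_succ_left, show a + j - ((n + 1 : ℕ) : ℝ) + 1 = a + j - n by push_cast; ring]
    have e2 : poch (b - j + 1) (n + 1) = poch (b - j + 1) n * (b - j + 1 + n) := poch_succ _ _
    have e3 : poch (b - (j + 1 : ℕ) + 1) (n + 1) = (b - j) * poch (b - j + 1) n := by
      rw [poch_succ_left, show b - ((j + 1 : ℕ) : ℝ) + 1 = b - j by push_cast; ring]
    have e4 : a + 1 + (j : ℝ) - n + 1 = a + j - n + 2 := by ring
    have e5 : a + ((j + 1 : ℕ) : ℝ) - n + 1 = a + j - n + 2 := by push_cast; ring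
    simp only [g, phiTerm]
    rw [e1, e2, e3, e4, e5]
    have hc2 : ((n : ℝ) + 1) ^ 2 * (n.choose j : ℝ) ^ 2
        = ((n + 1 - j) * ((n + 1).choose j : ℝ)) ^ 2 := by rw [← hc]; ring
    have hc3 : (((j + 1 : ℕ) : ℝ)) ^ 2 * ((n + 1).choose (j + 1) : ℝ) ^ 2
        = ((n + 1 - j) * ((n + 1).choose j : ℝ)) ^ 2 := by
      rw [← mul_pow]; push_cast at hc' ⊢; rw [hc']
    rw [hc3]
    push_cast
    linear_combination (phiCoef n a b * poch (a + j - n + 1) n * poch (b - j + 1) n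
      + 2 * (a + 1) ^ 2 * (n - 1 - a - b) * poch (a + j - n + 2) n * poch (b - j + 1) n) * hc2
      + ((n + 1).choose j : ℝ) ^ 2 * poch (b - j + 1) n * key j
  have hs := Finset.sum_congr rfl h
  rw [Finset.sum_range_sub] at hs
  have hg0 : g 0 = 0 := by simp [g]
  have hgn : g (n + 2) = 0 := by simp [g]
  rw [hg0, hgn, ← Finset.mul_sum, Finset.sum_add_distrib, Finset.sum_add_distrib, ← Finset.mul_sum,
      ← Finset.mul_sum, ← Finset.mul_sum] at hs
  have hz : ∀ a' : ℝ, ∑ j ∈ range (n + 2), phiTerm n a' b j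
      = ∑ j ∈ range (n + 1), phiTerm n a' b j := by
    intro a'
    rw [Finset.sum_range_succ]
    simp [phiTerm]
  rw [hz, hz] at hs
  simp only [Phi, factorial_add_one]
  have hf : (n.factorial : ℝ) ≠ 0 := by positivity
  have hs' := (mul_eq_zero.1 (hs.trans (sub_self 0))).resolve_left (by positivity)
  field_simp
  linear_combination hs'

end ContiguousRelations

/-! ### The right-hand summand in terms of n and N, and the identity behind its recurrence. -/

section RightRational

/-- `R̃_{n,m}` as a function of `n` and `N = 2n - m`. -/
noncomputable def balR (n N : ℕ) (t : ℝ) : ℝ :=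
  n.factorial * poch (t - n) N / (poch t (n + 1) * poch t (N + 1)) * Phi n N (t - 1)

theorem ratRTilde_eq {n m : ℕ} (hm : m ≤ n) (t : ℝ) :
    ratRTilde n m t = balR n (2 * n - m) t := by
  rw [ratRTilde, balR, Phi, Finset.sum_div]
  congr 1
  refine Finset.sum_congr rfl fun j _ => ?_
  have h : ((2 * n - m + j).choose n : ℝ) = poch (((2 * n - m : ℕ) : ℝ) + j - n + 1) n / n.factorial := by
    have e : ((2 * n - m : ℕ) : ℝ) + j - n = ((2 * n - m + j - n : ℕ) : ℝ) := by
      rw [Nat.cast_sub (by omega : n ≤ 2 * n - m + j)]; push_cast; ring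
    rw [e, poch_natCast_succ, show 2 * n - m + j - n + n = 2 * n - m + j by omega,
      Nat.cast_choose ℝ (by omega : n ≤ 2 * n - m + j)]
    field_simp
  rw [h, phiTerm, show t - 1 - j + 1 = t - (j : ℝ) by ring]
  field_simp

theorem ratOrd_Phi (n : ℕ) (a : ℝ) : RatOrd n (fun t => Phi n a (t - 1)) := by
  have h : RatOrd n (fun t => (1 / (n.factorial : ℝ) ^ 2) *
      ∑ j ∈ range (n + 1), phiTerm n a (t - 1) j) := by
    refine RatOrd.const_mul _ (RatOrd.sum _ _ (fun j _ => ?_) (by positivity))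
    refine ((ratOrd_poch (-(j : ℝ)) n).const_mul ((n.choose j : ℝ) ^ 2 * poch (a + j - n + 1) n)).congr
      fun t _ => ?_
    rw [phiTerm, show t - 1 - (j : ℝ) + 1 = t + -j by ring]
  refine h.congr fun t _ => ?_
  rw [Phi]; ring

theorem ratOrd_balR (n N : ℕ) : RatOrd (-2) (balR n N) := by
  have h := ((((ratOrd_poch (-n) N).const_mul (n.factorial : ℝ)).mul
    (ratOrd_inv_poch le_rfl (n + 1))).mul (ratOrd_inv_poch le_rfl (N + 1))).mul (ratOrd_Phi n N)
  refine (h.mono (by push_cast; omega)).congr fun t _ => ?_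
  simp only [balR, add_zero, ← sub_eq_add_neg]
  rw [div_eq_mul_inv, mul_inv]; ring

/-- The coefficients of the certificate of the recurrence in `m`. -/
def certRecU (n N t : ℝ) : ℝ :=
  -2 * n ^ 2 * N ^ 2 + 4 * n ^ 2 * N - 2 * n ^ 2 - 2 * n * N ^ 2 + 4 * n * N - 2 * n - N ^ 4
    + 3 * N ^ 3 - 3 * N ^ 2 + N - N * (N - 1) ^ 2 * t

def certRecV (n N t : ℝ) : ℝ :=
  -4 * n ^ 3 * N + 2 * n ^ 3 + 4 * n ^ 2 * N ^ 2 - 14 * n ^ 2 * N + 6 * n ^ 2 - n * N ^ 3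
    + 4 * n * N ^ 2 - 10 * n * N + 4 * n + N ^ 4 - 2 * N ^ 3
    + (4 * n ^ 2 * N - 2 * n ^ 2 + 4 * n * N - 2 * n + N ^ 3) * t

/-- The contiguous relations express the shifts needed through Φ_n(k, t-1) and Φ_n(k+1, t-1) over
rational functions; the certificate is taken from their span. -/
noncomputable def certRec (n k : ℕ) (t : ℝ) : ℝ :=
  n.factorial * poch (t - n - 1) (k + 1) / (poch t n * poch t (k + 2))
    * (certRecU n (k + 2) t * Phi n k (t - 1) + certRecV n (k + 2) t * Phi n (k + 1) (t - 1))

/-- The middle coefficient of the recurrence in `m`, with `m = 2n - N`. -/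
def recMid (n m : ℝ) : ℝ := -(4 * n - 2 * m - 1) *
    (6 * n ^ 4 - 24 * n ^ 3 * m + 22 * n ^ 2 * m ^ 2 - 8 * n * m ^ 3 + m ^ 4 - 24 * n ^ 3
      + 30 * n ^ 2 * m - 14 * n * m ^ 2 + 2 * m ^ 3 + 8 * n ^ 2 - 10 * n * m + 2 * m ^ 2
      - 4 * n + m)

/-- Elimination of Φ_n(k, t), Φ_n(k+1, t) and Φ_n(k+2, t-1) leaves two basis functions, whose
coefficients are compared in `hp` and `hq`. The factor k + t + 1 - n comes from the coefficient of
Φ_n(k+1, t) in `Phi_contig_diag`. -/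
theorem Phi_rec_identity (n : ℕ) (k t : ℝ) (hs : k + t + 1 - n ≠ 0) :
    (k + 2) ^ 5 * ((t - n + k) * (t - n + k + 1)) * Phi n (k + 2) (t - 1)
      + recMid n (2 * n - (k + 2)) * ((t - n + k) * (t + k + 2)) * Phi n (k + 1) (t - 1)
      - (k + 1) ^ 3 * (2 * n + (k + 2)) * (2 * n - (k + 2) + 2) * ((t + k + 1) * (t + k + 2))
        * Phi n k (t - 1)
    = (t - n + k) * t ^ 2 * (certRecU n (k + 2) (t + 1) * Phi n k t
        + certRecV n (k + 2) (t + 1) * Phi n (k + 1) t)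
      - (t - n - 1) * (t + n) * (t + k + 2) * (certRecU n (k + 2) t * Phi n k (t - 1)
        + certRecV n (k + 2) t * Phi n (k + 1) (t - 1)) := by
  have h1 := Phi_contig n k (t - 1)
  have h2 := Phi_contig_diag n k (t - 1)
  have h3 := Phi_contig n (k + 1) (t - 1)
  rw [show t - 1 + 1 = t by ring] at h1 h2 h3
  rw [show k + 1 + 1 = k + 2 by ring] at h3
  have hp : (k + t + 1 - n) * (-(k + 1) ^ 3 * (2 * n + (k + 2)) * (2 * n - (k + 2) + 2)
      * ((t + k + 1) * (t + k + 2)) + (t - n - 1) * (t + n) * (t + k + 2) * certRecU n (k + 2) t)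
      = -(k + t + 1 - n) * (t - n + k) * certRecU n (k + 2) (t + 1) * ((k - t + 1) * (k + t + n + 1))
      + ((k + 2) ^ 3 * ((t - n + k) * (t - n + k + 1)) - (t - n + k) * certRecV n (k + 2) (t + 1))
        * ((k + 1) ^ 2 * (k + t + n + 1)) := by
    unfold certRecU certRecV; ring
  have hq : (k + t + 1 - n) * (recMid n (2 * n - (k + 2)) * ((t - n + k) * (t + k + 2))
      + (t - n - 1) * (t + n) * (t + k + 2) * certRecV n (k + 2) t)
      = -(k + t + 1 - n) * (t - n + k) * certRecU n (k + 2) (t + 1) * (-(k + 1) ^ 2)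
      - ((k + 2) ^ 3 * ((t - n + k) * (t - n + k + 1)) - (t - n + k) * certRecV n (k + 2) (t + 1))
        * ((k + t + 1) * ((k + 1) ^ 2 + t ^ 2))
      - (k + t + 1 - n) * (k + 2) ^ 3 * ((t - n + k) * (t - n + k + 1))
        * ((k + 2 - t) * (k + t + n + 2)) := by
    unfold certRecU certRecV recMid; ring
  refine mul_left_cancel₀ hs ?_
  -- The explicit coefficients matter only in `hp` and `hq`; as opaque symbols they keep the last
  -- check small.
  generalize recMid n (2 * n - (k + 2)) = M at *
  generalize certRecU n (k + 2) t = U at *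
  generalize certRecV n (k + 2) t = V at *
  generalize certRecU n (k + 2) (t + 1) = U' at *
  generalize certRecV n (k + 2) (t + 1) = V' at *
  linear_combination (-(k + t + 1 - n) * (k + 2) ^ 3 * ((t - n + k) * (t - n + k + 1))) * h3
    + (-(k + t + 1 - n) * (t - n + k) * U') * h1
    + ((k + 2) ^ 3 * ((t - n + k) * (t - n + k + 1)) - (t - n + k) * V') * h2
    + Phi n k (t - 1) * hp + Phi n (k + 1) (t - 1) * hq

end RightRational

/-! ### Telescoping identities for the right-hand summand. -/

section RightTelescope

theorem balR_forms (n k : ℕ) {t : ℝ} (ht : 0 < t) : ∃ K : ℝ,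
    balR n (k + 2) t = K * ((t - n + k) * (t - n + k + 1) * Phi n (k + 2) (t - 1)) ∧
    balR n (k + 1) t = K * ((t - n + k) * (t + k + 2) * Phi n (k + 1) (t - 1)) ∧
    balR n k t = K * ((t + k + 1) * (t + k + 2) * Phi n k (t - 1)) ∧
    n.factorial * poch (t - n - 1) (k + 1) / (poch t n * poch t (k + 2))
      = K * ((t - n - 1) * (t + n) * (t + k + 2)) ∧
    n.factorial * poch (t + 1 - n - 1) (k + 1) / (poch (t + 1) n * poch (t + 1) (k + 2))
      = K * ((t - n + k) * t ^ 2) := by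
  have hp1 := poch_succ (t - n) k
  have hp2 := poch_succ (t - n) (k + 1)
  have hs := poch_succ_left (t - n - 1) k
  have hD := poch_succ t n
  have hE1 := poch_succ t (k + 1)
  have hE2 := poch_succ t (k + 2)
  have hD' := poch_shift ht n
  have hE' := poch_shift ht (k + 2)
  have h1 : poch t n ≠ 0 := (poch_pos ht n).ne'
  have h2 : poch t (k + 1) ≠ 0 := (poch_pos ht _).ne'
  have h3 : t + n ≠ 0 := by positivity
  have h4 : t + k + 1 ≠ 0 := by positivity
  have h5 : t + k + 2 ≠ 0 := by positivity
  rw [sub_add_cancel] at hs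
  have hE1' : poch t (k + 2) = poch t (k + 1) * (t + k + 1) := by rw [hE1]; push_cast; ring
  have hE2' : poch t (k + 2 + 1) = poch t (k + 1) * (t + k + 1) * (t + k + 2) := by
    rw [hE2, hE1']; push_cast; ring
  have hp2' : poch (t - n) (k + 2) = poch (t - n) k * (t - n + k) * (t - n + k + 1) := by
    rw [hp2, hp1]; push_cast; ring
  refine ⟨n.factorial * poch (t - n) k
    / (poch t n * (t + n) * (poch t (k + 1) * (t + k + 1) * (t + k + 2))), ?_, ?_, ?_, ?_, ?_⟩
  · rw [balR, hp2', hD, hE2']; push_cast; field_simp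
  · rw [balR, hp1, hD, show k + 1 + 1 = k + 2 from rfl, hE1']; push_cast; field_simp
  · rw [balR, hD]; field_simp
  · rw [hs, hE1']; field_simp
  · rw [show t + 1 - n - 1 = t - n by ring, hp1, hD', hE', hE1']; push_cast; field_simp; ring

theorem certRec_telescope {n k : ℕ} (hk : n ≤ k) {t : ℝ} (ht : 0 < t) :
    ((k + 2) ^ 5 : ℝ) * balR n (k + 2) t + recMid n (2 * n - (k + 2)) * balR n (k + 1) t
      + -((k + 1) ^ 3 * (2 * n + (k + 2)) * (2 * n - (k + 2) + 2)) * balR n k t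
    = 1 * (certRec n k (t + 1) - certRec n k t) := by
  have hkn : (n : ℝ) ≤ k := by exact_mod_cast hk
  have h := Phi_rec_identity n k t (by linarith : (k : ℝ) + t + 1 - n ≠ 0)
  obtain ⟨K, h2, h1, h0, hG, hG'⟩ := balR_forms n k ht
  rw [certRec, certRec, hG, hG', h0, h1, h2, add_sub_cancel_right]
  linear_combination K * h

theorem certRec_ratOrd {n k : ℕ} : RatOrd 0 (certRec n k) := by
  have hU : RatOrd 1 (certRecU n (k + 2)) := by
    refine ((((RatOrd.linear 0).const_mul (-((k + 2 : ℝ) * ((k + 2 : ℝ) - 1) ^ 2)))).add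
      ((RatOrd.const (certRecU n (k + 2) 0)).mono (by norm_num))).congr fun t _ => ?_
    unfold certRecU; ring
  have hV : RatOrd 1 (certRecV n (k + 2)) := by
    refine ((((RatOrd.linear 0).const_mul (4 * n ^ 2 * (k + 2) - 2 * n ^ 2 + 4 * n * (k + 2)
      - 2 * n + (k + 2) ^ 3 : ℝ))).add
      ((RatOrd.const (certRecV n (k + 2) 0)).mono (by norm_num))).congr fun t _ => ?_
    unfold certRecV; ring
  have h := ((((ratOrd_poch (-(n + 1)) (k + 1)).const_mul (n.factorial : ℝ)).mul
    (ratOrd_inv_poch le_rfl n)).mul (ratOrd_inv_poch le_rfl (k + 2))).mul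
    ((hU.mul (ratOrd_Phi n k)).add (hV.mul (ratOrd_Phi n (k + 1))))
  refine (h.mono (by push_cast; omega)).congr fun t _ => ?_
  simp only [certRec, add_zero]
  rw [div_eq_mul_inv, mul_inv, show t - n - 1 = t + -((n : ℝ) + 1) by ring]; ring

/-- The coefficients of the certificate of the row relation. -/
def certRowU (n N t : ℝ) : ℝ := -4 * n * N ^ 2 - 10 * N ^ 3 - 4 * N ^ 2 * t

def certRowV (n N t : ℝ) : ℝ :=
  -4 * n ^ 3 - 6 * n ^ 2 * N - 12 * n ^ 2 - 12 * n * N - 12 * n + 10 * N ^ 3 - 6 * N - 4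
      + (4 * n ^ 2 + 10 * n * N + 8 * n + 10 * N ^ 2 + 10 * N + 4) * t

noncomputable def balCertRow (n k : ℕ) (t : ℝ) : ℝ :=
  n.factorial * poch (t - n - 1) (k + 1) / (poch t (n + 1) * poch t (k + 1))
    * (certRowU n (k + 1) t * Phi n k (t - 1) + certRowV n (k + 1) t * Phi n (k + 1) (t - 1))

/-- The elimination of `Phi_rec_identity` again, with `Phi_succ` used in addition to remove the
function of order n + 1. -/
theorem Phi_row_identity (n : ℕ) (k t : ℝ) (hs : k + t + 1 - n ≠ 0) :
    (n + 1) ^ 4 * (2 * n - (k + 1) + 2) * (t - n - 1) * Phi (n + 1) (k + 1) (t - 1)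
      + rowCoefA n (k + 1) * ((t - n + k) * (t + n + 1)) * Phi n (k + 1) (t - 1)
      - 6 * (k + 1) ^ 3 * (2 * n + (k + 1) + 1) * ((t + k + 1) * (t + n + 1)) * Phi n k (t - 1)
    = (t - n + k) * t ^ 2 * (certRowU n (k + 1) (t + 1) * Phi n k t
        + certRowV n (k + 1) (t + 1) * Phi n (k + 1) t)
      - (t - n - 1) * (t + n + 1) * (t + k + 1) * (certRowU n (k + 1) t * Phi n k (t - 1)
        + certRowV n (k + 1) t * Phi n (k + 1) (t - 1)) := by
  have h1 := Phi_contig n k (t - 1)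
  have h2 := Phi_contig_diag n k (t - 1)
  have h3 := Phi_contig n (k + 1) (t - 1)
  have h4 := Phi_succ n (k + 1) (t - 1)
  rw [show t - 1 + 1 = t by ring] at h1 h2 h3
  have hp : (k + t + 1 - n) * (-6 * (k + 1) ^ 3 * (2 * n + (k + 1) + 1) * ((t + k + 1) * (t + n + 1))
      + (t - n - 1) * (t + n + 1) * (t + k + 1) * certRowU n (k + 1) t)
      = -(k + t + 1 - n) * (t - n + k) * certRowU n (k + 1) (t + 1) * ((k - t + 1) * (k + t + n + 1))
      + (2 * (k + t + 1 - n) * ((n + 1) * (2 * n - (k + 1) + 2) * (t - n - 1))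
        - (t - n + k) * certRowV n (k + 1) (t + 1)) * ((k + 1) ^ 2 * (k + t + n + 1)) := by
    unfold certRowU certRowV; ring
  have hq : (k + t + 1 - n) * (rowCoefA n (k + 1) * ((t - n + k) * (t + n + 1))
      + (t - n - 1) * (t + n + 1) * (t + k + 1) * certRowV n (k + 1) t)
      = -(k + t + 1 - n) * (t - n + k) * certRowU n (k + 1) (t + 1) * (-(k + 1) ^ 2)
      - (2 * (k + t + 1 - n) * ((n + 1) * (2 * n - (k + 1) + 2) * (t - n - 1))
        - (t - n + k) * certRowV n (k + 1) (t + 1)) * ((k + t + 1) * ((k + 1) ^ 2 + t ^ 2))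
      - 2 * (k + t + 1 - n) ^ 2 * ((n + 1) * (2 * n - (k + 1) + 2) * (t - n - 1))
        * ((k + 2 - t) * (k + t + n + 2))
      + (k + t + 1 - n) * ((n + 1) * (2 * n - (k + 1) + 2) * (t - n - 1))
        * phiCoef n (k + 1) (t - 1) := by
    unfold certRowU certRowV rowCoefA phiCoef; ring
  refine mul_left_cancel₀ hs ?_
  generalize rowCoefA n (k + 1) = M at *
  generalize phiCoef n (k + 1) (t - 1) = F at *
  generalize certRowU n (k + 1) t = U at *
  generalize certRowV n (k + 1) t = V at *
  generalize certRowU n (k + 1) (t + 1) = U' at *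
  generalize certRowV n (k + 1) (t + 1) = V' at *
  linear_combination (-(k + t + 1 - n) * (t - n + k) * U') * h1
    + (2 * (k + t + 1 - n) * ((n + 1) * (2 * n - (k + 1) + 2) * (t - n - 1)) - (t - n + k) * V') * h2
    - (2 * (k + t + 1 - n) ^ 2 * ((n + 1) * (2 * n - (k + 1) + 2) * (t - n - 1))) * h3
    + ((k + t + 1 - n) * ((n + 1) * (2 * n - (k + 1) + 2) * (t - n - 1))) * h4
    + Phi n k (t - 1) * hp + Phi n (k + 1) (t - 1) * hq

theorem balR_row_forms (n k : ℕ) {t : ℝ} (ht : 0 < t) : ∃ K : ℝ,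
    balR (n + 1) (k + 1) t = K * ((n + 1) * (t - n - 1) * Phi (n + 1) (k + 1) (t - 1)) ∧
    balR n (k + 1) t = K * ((t - n + k) * (t + n + 1) * Phi n (k + 1) (t - 1)) ∧
    balR n k t = K * ((t + k + 1) * (t + n + 1) * Phi n k (t - 1)) ∧
    n.factorial * poch (t - n - 1) (k + 1) / (poch t (n + 1) * poch t (k + 1))
      = K * ((t - n - 1) * (t + n + 1) * (t + k + 1)) ∧
    n.factorial * poch (t + 1 - n - 1) (k + 1) / (poch (t + 1) (n + 1) * poch (t + 1) (k + 1))
      = K * ((t - n + k) * t ^ 2) := by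
  have hp1 := poch_succ (t - n) k
  have hs := poch_succ_left (t - n - 1) k
  have hD := poch_succ t (n + 1)
  have hE1 := poch_succ t (k + 1)
  have hD' := poch_shift ht (n + 1)
  have hE' := poch_shift ht (k + 1)
  have h1 : poch t (n + 1) ≠ 0 := (poch_pos ht _).ne'
  have h2 : poch t (k + 1) ≠ 0 := (poch_pos ht _).ne'
  have h3 : t + n + 1 ≠ 0 := by positivity
  have h4 : t + k + 1 ≠ 0 := by positivity
  rw [sub_add_cancel] at hs
  have hE1' : poch t (k + 1 + 1) = poch t (k + 1) * (t + k + 1) := by rw [hE1]; push_cast; ring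
  have hD1' : poch t (n + 1 + 1) = poch t (n + 1) * (t + n + 1) := by rw [hD]; push_cast; ring
  refine ⟨n.factorial * poch (t - n) k
    / (poch t (n + 1) * (t + n + 1) * (poch t (k + 1) * (t + k + 1))), ?_, ?_, ?_, ?_, ?_⟩
  · rw [balR, hD1', hE1', show t - ((n + 1 : ℕ) : ℝ) = t - n - 1 by push_cast; ring, hs,
      factorial_add_one]
    push_cast; field_simp
  · rw [balR, hp1, hE1']; push_cast; field_simp
  · rw [balR]; field_simp
  · rw [hs]; field_simp
  · rw [show t + 1 - n - 1 = t - n by ring, hp1, hD', hE']; push_cast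
    rw [show t + ((n : ℝ) + 1) = t + n + 1 by ring, show t + ((k : ℝ) + 1) = t + k + 1 by ring]
    field_simp

theorem balCertRow_telescope {n k : ℕ} (hk : n ≤ k) {t : ℝ} (ht : 0 < t) :
    ((n + 1) ^ 3 * (2 * n - (k + 1) + 2) : ℝ) * balR (n + 1) (k + 1) t
      + rowCoefA n (k + 1) * balR n (k + 1) t
      + -(6 * (k + 1) ^ 3 * (2 * n + (k + 1) + 1)) * balR n k t
    = 1 * (balCertRow n k (t + 1) - balCertRow n k t) := by
  have hkn : (n : ℝ) ≤ k := by exact_mod_cast hk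
  have h := Phi_row_identity n k t (by linarith : (k : ℝ) + t + 1 - n ≠ 0)
  obtain ⟨K, h2, h1, h0, hG, hG'⟩ := balR_row_forms n k ht
  rw [balCertRow, balCertRow, hG, hG', h0, h1, h2, add_sub_cancel_right]
  linear_combination K * h

theorem balCertRow_ratOrd {n k : ℕ} : RatOrd 0 (balCertRow n k) := by
  have hU : RatOrd 1 (certRowU n (k + 1)) := by
    refine ((((RatOrd.linear 0).const_mul (-4 * (k + 1 : ℝ) ^ 2))).add
      ((RatOrd.const (certRowU n (k + 1) 0)).mono (by norm_num))).congr fun t _ => ?_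
    unfold certRowU; ring
  have hV : RatOrd 1 (certRowV n (k + 1)) := by
    refine ((((RatOrd.linear 0).const_mul (4 * n ^ 2 + 10 * n * (k + 1) + 8 * n
      + 10 * (k + 1) ^ 2 + 10 * (k + 1) + 4 : ℝ))).add
      ((RatOrd.const (certRowV n (k + 1) 0)).mono (by norm_num))).congr fun t _ => ?_
    unfold certRowV; ring
  have h := ((((ratOrd_poch (-(n + 1)) (k + 1)).const_mul (n.factorial : ℝ)).mul
    (ratOrd_inv_poch le_rfl (n + 1))).mul (ratOrd_inv_poch le_rfl (k + 1))).mul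
    ((hU.mul (ratOrd_Phi n k)).add (hV.mul (ratOrd_Phi n (k + 1))))
  refine (h.mono (by push_cast; omega)).congr fun t _ => ?_
  simp only [balCertRow, add_zero]
  rw [div_eq_mul_inv, mul_inv, show t - n - 1 = t + -((n : ℝ) + 1) by ring]; ring

end RightTelescope

/-! ### Vanishing of the boundary terms of the right series at t = 1. -/

section RightBoundary

open Filter Topology

theorem differentiable_poch (c : ℝ) (k : ℕ) : Differentiable ℝ fun t => poch (t + c) k := by
  have : (fun t => poch (t + c) k) = fun t =>
      ((ascPochhammer ℝ k).comp (Polynomial.X + Polynomial.C c)).eval t := by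
    funext t; simp [poch]
  rw [this]
  exact Polynomial.differentiable _

/-- Expansion of `Φ_n(a, b)` up to the second order in `b`. -/
theorem Phi_expand (n : ℕ) (a : ℝ) : ∃ g : ℝ → ℝ, Differentiable ℝ g ∧ ∀ b,
    Phi n a b = poch (b + 1) n ^ 2 * poch (b + (a - n + 1)) n / (n.factorial : ℝ) ^ 3
      + b ^ 2 * g b := by
  induction n generalizing a with
  | zero => exact ⟨fun _ => 0, differentiable_const _, fun b => by simp [Phi_zero, poch_zero]⟩
  | succ n ih =>
    obtain ⟨g₀, d₀, h₀⟩ := ih a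
    obtain ⟨g₁, d₁, h₁⟩ := ih (a + 1)
    have hp := differentiable_poch 1 n
    have hp' := differentiable_poch (a - n + 1) n
    have hd : Differentiable ℝ (phiCoef n a) := by unfold phiCoef; fun_prop
    -- Found by inserting both expansions into `Phi_succ`: the product itself satisfies that
    -- relation up to b² (n + a + b + 2) times the product, which gives the last summand.
    refine ⟨fun b => -(1 / ((n : ℝ) + 1) ^ 3) * (phiCoef n a b * g₀ b
      + 2 * (a + 1) ^ 2 * (n - 1 - a - b) * g₁ b
      + (n + a + b + 2) * (poch (b + 1) n ^ 2 * poch (b + (a - n + 1)) n)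
        / (n.factorial : ℝ) ^ 3), by fun_prop, fun b => ?_⟩
    have h := Phi_succ n a b
    have e1 : poch (b + (a - (n + 1 : ℕ) + 1)) (n + 1) = (b + a - n) * poch (b + (a - n + 1)) n := by
      rw [poch_succ_left, show b + (a - ((n + 1 : ℕ) : ℝ) + 1) = b + a - n by push_cast; ring,
        show b + a - n + 1 = b + (a - n + 1) by ring]
    have e2 : (b + a - n + 1) * poch (b + (a + 1 - n + 1)) n
        = poch (b + (a - n + 1)) n * (b + a + 1) := by
      have h3 := poch_succ (b + (a - n + 1)) n
      rw [poch_succ_left] at h3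
      rw [show b + (a - n + 1) + 1 = b + (a + 1 - n + 1) by ring] at h3
      linear_combination h3
    rw [h₀, h₁] at h
    rw [e1, poch_succ, factorial_add_one]
    have hn1 : (n : ℝ) + 1 ≠ 0 := by positivity
    have hf : (n.factorial : ℝ) ≠ 0 := by positivity
    have key : ((n : ℝ) + 1) ^ 3 * Phi (n + 1) a b
        = (b + 1 + n) ^ 2 * (b + a - n) * (poch (b + 1) n ^ 2 * poch (b + (a - n + 1)) n
          / (n.factorial : ℝ) ^ 3) - b ^ 2 * (phiCoef n a b * g₀ b
        + 2 * (a + 1) ^ 2 * (n - 1 - a - b) * g₁ b + (n + a + b + 2) * (poch (b + 1) n ^ 2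
          * poch (b + (a - n + 1)) n / (n.factorial : ℝ) ^ 3)) := by
      unfold phiCoef at h ⊢
      linear_combination h
        + 2 * (a + 1) ^ 2 * poch (b + 1) n ^ 2 / (n.factorial : ℝ) ^ 3 * e2
    refine mul_left_cancel₀ (pow_ne_zero 3 hn1) (key.trans ?_)
    field_simp
    ring

theorem hasDerivAt_of_symm {f : ℝ → ℝ} (hf : DifferentiableAt ℝ f 1) (h : ∀ t, f (2 - t) = f t) :
    HasDerivAt f 0 1 := by
  have h1 := hf.hasDerivAt
  have h2 : HasDerivAt (fun t : ℝ => f (2 - t)) (-deriv f 1) 1 := by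
    have h3 : HasDerivAt f (deriv f 1) (2 - 1) := by norm_num; exact hf
    exact (h3.comp (1 : ℝ) ((hasDerivAt_id (1 : ℝ)).const_sub 2)).congr_deriv (by ring)
  have h3 : (fun t : ℝ => f (2 - t)) = f := funext h
  rw [h3] at h2
  have := h1.unique h2
  rw [show deriv f 1 = 0 by linarith] at h1
  exact h1

theorem poch_reflect (t : ℝ) (k : ℕ) : poch (1 - t - k) k = (-1) ^ k * poch t k := by
  induction k with
  | zero => simp [poch_zero]
  | succ k ih =>
    rw [poch_succ_left, poch_succ, show 1 - t - ((k + 1 : ℕ) : ℝ) + 1 = 1 - t - k by push_cast; ring,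
      ih]
    push_cast; ring

/-- The reflection t ↦ 2 - t exchanges the two rising factorials, and the signs (-1)^n cancel. -/
theorem hasDerivAt_poch_even (n : ℕ) :
    HasDerivAt (fun t => poch (t - n - 1) n * poch t n) 0 1 := by
  have h1 := differentiable_poch (-n - 1) n
  have h2 := differentiable_poch 0 n
  simp only [add_zero] at h2
  have h3 : (fun t => poch (t - n - 1) n) = fun t => poch (t + (-n - 1)) n := by
    funext t; congr 1; ring
  refine hasDerivAt_of_symm ?_ fun t => ?_
  · have : DifferentiableAt ℝ (fun t => poch (t - n - 1) n) 1 := by rw [h3]; exact h1 _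
    exact this.mul (h2 _)
  · have e1 := poch_reflect t n
    have e2 := poch_reflect (2 - t) n
    rw [show 2 - t - n - 1 = 1 - t - n by ring, e1]
    rw [show 1 - (2 - t) - n = t - (n : ℝ) - 1 by ring] at e2
    rw [e2]; ring

/-- For f = (t - 1)H one has f''(1) = 2H'(1). -/
theorem deriv_deriv_eq_zero_of_factor {f H : ℝ → ℝ} {d : ℤ} (hH : RatOrd d H)
    (h : ∀ t > 0, f t = (t - 1) * H t) (h0 : HasDerivAt H 0 1) : deriv (deriv f) 1 = 0 := by
  have hpos : ∀ᶠ t : ℝ in 𝓝 1, 0 < t := lt_mem_nhds one_pos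
  have h1 : ∀ t > 0, deriv f t = H t + (t - 1) * deriv H t := by
    intro t ht
    have he : f =ᶠ[𝓝 t] fun s => (s - 1) * H s := by
      filter_upwards [lt_mem_nhds ht] with s hs using h s hs
    rw [he.deriv_eq]
    have := ((hasDerivAt_id t).sub_const 1).mul (hH.differentiableAt ht).hasDerivAt
    exact this.deriv.trans (by simp)
  have he : deriv f =ᶠ[𝓝 1] fun t => H t + (t - 1) * deriv H t := by
    filter_upwards [hpos] with t ht using h1 t ht
  rw [he.deriv_eq]
  have := h0.add (((hasDerivAt_id (1 : ℝ)).sub_const 1).mul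
    (hH.deriv.differentiableAt one_pos).hasDerivAt)
  exact this.deriv.trans (by simp [h0.deriv])

/-- Modulo (t - 1)² each Φ may be replaced by the product in `Phi_expand`. The rising factorials
then cancel down to the even product of `hasDerivAt_poch_even`, times the elementary function in
`hr`. -/
theorem hasDerivAt_boundary {n A : ℕ} (hA : n ≤ A) {u v q : ℝ → ℝ} (hu : DifferentiableAt ℝ u 1)
    (hv : DifferentiableAt ℝ v 1) (hq : DifferentiableAt ℝ q 1)
    (hr : HasDerivAt (fun t => (u t * (t + (A - n)) + v t * (t + A)) / (t + (A - n)) * q t) 0 1) :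
    HasDerivAt (fun t => poch (t - n - 1) n * poch t (A - n) / (poch t n * poch t A) * q t
      * (u t * Phi n A (t - 1) + v t * Phi n (A + 1) (t - 1))) 0 1 := by
  obtain ⟨g₀, d₀, h₀⟩ := Phi_expand n A
  obtain ⟨g₁, d₁, h₁⟩ := Phi_expand n (A + 1)
  have hp : ∀ k, DifferentiableAt ℝ (fun t => poch t k) 1 := fun k => by
    have := differentiable_poch 0 k
    simp only [add_zero] at this
    exact this 1
  have hp' : DifferentiableAt ℝ (fun t => poch (t - n - 1) n) 1 := by
    have h3 : (fun t => poch (t - n - 1) n) = fun t => poch (t + (-n - 1)) n := by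
      funext t; congr 1; ring
    rw [h3]; exact differentiable_poch _ _ 1
  have hn0 : ∀ k, poch 1 k ≠ 0 := fun k => (poch_pos one_pos k).ne'
  have hg₀ : DifferentiableAt ℝ (fun t => g₀ (t - 1)) 1 := by fun_prop
  have hg₁ : DifferentiableAt ℝ (fun t => g₁ (t - 1)) 1 := by fun_prop
  -- W gathers the second-order remainders; (t - 1)² W has derivative 0 at 1.
  set W : ℝ → ℝ := fun t => poch (t - n - 1) n * poch t (A - n) / (poch t n * poch t A) * q t
      * (u t * g₀ (t - 1) + v t * g₁ (t - 1)) with hW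
  have hWd : DifferentiableAt ℝ W 1 :=
    ((((hp'.mul (hp _)).div ((hp n).mul (hp A)) (mul_ne_zero (hn0 _) (hn0 _))).mul hq).mul
      ((hu.mul hg₀).add (hv.mul hg₁)))
  have hE : HasDerivAt (fun t => (1 / (n.factorial : ℝ) ^ 3) * ((poch (t - n - 1) n * poch t n)
      * ((u t * (t + (A - n)) + v t * (t + A)) / (t + (A - n)) * q t)) + (t - 1) ^ 2 * W t) 0 1 := by
    have e1 := (((hasDerivAt_poch_even n).mul hr).const_mul (1 / (n.factorial : ℝ) ^ 3)).add
      ((((hasDerivAt_id (1 : ℝ)).sub_const 1).pow 2).mul hWd.hasDerivAt)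
    refine e1.congr_deriv ?_
    simp
  refine hE.congr_of_eventuallyEq ?_
  filter_upwards [lt_mem_nhds (one_pos : (0 : ℝ) < 1)] with t ht
  have hAn : (n : ℝ) ≤ A := by exact_mod_cast hA
  have ht' : t + ((A : ℝ) - n) ≠ 0 := by linarith
  have e0 : poch t A = poch t (A - n) * poch (t + (A - n)) n := by
    conv_lhs => rw [← Nat.sub_add_cancel hA]
    rw [poch_add, Nat.cast_sub hA]
  have e1 := poch_succ (t + (A - n)) n
  rw [poch_succ_left] at e1
  have e2 : poch (t + (A - n) + 1) n = poch (t + (A - n)) n * (t + A) / (t + (A - n)) := by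
    rw [eq_div_iff ht', mul_comm, e1]; ring
  have h2 : poch t n ≠ 0 := (poch_pos ht _).ne'
  have h3 : poch t (A - n) ≠ 0 := (poch_pos ht _).ne'
  have h4 : poch (t + (A - n)) n ≠ 0 := (poch_pos (by linarith) _).ne'
  simp only [hW]
  rw [h₀, h₁, e0, show t - 1 + 1 = t by ring, show t - 1 + ((A : ℝ) - n + 1) = t + (A - n) by ring,
    show t - 1 + ((A : ℝ) + 1 - n + 1) = t + (A - n) + 1 by ring, e2]
  field_simp
  ring

theorem poch_sub_split {n k : ℕ} (h : n ≤ k) (t : ℝ) :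
    poch (t - n - 1) (k + 1) = poch (t - n - 1) n * ((t - 1) * poch t (k - n)) := by
  rw [show k + 1 = n + (k - n + 1) by omega, poch_add, poch_succ_left,
    show t - n - 1 + n = t - (1 : ℝ) by ring, sub_add_cancel]

theorem hasDerivAt_quot_zero {p d : ℝ → ℝ} {p' d' : ℝ} (hp : HasDerivAt p p' 1)
    (hd : HasDerivAt d d' 1) (h0 : d 1 ≠ 0) (h : p' * d 1 = p 1 * d') :
    HasDerivAt (fun t => p t / d t) 0 1 :=
  (hp.div hd h0).congr_deriv (by rw [h, sub_self, zero_div])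

theorem hasDerivAt_quadratic (a b c x : ℝ) :
    HasDerivAt (fun t => a + b * t + c * t ^ 2) (b + 2 * c * x) x := by
  have := (((hasDerivAt_id x).const_mul b).const_add a).add
    (((hasDerivAt_id x).pow 2).const_mul c)
  exact this.congr_deriv (by simp; ring)

theorem ratOrd_boundary {n A : ℕ} {u v q : ℝ → ℝ} (hu : RatOrd 1 u) (hv : RatOrd 1 v)
    (hq : RatOrd (-2) q) : ∃ d, RatOrd d
    (fun t => poch (t - n - 1) n * poch t (A - n) / (poch t n * poch t A) * q t
      * (u t * Phi n A (t - 1) + v t * Phi n (A + 1) (t - 1))) := by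
  have h := ((((ratOrd_poch (-(n + 1)) n).mul (ratOrd_poch 0 (A - n))).mul
    ((ratOrd_inv_poch le_rfl n).mul (ratOrd_inv_poch le_rfl A))).mul hq).mul
    ((hu.mul (ratOrd_Phi n A)).add (hv.mul (ratOrd_Phi n (A + 1))))
  refine ⟨_, h.congr fun t _ => ?_⟩
  simp only [add_zero]
  rw [div_eq_mul_inv, mul_inv, show t - n - 1 = t + -((n : ℝ) + 1) by ring]

theorem ratOrd_affine (a b : ℝ) : RatOrd 1 (fun t => a + b * t) :=
  (((RatOrd.const a).mono (by norm_num)).add ((RatOrd.linear 0).const_mul b)).congr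
    fun t _ => by ring

theorem ratOrd_inv_quadratic {a b : ℝ} (ha : 0 ≤ a) (hb : 0 ≤ b) (c : ℝ) :
    RatOrd (-2) (fun t => c / ((t + a) * (t + b))) :=
  (((RatOrd.inv_linear ha).mul (RatOrd.inv_linear hb)).const_mul c).congr
    fun t _ => by rw [div_eq_mul_inv, mul_inv]

/-- Condition `h0` says that the numerator of the quotient rule vanishes at 1, so each certificate
requires only one polynomial check. -/
theorem deriv_deriv_boundary {n A : ℕ} (hA : n ≤ A) {f : ℝ → ℝ} {u₀ u₁ v₀ v₁ a b c : ℝ}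
    (ha : 0 ≤ a) (hb : 0 ≤ b)
    (h : ∀ t > 0, f t = (t - 1) * (poch (t - n - 1) n * poch t (A - n) / (poch t n * poch t A)
      * (c / ((t + a) * (t + b))) * ((u₀ + u₁ * t) * Phi n A (t - 1)
        + (v₀ + v₁ * t) * Phi n (A + 1) (t - 1))))
    (h0 : (u₁ * (1 + (A - n)) + u₀ + u₁ + v₁ * (1 + A) + v₀ + v₁)
        * ((1 + (A - n)) * ((1 + a) * (1 + b)))
      = ((u₀ + u₁) * (1 + (A - n)) + (v₀ + v₁) * (1 + A))
        * ((1 + a) * (1 + b) + (1 + (A - n)) * (2 + a + b))) :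
    deriv (deriv f) 1 = 0 := by
  have hAn : (n : ℝ) ≤ A := by exact_mod_cast hA
  obtain ⟨d, hd⟩ := ratOrd_boundary (n := n) (A := A) (ratOrd_affine u₀ u₁) (ratOrd_affine v₀ v₁)
    (ratOrd_inv_quadratic ha hb c)
  refine deriv_deriv_eq_zero_of_factor hd h ?_
  have hq := ((ratOrd_inv_quadratic ha hb c).differentiableAt one_pos)
  refine hasDerivAt_boundary hA ((ratOrd_affine u₀ u₁).differentiableAt one_pos)
    ((ratOrd_affine v₀ v₁).differentiableAt one_pos) hq ?_
  have hp : HasDerivAt (fun t => c * ((u₀ + u₁ * t) * (t + (A - n)) + (v₀ + v₁ * t) * (t + A)))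
      (c * (u₁ * (1 + (A - n)) + u₀ + u₁ + v₁ * (1 + A) + v₀ + v₁)) 1 := by
    have := (hasDerivAt_quadratic (u₀ * (A - n) + v₀ * A) (u₀ + u₁ * (A - n) + v₀ + v₁ * A)
      (u₁ + v₁) 1).const_mul c
    refine (this.congr_deriv (by ring)).congr_of_eventuallyEq (Eventually.of_forall fun t => ?_)
    simp only []; ring
  have hden : HasDerivAt (fun t : ℝ => (t + (A - n)) * ((t + a) * (t + b)))
      ((1 + a) * (1 + b) + (1 + (A - n)) * (2 + a + b)) 1 := by
    have := ((hasDerivAt_id (1 : ℝ)).add_const (A - n : ℝ)).mul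
      (((hasDerivAt_id (1 : ℝ)).add_const a).mul ((hasDerivAt_id (1 : ℝ)).add_const b))
    exact this.congr_deriv (by simp only [id, Pi.mul_apply]; ring)
  have h1 : (1 + ((A : ℝ) - n)) * ((1 + a) * (1 + b)) ≠ 0 := by
    have : 0 < 1 + ((A : ℝ) - n) := by linarith
    positivity
  refine (hasDerivAt_quot_zero hp hden h1 (by linear_combination c * h0)).congr_of_eventuallyEq
    (Eventually.of_forall fun t => ?_)
  simp only []
  rw [div_mul_div_comm, mul_comm c]

theorem deriv_deriv_certRec {n k : ℕ} (hk : n ≤ k) : deriv (deriv (certRec n k)) 1 = 0 := by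
  refine deriv_deriv_boundary hk (a := k) (b := k + 1) (c := n.factorial)
    (u₀ := certRecU n (k + 2) 0) (u₁ := -((k + 2 : ℝ) * ((k + 2 : ℝ) - 1) ^ 2))
    (v₀ := certRecV n (k + 2) 0) (v₁ := (4 * n ^ 2 * (k + 2) - 2 * n ^ 2 + 4 * n * (k + 2)
      - 2 * n + (k + 2) ^ 3 : ℝ)) (by positivity) (by positivity) (fun t ht => ?_) ?_
  · rw [certRec, poch_sub_split hk, show k + 2 = k + 1 + 1 from rfl, poch_succ, poch_succ]
    have hU : certRecU n (k + 2) t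
        = certRecU n (k + 2) 0 + -((k + 2 : ℝ) * ((k + 2 : ℝ) - 1) ^ 2) * t := by
      unfold certRecU; ring
    have hV : certRecV n (k + 2) t = certRecV n (k + 2) 0 + (4 * n ^ 2 * (k + 2) - 2 * n ^ 2
        + 4 * n * (k + 2) - 2 * n + (k + 2) ^ 3 : ℝ) * t := by
      unfold certRecV; ring
    rw [hU, hV]
    push_cast
    field_simp
  · unfold certRecU certRecV
    ring

theorem deriv_deriv_balCertRow {n k : ℕ} (hk : n ≤ k) : deriv (deriv (balCertRow n k)) 1 = 0 := by
  refine deriv_deriv_boundary hk (a := n) (b := k) (c := n.factorial)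
    (u₀ := certRowU n (k + 1) 0) (u₁ := -4 * (k + 1 : ℝ) ^ 2)
    (v₀ := certRowV n (k + 1) 0) (v₁ := (4 * n ^ 2 + 10 * n * (k + 1) + 8 * n
      + 10 * (k + 1) ^ 2 + 10 * (k + 1) + 4 : ℝ)) (by positivity) (by positivity)
      (fun t ht => ?_) ?_
  · rw [balCertRow, poch_sub_split hk, poch_succ, poch_succ]
    have hU : certRowU n (k + 1) t = certRowU n (k + 1) 0 + -4 * (k + 1 : ℝ) ^ 2 * t := by
      unfold certRowU; ring
    have hV : certRowV n (k + 1) t = certRowV n (k + 1) 0 + (4 * n ^ 2 + 10 * n * (k + 1) + 8 * n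
      + 10 * (k + 1) ^ 2 + 10 * (k + 1) + 4 : ℝ) * t := by
      unfold certRowV; ring
    rw [hU, hV]
    field_simp
  · unfold certRowU certRowV
    ring

end RightBoundary

/-! ### The relations for the right series. -/

section RightRelations

theorem termR_eq {n m : ℕ} (hm : m ≤ n) (i : ℕ) :
    termR n m i = deriv (deriv (balR n (2 * n - m))) ((i + 1 : ℕ) : ℝ) := by
  have h : ratRTilde n m = balR n (2 * n - m) := funext fun t => ratRTilde_eq hm t
  rw [termR, h, iteratedDeriv_succ, iteratedDeriv_one]
  push_cast
  rw [add_comm]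

theorem summable_deriv_balR (n N : ℕ) :
    Summable fun i : ℕ => deriv (deriv (balR n N)) ((i + 1 : ℕ) : ℝ) :=
  (ratOrd_balR n N).deriv.deriv.summable (by norm_num) 1

theorem summable_termR {n m : ℕ} (hm : m ≤ n) : Summable (termR n m) := by
  rw [show termR n m = _ from funext (termR_eq hm)]
  exact summable_deriv_balR n _

theorem hasSum_deriv_balR {n m N : ℕ} (hm : m ≤ n) (hN : m + N = 2 * n) :
    HasSum (fun i : ℕ => deriv (deriv (balR n N)) ((i + 1 : ℕ) : ℝ)) (6 * Zr n m) := by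
  obtain rfl : N = 2 * n - m := by omega
  have h := (summable_deriv_balR n (2 * n - m)).hasSum
  rw [← tsum_congr (termR_eq hm)] at h
  convert h using 1
  rw [Zr]; ring

theorem Zr_rec {n m : ℕ} (hm : m + 2 ≤ n) :
    (recA0 n m : ℝ) * Zr n m + (recA1 n m : ℝ) * Zr n (m + 1) + (recA2 n m : ℝ) * Zr n (m + 2)
      = 0 := by
  obtain ⟨k, hk⟩ : ∃ k, m + (k + 2) = 2 * n := ⟨2 * n - m - 2, by omega⟩
  have hmk : (m : ℝ) = 2 * n - (k + 2) := by
    have : ((m + (k + 2) : ℕ) : ℝ) = (2 * n : ℕ) := by rw [hk]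
    push_cast at this; linarith
  have h := sum_deriv_deriv_telescope (ratOrd_balR n (k + 2)) (ratOrd_balR n (k + 1))
    (ratOrd_balR n k) certRec_ratOrd (by norm_num) (by norm_num) (by norm_num)
    (fun t ht => certRec_telescope (n := n) (k := k) (by omega) ht) one_pos
    (hasSum_deriv_balR (by omega : m ≤ n) hk)
    (hasSum_deriv_balR (by omega : m + 1 ≤ n) (by omega))
    (hasSum_deriv_balR (by omega : m + 2 ≤ n) (by omega))
  rw [Nat.cast_one, deriv_deriv_certRec (by omega)] at h
  have e0 : (recA0 n m : ℝ) = (k + 2) ^ 5 := by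
    rw [recA0]; push_cast; rw [hmk]; ring
  have e1 : (recA1 n m : ℝ) = recMid n (2 * n - (k + 2)) := by
    rw [recA1, recMid]; push_cast; rw [hmk]
  have e2 : (recA2 n m : ℝ) = -((k + 1) ^ 3 * (2 * n + (k + 2)) * (2 * n - (k + 2) + 2)) := by
    rw [recA2]; push_cast; rw [hmk]; ring
  rw [e0, e1, e2]
  linear_combination h / 6

theorem Zr_row {n m k : ℕ} (h : m + (k + 1) = 2 * n) (hm : m + 1 ≤ n) :
    ((n + 1) ^ 3 * (m + 2) : ℝ) * Zr (n + 1) (m + 2) + rowCoefA n (k + 1) * Zr n m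
      + -(6 * (k + 1) ^ 3 * (2 * n + (k + 1) + 1)) * Zr n (m + 1) = 0 := by
  have hmk : (m : ℝ) = 2 * n - (k + 1) := by
    have : ((m + (k + 1) : ℕ) : ℝ) = (2 * n : ℕ) := by rw [h]
    push_cast at this; linarith
  have h := sum_deriv_deriv_telescope (ratOrd_balR (n + 1) (k + 1)) (ratOrd_balR n (k + 1))
    (ratOrd_balR n k) balCertRow_ratOrd (by norm_num) (by norm_num) (by norm_num)
    (fun t ht => balCertRow_telescope (n := n) (k := k) (by omega) ht) one_pos
    (hasSum_deriv_balR (by omega : m + 2 ≤ n + 1) (by omega))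
    (hasSum_deriv_balR (by omega : m ≤ n) h)
    (hasSum_deriv_balR (by omega : m + 1 ≤ n) (by omega))
  rw [Nat.cast_one, deriv_deriv_balCertRow (by omega)] at h
  rw [hmk]
  linear_combination h / 6

end RightRelations

/-! ### Initial values, and propagation of the equality of the two series. -/

section InitialValues

open Filter Topology

theorem hasDerivAt_inv_pow (c a : ℝ) (k : ℕ) {t : ℝ} (h : t + a ≠ 0) :
    HasDerivAt (fun t => c * ((t + a) ^ k)⁻¹) (-(k * c) * ((t + a) ^ (k + 1))⁻¹) t := by
  have h1 := ((((hasDerivAt_id t).add_const a).pow k).inv (pow_ne_zero k h)).const_mul c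
  refine h1.congr_deriv ?_
  cases k with
  | zero => simp
  | succ k => simp only [id, Pi.pow_apply, Nat.add_sub_cancel]; field_simp; ring

theorem deriv_deriv_of_hasDerivAt {f f' : ℝ → ℝ} {f'' x : ℝ} (hx : 0 < x)
    (h : ∀ t > 0, HasDerivAt f (f' t) t) (h' : HasDerivAt f' f'' x) : deriv (deriv f) x = f'' := by
  have : deriv f =ᶠ[𝓝 x] f' := by
    filter_upwards [lt_mem_nhds hx] with t ht using (h t ht).deriv
  rw [this.deriv_eq, h'.deriv]

theorem deriv_deriv_inv_sq {t : ℝ} (ht : 0 < t) :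
    deriv (deriv fun t : ℝ => (t ^ 2)⁻¹) t = 6 * (1 / t ^ 4) := by
  have h : ∀ s : ℝ, s > 0 → HasDerivAt (fun t : ℝ => (t ^ 2)⁻¹) (-2 * ((s + 0) ^ 3)⁻¹) s := by
    intro s hs
    have := hasDerivAt_inv_pow 1 0 2 (t := s) (by simpa using hs.ne')
    simpa using this
  have h' := hasDerivAt_inv_pow (-2) 0 3 (t := t) (by simpa using ht.ne')
  refine (deriv_deriv_of_hasDerivAt ht h h').trans ?_
  norm_num

/-- A generic rational function with poles at `0, -1, -2`. -/
noncomputable def polarPart (α β γ δ ε t : ℝ) : ℝ :=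
  α * ((t + 0) ^ 2)⁻¹ + β * ((t + 0) ^ 1)⁻¹ + γ * ((t + 1) ^ 1)⁻¹ + δ * ((t + 1) ^ 2)⁻¹
    + ε * ((t + 2) ^ 1)⁻¹

theorem deriv_deriv_polarPart (α β γ δ ε : ℝ) : deriv (deriv (polarPart α β γ δ ε)) 1
    = 6 * α + 2 * β + γ / 4 + 3 * δ / 8 + 2 * ε / 27 := by
  have h0 : ∀ t : ℝ, t > 0 → t + 0 ≠ 0 ∧ t + 1 ≠ 0 ∧ t + 2 ≠ 0 := fun t ht => by
    refine ⟨?_, ?_, ?_⟩ <;> positivity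
  refine (deriv_deriv_of_hasDerivAt one_pos (fun t ht =>
    (((((hasDerivAt_inv_pow α 0 2 (h0 t ht).1).add (hasDerivAt_inv_pow β 0 1 (h0 t ht).1)).add
    (hasDerivAt_inv_pow γ 1 1 (h0 t ht).2.1)).add (hasDerivAt_inv_pow δ 1 2 (h0 t ht).2.1)).add
    (hasDerivAt_inv_pow ε 2 1 (h0 t ht).2.2))) (((((hasDerivAt_inv_pow _ 0 _ (h0 1 one_pos).1).add
    (hasDerivAt_inv_pow _ 0 _ (h0 1 one_pos).1)).add
    (hasDerivAt_inv_pow _ 1 _ (h0 1 one_pos).2.1)).add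
    (hasDerivAt_inv_pow _ 1 _ (h0 1 one_pos).2.1)).add
    (hasDerivAt_inv_pow _ 2 _ (h0 1 one_pos).2.2))).trans ?_
  norm_num
  ring

theorem polarPart_ratOrd (α β γ δ ε : ℝ) : RatOrd 0 (polarPart α β γ δ ε) := by
  have h : ∀ c a : ℝ, 0 ≤ a → ∀ k, RatOrd 0 (fun t => c * ((t + a) ^ k)⁻¹) := by
    intro c a ha k
    refine RatOrd.const_mul _ ?_
    induction k with
    | zero => exact (RatOrd.const 1).congr fun t _ => by simp
    | succ k ih =>
      refine ((ih.mul (RatOrd.inv_linear ha)).mono (by norm_num)).congr fun t _ => ?_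
      rw [pow_succ, mul_inv]
  exact ((((h α 0 le_rfl 2).add (h β 0 le_rfl 1)).add (h γ 1 zero_le_one 1)).add
    (h δ 1 zero_le_one 2)).add (h ε 2 zero_le_two 1)

/-- R̃ has degree at most -2, so the residues of its simple poles add up to 0 and those poles
telescope; the double poles contribute c/t² up to a difference. The constants in the evaluations
below come from partial fractions. -/
theorem Zr_of_telescope {n m N : ℕ} {c α β γ δ ε : ℝ} (hm : m ≤ n) (hN : m + N = 2 * n)
    (h : ∀ t > 0, balR n N t = c * (t ^ 2)⁻¹
      + (polarPart α β γ δ ε (t + 1) - polarPart α β γ δ ε t)) :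
    Zr n m = c * zetaFour - (6 * α + 2 * β + γ / 4 + 3 * δ / 8 + 2 * ε / 27) / 6 := by
  have hsq : RatOrd (-2) fun t : ℝ => (t ^ 2)⁻¹ :=
    ((RatOrd.inv_linear le_rfl).mul (RatOrd.inv_linear le_rfl)).congr fun t _ => by
      rw [add_zero, ← mul_inv, sq]
  have hs : HasSum (fun i : ℕ => deriv (deriv fun t : ℝ => (t ^ 2)⁻¹) ((i + 1 : ℕ) : ℝ))
      (6 * zetaFour) := by
    rw [funext fun i : ℕ => deriv_deriv_inv_sq (t := ((i + 1 : ℕ) : ℝ)) (by positivity)]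
    exact zetaFour_hasSum.mul_left 6
  have h := sum_deriv_deriv_telescope (ratOrd_balR n N) hsq hsq (polarPart_ratOrd α β γ δ ε)
    (by norm_num) (by norm_num) (by norm_num) (a₀ := 1) (a₁ := -c) (a₂ := 0) (κ := 1)
    (fun t ht => by rw [h t ht]; ring) one_pos (hasSum_deriv_balR hm hN) hs hs
  rw [Nat.cast_one, deriv_deriv_polarPart] at h
  linear_combination h / 6

theorem Zr_zero_zero : Zr 0 0 = zetaFour := by
  have h := Zr_of_telescope (n := 0) (m := 0) (N := 0) (c := 1) (α := 0) (β := 0) (γ := 0) (δ := 0)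
    (ε := 0) le_rfl rfl fun t ht => by
    simp [balR, Phi_zero, poch_zero, poch_one_right, polarPart]
    field_simp
  linarith

theorem Zr_one_zero : Zr 1 0 = -16 * zetaFour + 277 / 16 := by
  have h := Zr_of_telescope (n := 1) (m := 0) (N := 2) (c := -16) (α := -16) (β := -3 / 2)
    (γ := -39 / 2) (δ := 0) (ε := 0) (by norm_num) rfl fun t ht => by
    simp [balR, Phi, phiTerm, poch_succ, poch_zero, polarPart, Finset.sum_range_succ]
    field_simp
    ring
  linarith

theorem Zr_one_one : Zr 1 1 = 12 * zetaFour - 13 := by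
  have h := Zr_of_telescope (n := 1) (m := 1) (N := 1) (c := 12) (α := 10) (β := 9)
    (γ := 0) (δ := 0) (ε := 0) (by norm_num) rfl fun t ht => by
    simp [balR, Phi, phiTerm, poch_succ, poch_zero, polarPart, Finset.sum_range_succ]
    field_simp
    ring
  linarith

theorem Zr_two_one : Zr 2 1 = -1944 * zetaFour + 4090247 / 1944 := by
  have h := Zr_of_telescope (n := 2) (m := 1) (N := 3) (c := -1944) (α := -1944) (β := -10 / 3)
    (γ := -3403 / 3) (δ := -1620) (ε := -2530 / 3) (by norm_num) rfl fun t ht => by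
    simp [balR, Phi, phiTerm, poch_succ, poch_zero, polarPart, Finset.sum_range_succ,
      Nat.factorial, Nat.choose]
    field_simp
    ring
  linarith

theorem Zl_eq_Zr_initial {n m : ℕ} (h : n = 0 ∧ m = 0 ∨ n = 1 ∧ m = 0 ∨ n = 1 ∧ m = 1 ∨
    n = 2 ∧ m = 1) : Zl n m = Zr n m := by
  rcases h with ⟨rfl, rfl⟩ | ⟨rfl, rfl⟩ | ⟨rfl, rfl⟩ | ⟨rfl, rfl⟩
  · rw [Zl_zero_zero, Zr_zero_zero]
  all_goals
    rw [Zl_eq_closedForm (by norm_num), closedForm_eq]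
    norm_num [Zr_one_zero, Zr_one_one, Zr_two_one, coefZeta, ratP, hypA, coefOne, ratQ, hypB,
      coefU, Finset.sum_Icc_succ_top, weightU, nestedU, Finset.sum_range_succ, Nat.choose]
    try ring

theorem recA0_ne_zero {n m : ℕ} (h : m + 2 ≤ n) : (recA0 n m : ℝ) ≠ 0 := by
  have h' : (m : ℚ) + 2 ≤ n := by exact_mod_cast h
  have hm : (0 : ℚ) ≤ m := by positivity
  have : recA0 n m ≠ 0 := by
    rw [recA0]
    exact pow_ne_zero _ (by linarith)
  exact_mod_cast this

/-- Within a row, two consecutive coincidences propagate to the whole row. -/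
theorem row_eq_of_two {n l : ℕ} (hl : l + 1 ≤ n) (h0 : Zl n l = Zr n l)
    (h1 : Zl n (l + 1) = Zr n (l + 1)) : ∀ m ≤ n, Zl n m = Zr n m := by
  have hdown : Zl n 0 = Zr n 0 ∧ Zl n 1 = Zr n 1 := by
    induction l with
    | zero => exact ⟨h0, h1⟩
    | succ l ih =>
      refine ih (by omega) ?_ h0
      have e1 := Zl_rec (n := n) (m := l) (by omega)
      have e2 := Zr_rec (n := n) (m := l) (by omega)
      rw [h0, h1] at e1
      exact mul_left_cancel₀ (recA0_ne_zero (n := n) (m := l) (by omega)) (by linarith)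
  intro m
  induction m using Nat.twoStepInduction with
  | zero => exact fun _ => hdown.1
  | one => exact fun _ => hdown.2
  | more m ih1 ih2 =>
    intro hm
    have e1 := Zl_rec hm
    have e2 := Zr_rec hm
    rw [ih1 (by omega), ih2 (by omega)] at e1
    have h2 : ((recA2 n m : ℚ) : ℝ) ≠ 0 := by exact_mod_cast recA2_ne_zero hm
    exact mul_left_cancel₀ h2 (by linarith)

theorem Zl_eq_Zr_next_row {n m : ℕ} (hm : m + 1 ≤ n) (h0 : Zl n m = Zr n m)
    (h1 : Zl n (m + 1) = Zr n (m + 1)) : Zl (n + 1) (m + 2) = Zr (n + 1) (m + 2) := by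
  obtain ⟨k, hk⟩ : ∃ k, m + (k + 1) = 2 * n := ⟨2 * n - m - 1, by omega⟩
  have e1 := Zl_row hk hm
  have e2 := Zr_row hk hm
  rw [h0, h1] at e1
  exact mul_left_cancel₀ (by positivity : ((n + 1) ^ 3 * (m + 2) : ℝ) ≠ 0) (by linarith)

theorem Zl_eq_Zr {n m : ℕ} (hm : m ≤ n) : Zl n m = Zr n m := by
  induction n generalizing m with
  | zero => exact Zl_eq_Zr_initial (by omega)
  | succ n ih =>
    -- The row relation reaches only m ≥ 2. Row 1 consists of initial values; row 2 obtains m = 2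
    -- and needs (2,1) separately; later rows obtain m = 2 and m = 3, which determine the row.
    rcases n with _ | _ | n
    · exact Zl_eq_Zr_initial (by omega)
    · exact row_eq_of_two (l := 1) (by omega) (Zl_eq_Zr_initial (by omega))
        (Zl_eq_Zr_next_row (by omega) (ih (by omega)) (ih (by omega))) m hm
    · exact row_eq_of_two (l := 2) (by omega)
        (Zl_eq_Zr_next_row (by omega) (ih (by omega)) (ih (by omega)))
        (Zl_eq_Zr_next_row (by omega) (ih (by omega)) (ih (by omega))) m hm

end InitialValues

/-! ### Compilation of arithmetic expressions and assignments, with exact costs. -/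

section StraightLine

/-- The four field operations. -/
inductive FieldOp : Type
  | add | sub | mul | div

namespace FieldOp

def prog : FieldOp → ℕ → ℕ → ℕ → Prog
  | add => Prog.add
  | sub => Prog.sub
  | mul => Prog.mul
  | div => Prog.div

def apply : FieldOp → ℚ → ℚ → ℚ
  | add => (· + ·)
  | sub => (· - ·)
  | mul => (· * ·)
  | div => (· / ·)

def Admissible : FieldOp → ℚ → Prop
  | div, q => q ≠ 0
  | _, _ => True

theorem exec (o : FieldOp) (r a b : ℕ) (s : ℕ → ℚ) (h : o.Admissible (s b)) :
    Exec (o.prog r a b) s 1 (Function.update s r (o.apply (s a) (s b))) := by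
  cases o with
  | add => exact Exec.add r a b s
  | sub => exact Exec.sub r a b s
  | mul => exact Exec.mul r a b s
  | div => exact Exec.div r a b s h

end FieldOp

/-- Arithmetic expressions over the registers. -/
inductive RegExpr : Type
  | const (q : ℤ)
  | reg (r : ℕ)
  | bin (o : FieldOp) (e f : RegExpr)

namespace RegExpr

def eval (s : ℕ → ℚ) : RegExpr → ℚ
  | const q => q
  | reg r => s r
  | bin o e f => o.apply (e.eval s) (f.eval s)

/-- No division by zero occurs in the evaluation. -/
def Defined (s : ℕ → ℚ) : RegExpr → Prop
  | const _ => True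
  | reg _ => True
  | bin o e f => e.Defined s ∧ f.Defined s ∧ o.Admissible (f.eval s)

/-- Only registers below `b` are read. -/
def Below (b : ℕ) : RegExpr → Prop
  | const _ => True
  | reg r => r < b
  | bin _ e f => e.Below b ∧ f.Below b

/-- The program that evaluates the expression into register `b`, using registers above `b` as
scratch space. -/
def compile (b : ℕ) : RegExpr → Prog
  | const q => Prog.const b q
  | reg r => Prog.seq (Prog.const b 0) (Prog.add b r b)
  | bin o e f => Prog.seq (e.compile b) (Prog.seq (f.compile (b + 1)) (o.prog b b (b + 1)))

def cost : RegExpr → ℕ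
  | const _ => 1
  | reg _ => 1 + 1
  | bin _ e f => e.cost + (f.cost + 1)

theorem Below.mono {b c : ℕ} (h : b ≤ c) {e : RegExpr} (he : e.Below b) : e.Below c := by
  induction e with
  | const => trivial
  | reg r => exact lt_of_lt_of_le he h
  | bin o e f ihe ihf => exact ⟨ihe he.1, ihf he.2⟩

theorem eval_congr {b : ℕ} {s s' : ℕ → ℚ} (h : ∀ r < b, s' r = s r) {e : RegExpr}
    (he : e.Below b) : e.eval s' = e.eval s := by
  induction e with
  | const => rfl
  | reg r => exact h r he
  | bin o e f ihe ihf => simp only [eval, ihe he.1, ihf he.2]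

theorem defined_congr {b : ℕ} {s s' : ℕ → ℚ} (h : ∀ r < b, s' r = s r) {e : RegExpr}
    (he : e.Below b) : e.Defined s' ↔ e.Defined s := by
  induction e with
  | const => rfl
  | reg r => rfl
  | bin o e f ihe ihf => simp only [Defined, ihe he.1, ihf he.2, eval_congr h he.2]

/-- Since lower registers are preserved, the first operand survives in b while the second is
computed from b + 1 upwards. -/
theorem compile_spec {b : ℕ} {s : ℕ → ℚ} {e : RegExpr} (he : e.Below b) (hd : e.Defined s) :
    ∃ s', Exec (e.compile b) s e.cost s' ∧ s' b = e.eval s ∧ ∀ r < b, s' r = s r := by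
  induction e generalizing b s with
  | const q =>
    exact ⟨_, Exec.const b q s, by simp [eval], fun r hr => Function.update_of_ne hr.ne _ _⟩
  | reg r =>
    refine ⟨_, Exec.seq (Exec.const b 0 s) (Exec.add b r b _), ?_, fun i hi => ?_⟩
    · have : r ≠ b := ne_of_lt he
      simp [eval, Function.update_of_ne this]
    · rw [Function.update_of_ne hi.ne, Function.update_of_ne hi.ne]
  | bin o e f ihe ihf =>
    obtain ⟨s₁, h₁, v₁, a₁⟩ := ihe he.1 hd.1
    obtain ⟨s₂, h₂, v₂, a₂⟩ := ihf (b := b + 1) (s := s₁) (he.2.mono (Nat.le_succ b))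
      ((defined_congr a₁ he.2).2 hd.2.1)
    rw [eval_congr a₁ he.2] at v₂
    refine ⟨_, Exec.seq h₁ (Exec.seq h₂ (o.exec b b (b + 1) s₂ ?_)), ?_, fun r hr => ?_⟩
    · rw [v₂]; exact hd.2.2
    · rw [Function.update_self, v₂, a₂ b (Nat.lt_succ_self b), v₁]; rfl
    · rw [Function.update_of_ne hr.ne, a₂ r (Nat.lt_succ_of_lt hr), a₁ r hr]

instance : Add RegExpr := ⟨bin .add⟩
instance : Sub RegExpr := ⟨bin .sub⟩
instance : Mul RegExpr := ⟨bin .mul⟩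
instance : Div RegExpr := ⟨bin .div⟩

def npow (e : RegExpr) : ℕ → RegExpr
  | 0 => const 1
  | 1 => e
  | k + 2 => e.npow (k + 1) * e

instance : Pow RegExpr ℕ := ⟨npow⟩

variable (s : ℕ → ℚ) (b : ℕ) (e f : RegExpr)

@[simp] theorem eval_const (q : ℤ) : (const q).eval s = q := rfl
@[simp] theorem eval_reg (r : ℕ) : (reg r).eval s = s r := rfl
@[simp] theorem eval_add : (e + f).eval s = e.eval s + f.eval s := rfl
@[simp] theorem eval_sub : (e - f).eval s = e.eval s - f.eval s := rfl
@[simp] theorem eval_mul : (e * f).eval s = e.eval s * f.eval s := rfl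
@[simp] theorem eval_div : (e / f).eval s = e.eval s / f.eval s := rfl

@[simp] theorem eval_pow (k : ℕ) : (e ^ k).eval s = e.eval s ^ k := by
  change (e.npow k).eval s = _
  induction k using Nat.twoStepInduction with
  | zero => simp [npow]
  | one => simp [npow]
  | more k _ ih => rw [npow, eval_mul, ih, ← pow_succ]

@[simp] theorem defined_const (q : ℤ) : (const q).Defined s := trivial
@[simp] theorem defined_reg (r : ℕ) : (reg r).Defined s := trivial
@[simp] theorem defined_add : (e + f).Defined s ↔ e.Defined s ∧ f.Defined s :=
  ⟨fun h => ⟨h.1, h.2.1⟩, fun h => ⟨h.1, h.2, trivial⟩⟩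
@[simp] theorem defined_sub : (e - f).Defined s ↔ e.Defined s ∧ f.Defined s :=
  ⟨fun h => ⟨h.1, h.2.1⟩, fun h => ⟨h.1, h.2, trivial⟩⟩
@[simp] theorem defined_mul : (e * f).Defined s ↔ e.Defined s ∧ f.Defined s :=
  ⟨fun h => ⟨h.1, h.2.1⟩, fun h => ⟨h.1, h.2, trivial⟩⟩
@[simp] theorem defined_div : (e / f).Defined s ↔ e.Defined s ∧ f.Defined s ∧ f.eval s ≠ 0 :=
  Iff.rfl

@[simp] theorem defined_pow (k : ℕ) (h : e.Defined s) : (e ^ k).Defined s := by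
  change (e.npow k).Defined s
  induction k using Nat.twoStepInduction with
  | zero => trivial
  | one => exact h
  | more k _ ih => exact ⟨ih, h, trivial⟩

@[simp] theorem below_const (q : ℤ) : (const q).Below b := trivial
@[simp] theorem below_reg (r : ℕ) : (reg r).Below b ↔ r < b := Iff.rfl
@[simp] theorem below_add : (e + f).Below b ↔ e.Below b ∧ f.Below b := Iff.rfl
@[simp] theorem below_sub : (e - f).Below b ↔ e.Below b ∧ f.Below b := Iff.rfl
@[simp] theorem below_mul : (e * f).Below b ↔ e.Below b ∧ f.Below b := Iff.rfl
@[simp] theorem below_div : (e / f).Below b ↔ e.Below b ∧ f.Below b := Iff.rfl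

@[simp] theorem below_pow (k : ℕ) (h : e.Below b) : (e ^ k).Below b := by
  change (e.npow k).Below b
  induction k using Nat.twoStepInduction with
  | zero => trivial
  | one => exact h
  | more k _ ih => exact ⟨ih, h⟩

end RegExpr

/-- A sequence of assignments; the registers from `64` on are scratch space. -/
def assignProg : List (ℕ × RegExpr) → Prog
  | [] => Prog.const 64 0
  | (r, e) :: l => Prog.seq (e.compile 64)
      (Prog.seq (Prog.seq (Prog.const 65 0) (Prog.add r 64 65)) (assignProg l))

/-- The cost does not depend on the register contents, so each block contributes an absolute
constant. -/
def assignCost : List (ℕ × RegExpr) → ℕ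
  | [] => 1
  | (_, e) :: l => e.cost + (1 + 1 + assignCost l)

def assignState (s : ℕ → ℚ) : List (ℕ × RegExpr) → ℕ → ℚ
  | [] => s
  | (r, e) :: l => assignState (Function.update s r (e.eval s)) l

def AssignBelow : List (ℕ × RegExpr) → Prop
  | [] => True
  | (r, e) :: l => r < 64 ∧ e.Below 64 ∧ AssignBelow l

def AssignDefined (s : ℕ → ℚ) : List (ℕ × RegExpr) → Prop
  | [] => True
  | (r, e) :: l => e.Defined s ∧ AssignDefined (Function.update s r (e.eval s)) l

/-- The actual run alters scratch registers while `assignState` does not; later assignments cannot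
see the difference. -/
theorem assignState_congr {s s' : ℕ → ℚ} (h : ∀ r < 64, s' r = s r) {l : List (ℕ × RegExpr)}
    (hl : AssignBelow l) : (∀ r < 64, assignState s' l r = assignState s l r) ∧
      (AssignDefined s l → AssignDefined s' l) := by
  induction l generalizing s s' with
  | nil => exact ⟨h, fun _ => trivial⟩
  | cons p l ih =>
    obtain ⟨hr, he, hl⟩ := hl
    have h' : ∀ r < 64, Function.update s' p.1 (p.2.eval s') r
        = Function.update s p.1 (p.2.eval s) r := by
      intro r hr
      rw [RegExpr.eval_congr h he]
      by_cases hrp : r = p.1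
      · subst hrp; simp
      · rw [Function.update_of_ne hrp, Function.update_of_ne hrp, h r hr]
    exact ⟨(ih h' hl).1, fun hd => ⟨(RegExpr.defined_congr h he).2 hd.1, (ih h' hl).2 hd.2⟩⟩

theorem assignProg_spec {l : List (ℕ × RegExpr)} (hl : AssignBelow l) {s : ℕ → ℚ}
    (hd : AssignDefined s l) :
    ∃ s', Exec (assignProg l) s (assignCost l) s' ∧ ∀ r < 64, s' r = assignState s l r := by
  induction l generalizing s with
  | nil => exact ⟨_, Exec.const 64 0 s, fun r hr => Function.update_of_ne hr.ne _ _⟩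
  | cons p l ih =>
    obtain ⟨hr, he, hl⟩ := hl
    obtain ⟨s₁, h₁, v₁, a₁⟩ := RegExpr.compile_spec he hd.1
    set s₂ := Function.update (Function.update s₁ 65 ((0 : ℤ) : ℚ)) p.1
      (Function.update s₁ 65 ((0 : ℤ) : ℚ) 64 + Function.update s₁ 65 ((0 : ℤ) : ℚ) 65) with hs₂
    have a₂ : ∀ r < 64, s₂ r = Function.update s p.1 (p.2.eval s) r := by
      intro r hr
      rw [hs₂]
      by_cases hrp : r = p.1
      · subst hrp; simp [v₁]
      · rw [Function.update_of_ne hrp, Function.update_of_ne hrp,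
          Function.update_of_ne (by omega), a₁ r hr]
    obtain ⟨s₃, h₃, a₃⟩ := ih hl (s := s₂) ((assignState_congr a₂ hl).2 hd.2)
    exact ⟨s₃, Exec.seq h₁ (Exec.seq (Exec.seq (Exec.const 65 0 s₁) (Exec.add p.1 64 65 _)) h₃),
      fun r hr => (a₃ r hr).trans ((assignState_congr a₂ hl).1 r hr)⟩

theorem exec_while {c : Prog} {r T n : ℕ} (I : ℕ → (ℕ → ℚ) → Prop)
    (hstep : ∀ i < n, ∀ s, I i s → s r ≠ 0 ∧ ∃ s', Exec c s T s' ∧ I (i + 1) s')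
    (hdone : ∀ s, I n s → s r = 0) {s : ℕ → ℚ} (h : I 0 s) :
    ∃ s', Exec (.whileNonzero r c) s (n * (1 + T) + 1) s' ∧ I n s' := by
  suffices H : ∀ k i s, i + k = n → I i s →
      ∃ s', Exec (.whileNonzero r c) s (k * (1 + T) + 1) s' ∧ I n s' from H n 0 s (by omega) h
  intro k
  induction k with
  | zero =>
    rintro i s rfl hi
    rw [Nat.zero_mul, Nat.zero_add]
    exact ⟨s, Exec.whileDone (hdone s hi), hi⟩
  | succ k ih =>
    intro i s hik hi
    obtain ⟨h0, s', hs, hi'⟩ := hstep i (by omega) s hi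
    obtain ⟨s'', hs', hn⟩ := ih (i + 1) s' (by omega) hi'
    refine ⟨s'', ?_, hn⟩
    have := Exec.whileStep h0 hs hs'
    rwa [show 1 + T + (k * (1 + T) + 1) = (k + 1) * (1 + T) + 1 by ring] at this

end StraightLine

/-! ### The linear-time program and its verification. -/

section Program

open RegExpr

set_option linter.unusedSimpArgs false

/-- The input is copied to 20 and 21 because the output reuses 0 and 1. Registers 14 to 19 hold U_4,
..., U_9 and start at 1, the summand with i = 0. -/
def initBlock : List (ℕ × RegExpr) :=
  [(20, reg 0), (21, reg 1), (22, reg 0), (23, const 0), (24, const 1), (25, const 1),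
    (26, const 1), (14, const 1), (15, const 1), (16, const 1), (17, const 1), (18, const 1),
    (19, const 1)]

/-- Passage from `i` to `i + 1` in the nested sums, with `C(2i,i)`, `C(4i,2i)` and `(-1)^i`. -/
def sumBlock : List (ℕ × RegExpr) :=
  [(23, reg 23 + const 1),
    (24, reg 24 * (const 2 * (const 2 * reg 23 - const 1)) / reg 23),
    (25, reg 25 * (const 4 * (const 4 * reg 23 - const 1) * (const 4 * reg 23 - const 3))
      / (const 2 * reg 23 * (const 2 * reg 23 - const 1))),
    (26, const 0 - reg 26),
    (27, reg 25 / reg 24 ^ 8),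
    (28, const 2 * reg 23 + const 1),
    (14, reg 14 + reg 27 / reg 28 ^ 4),
    (15, reg 15 + reg 27 / reg 28 ^ 5),
    (16, reg 16 + reg 27 / reg 28 ^ 6),
    (17, reg 17 + reg 27 / reg 28 ^ 7),
    (18, reg 18 + reg 27 / reg 28 ^ 8),
    (19, reg 19 + reg 27 / reg 28 ^ 9),
    (22, reg 22 - const 1)]

/-- The hypergeometric products and the coefficients for `m = 0`. -/
def zeroBlock : List (ℕ × RegExpr) :=
  [(27, reg 26 * reg 24 ^ 4),
    (28, reg 26 * reg 25 / reg 24 ^ 4),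
    (30, const 1 / const 30720),
    (32, (const 4 * reg 20 + const 1) * (const 5460 * reg 20 ^ 4 + const 13499 * reg 20 ^ 3
      + const 12601 * reg 20 ^ 2 + const 5265 * reg 20 + const 831)
      / (const 768 * (const 2 * reg 20 + const 1) ^ 9))]

/-- The coefficients for `m = 1`, and the counters of the recurrence. -/
def oneBlock : List (ℕ × RegExpr) :=
  [(31, (const 0 - reg 20) / const 40960),
    (33, (const 16 * reg 20 ^ 9 + const 116544 * reg 20 ^ 8 + const 398115 * reg 20 ^ 7
      + const 587145 * reg 20 ^ 6 + const 490329 * reg 20 ^ 5 + const 255555 * reg 20 ^ 4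
      + const 86016 * reg 20 ^ 3 + const 18432 * reg 20 ^ 2 + const 2304 * reg 20 + const 128)
      / (const 3072 * reg 20 ^ 3 * (const 2 * reg 20 + const 1) ^ 9)),
    (34, const 0),
    (35, reg 21)]

/-- One application of the recurrence in `m`. -/
def recBlock : List (ℕ × RegExpr) :=
  [(36, (const 2 * reg 20 - reg 34) ^ 5),
    (37, (const 0 - (const 4 * reg 20 - const 2 * reg 34 - const 1)) *
      (const 6 * reg 20 ^ 4 - const 24 * reg 20 ^ 3 * reg 34 + const 22 * reg 20 ^ 2 * reg 34 ^ 2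
        - const 8 * reg 20 * reg 34 ^ 3 + reg 34 ^ 4 - const 24 * reg 20 ^ 3
        + const 30 * reg 20 ^ 2 * reg 34 - const 14 * reg 20 * reg 34 ^ 2 + const 2 * reg 34 ^ 3
        + const 8 * reg 20 ^ 2 - const 10 * reg 20 * reg 34 + const 2 * reg 34 ^ 2
        - const 4 * reg 20 + reg 34)),
    (38, (const 0 - (const 2 * reg 20 - reg 34 - const 1) ^ 3) * (const 4 * reg 20 - reg 34)
      * (reg 34 + const 2)),
    (39, (const 0 - (reg 36 * reg 30 + reg 37 * reg 31)) / reg 38),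
    (30, reg 31),
    (31, reg 39),
    (39, (const 0 - (reg 36 * reg 32 + reg 37 * reg 33)) / reg 38),
    (32, reg 33),
    (33, reg 39),
    (34, reg 34 + const 1),
    (35, reg 35 - const 1)]

def outputBlock : List (ℕ × RegExpr) :=
  [(29, reg 30 * reg 27),
    (0, const 30720 * reg 29),
    (4, const (-27300) * reg 29),
    (5, const (-12140) * reg 29),
    (6, const 2045 * reg 29),
    (7, const 3095 * reg 29),
    (8, const 955 * reg 29),
    (9, const 105 * reg 29),
    (1, reg 32 * reg 28),
    (2, reg 4 * reg 14 + reg 5 * reg 15 + reg 6 * reg 16 + reg 7 * reg 17 + reg 8 * reg 18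
      + reg 9 * reg 19 + reg 1)]

def recProg : Prog :=
  .seq (assignProg oneBlock) (.whileNonzero 35 (assignProg recBlock))

/-- The case n = 0 is separated because Q_1 has x³ in its denominator; then m = 0 and the output of
`zeroBlock` is already final. -/
def mainProg : Prog :=
  .seq (assignProg initBlock) (.seq (.whileNonzero 22 (assignProg sumBlock))
    (.seq (assignProg zeroBlock) (.seq (.ifZero 20 (assignProg []) recProg)
      (assignProg outputBlock))))

/-- The registers holding the sums, when the index has reached `i`. -/
structure SumState (n m i : ℕ) (s : ℕ → ℚ) : Prop where
  row : s 20 = n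
  col : s 21 = m
  count : s 22 = n - i
  index : s 23 = i
  binom : s 24 = (2 * i).choose i
  binom' : s 25 = (4 * i).choose (2 * i)
  sign : s 26 = (-1) ^ i
  sums : s 14 = nestedU 4 i ∧ s 15 = nestedU 5 i ∧ s 16 = nestedU 6 i ∧ s 17 = nestedU 7 i ∧
    s 18 = nestedU 8 i ∧ s 19 = nestedU 9 i

/-- The registers holding the coefficients, when the recurrence has reached `j`. -/
structure RecState (n m j : ℕ) (s : ℕ → ℚ) : Prop where
  row : s 20 = n
  prodA : s 27 = hypA n
  prodB : s 28 = hypB n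
  coefP : s 30 = ratP n j
  coefP' : s 31 = ratP n (j + 1)
  coefQ : s 32 = ratQ n j
  coefQ' : s 33 = ratQ n (j + 1)
  index : s 34 = j
  count : s 35 = m - j
  sums : s 14 = nestedU 4 n ∧ s 15 = nestedU 5 n ∧ s 16 = nestedU 6 n ∧ s 17 = nestedU 7 n ∧
    s 18 = nestedU 8 n ∧ s 19 = nestedU 9 n

theorem centralBinom_succ (i : ℕ) : ((2 * (i + 1)).choose (i + 1) : ℚ)
    = (2 * i).choose i * (2 * (2 * (i + 1) - 1)) / (i + 1) := by
  have h := Nat.succ_mul_centralBinom_succ i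
  simp only [Nat.centralBinom] at h
  have h' : ((i + 1 : ℕ) : ℚ) * ((2 * (i + 1)).choose (i + 1) : ℚ)
      = 2 * (2 * i + 1) * ((2 * i).choose i : ℚ) := by exact_mod_cast h
  have h0 : (i : ℚ) + 1 ≠ 0 := by positivity
  rw [eq_div_iff h0]
  push_cast at h'
  linear_combination h'

/-- C(4i, 2i) is the central binomial coefficient of index 2i, so two steps of `centralBinom_succ`
are needed. -/
theorem centralBinom_double_succ (i : ℕ) : ((4 * (i + 1)).choose (2 * (i + 1)) : ℚ)
    = (4 * i).choose (2 * i) * (4 * (4 * (i + 1) - 1) * (4 * (i + 1) - 3))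
      / (2 * (i + 1) * (2 * (i + 1) - 1)) := by
  have h1 := centralBinom_succ (2 * i)
  have h2 := centralBinom_succ (2 * i + 1)
  rw [h1] at h2
  rw [show 4 * (i + 1) = 2 * (2 * i + 1 + 1) by ring, show 2 * (i + 1) = 2 * i + 1 + 1 by ring, h2,
    show 4 * i = 2 * (2 * i) by ring]
  have h0 : (i : ℚ) + 1 ≠ 0 := by positivity
  have h3 : 2 * (i : ℚ) + 1 ≠ 0 := by positivity
  have h4 : 2 * ((i : ℚ) + 1) - 1 ≠ 0 := by
    rw [show 2 * ((i : ℚ) + 1) - 1 = 2 * i + 1 by ring]; exact h3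
  have h5 : 2 * (i : ℚ) + 1 + 1 ≠ 0 := by positivity
  push_cast
  field_simp
  ring

theorem nestedU_succ (k i : ℕ) : nestedU k (i + 1) = nestedU k i
    + ((4 * (i + 1)).choose (2 * (i + 1)) : ℚ) / ((2 * (i + 1)).choose (i + 1) : ℚ) ^ 8
      / (2 * (i + 1) + 1) ^ k := by
  rw [nestedU, Finset.sum_range_succ, ← nestedU, div_div, mul_comm (_ ^ 8)]
  push_cast
  rfl

theorem sumBlock_spec {n m i : ℕ} {s : ℕ → ℚ} (h : SumState n m i s) :
    ∃ s', Exec (assignProg sumBlock) s (assignCost sumBlock) s' ∧ SumState n m (i + 1) s' := by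
  obtain ⟨h20, h21, h22, h23, h24, h25, h26, h14, h15, h16, h17, h18, h19⟩ := h
  have h0 : (i : ℚ) + 1 ≠ 0 := by positivity
  have h1 : 2 * ((i : ℚ) + 1) + 1 ≠ 0 := by positivity
  have h2 : 2 * ((i : ℚ) + 1) - 1 ≠ 0 := by
    rw [show 2 * ((i : ℚ) + 1) - 1 = 2 * i + 1 by ring]; positivity
  have c2 := centralBinom_succ i
  have c4 := centralBinom_double_succ i
  have hc : ((2 * (i + 1)).choose (i + 1) : ℚ) ≠ 0 :=
    Nat.cast_ne_zero.2 (Nat.choose_pos (by omega)).ne'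
  obtain ⟨s', hs', hv⟩ := assignProg_spec (l := sumBlock) (s := s) (by simp [sumBlock, AssignBelow])
    (by
      simp only [sumBlock, AssignDefined, Function.update_apply, eval_add, eval_mul, eval_sub,
        eval_div, eval_pow, eval_reg, eval_const, defined_add, defined_sub, defined_mul,
        defined_div, defined_reg, defined_const, Nat.reduceEqDiff, if_true, if_false,
        Int.cast_ofNat, Int.cast_one, Int.cast_zero, h23, h24, ← c2, ← c4, h25]
      simp [h0, h1, h2, hc])
  refine ⟨s', hs', ?_⟩
  have e : ∀ r < 64, s' r = _ := hv
  simp only [sumBlock, assignState, Function.update_apply, eval_add, eval_mul, eval_sub,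
        eval_div, eval_pow, eval_reg, eval_const, Nat.reduceEqDiff, if_true, if_false,
        Int.cast_ofNat, Int.cast_one, Int.cast_zero, h23, h24, h25, h26, h14, h15, h16, h17, h18, h19,
        h22, ← c2, ← c4] at e
  constructor
  · rw [e 20 (by norm_num)]; simp [h20]
  · rw [e 21 (by norm_num)]; simp [h21]
  · rw [e 22 (by norm_num)]; simp; ring
  · rw [e 23 (by norm_num)]; simp
  · rw [e 24 (by norm_num)]; simp
  · rw [e 25 (by norm_num)]; simp
  · rw [e 26 (by norm_num)]; simp [pow_succ]
  · refine ⟨?_, ?_, ?_, ?_, ?_, ?_⟩ <;> rw [e _ (by norm_num), nestedU_succ] <;>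
      simp only [Nat.reduceEqDiff, if_true, if_false]

theorem initBlock_spec (n m : ℕ) : ∃ s', Exec (assignProg initBlock) (inputNM n m)
    (assignCost initBlock) s' ∧ SumState n m 0 s' := by
  obtain ⟨s', hs', e⟩ := assignProg_spec (l := initBlock) (s := inputNM n m)
    (by simp [initBlock, AssignBelow]) (by simp [initBlock, AssignDefined])
  refine ⟨s', hs', ?_⟩
  have h0 : inputNM n m 0 = n := rfl
  have h1 : inputNM n m 1 = m := rfl
  simp only [initBlock, assignState, Function.update_apply, eval_add, eval_mul, eval_sub,
    eval_div, eval_pow, eval_reg, eval_const, Nat.reduceEqDiff, if_true, if_false,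
    Int.cast_ofNat, Int.cast_one, Int.cast_zero, h0, h1] at e
  constructor
  case sums => refine ⟨?_, ?_, ?_, ?_, ?_, ?_⟩ <;> rw [e _ (by norm_num)] <;> simp [nestedU]
  all_goals rw [e _ (by norm_num)]; simp

/-- The state in which the output is computed. -/
structure CoefState (n m : ℕ) (s : ℕ → ℚ) : Prop where
  prodA : s 27 = hypA n
  prodB : s 28 = hypB n
  coefP : s 30 = ratP n m
  coefQ : s 32 = ratQ n m
  sums : s 14 = nestedU 4 n ∧ s 15 = nestedU 5 n ∧ s 16 = nestedU 6 n ∧ s 17 = nestedU 7 n ∧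
    s 18 = nestedU 8 n ∧ s 19 = nestedU 9 n

theorem zeroBlock_spec {n m : ℕ} {s : ℕ → ℚ} (h : SumState n m n s) :
    ∃ s', Exec (assignProg zeroBlock) s (assignCost zeroBlock) s' ∧ CoefState n 0 s' ∧
      s' 20 = n ∧ s' 21 = m := by
  obtain ⟨h20, h21, h22, h23, h24, h25, h26, hU⟩ := h
  have hc : ((2 * n).choose n : ℚ) ≠ 0 := Nat.cast_ne_zero.2 (Nat.choose_pos (by omega)).ne'
  have h1 : 2 * (n : ℚ) + 1 ≠ 0 := by positivity
  obtain ⟨s', hs', e⟩ := assignProg_spec (l := zeroBlock) (s := s)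
    (by simp [zeroBlock, AssignBelow]) (by
      simp only [zeroBlock, AssignDefined, Function.update_apply, defined_add, defined_sub, defined_mul, defined_div, defined_reg,
    defined_const, eval_add, eval_mul, eval_sub,
    eval_div, eval_pow, eval_reg, eval_const, Nat.reduceEqDiff, if_true, if_false,
    Int.cast_ofNat, Int.cast_one, Int.cast_zero, h20, h24]
      simp [h1, hc])
  refine ⟨s', hs', ?_⟩
  simp only [zeroBlock, assignState, Function.update_apply, eval_add, eval_mul, eval_sub,
    eval_div, eval_pow, eval_reg, eval_const, Nat.reduceEqDiff, if_true, if_false,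
    Int.cast_ofNat, Int.cast_one, Int.cast_zero, h20, h24, h25, h26] at e
  refine ⟨⟨?_, ?_, ?_, ?_, ?_⟩, ?_, ?_⟩
  · rw [e 27 (by norm_num)]; simp [hypA]
  · rw [e 28 (by norm_num)]; simp [hypB]
  · rw [e 30 (by norm_num)]; simp [ratP]
  · rw [e 32 (by norm_num)]; simp [ratQ]
  · simpa [e] using hU
  · rw [e 20 (by norm_num)]; simp [h20]
  · rw [e 21 (by norm_num)]; simp [h21]

theorem oneBlock_spec {n m : ℕ} (hn : n ≠ 0) {s : ℕ → ℚ} (h : CoefState n 0 s) (h20 : s 20 = n)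
    (h21 : s 21 = m) :
    ∃ s', Exec (assignProg oneBlock) s (assignCost oneBlock) s' ∧ RecState n m 0 s' := by
  obtain ⟨h27, h28, h30, h32, hU⟩ := h
  have h1 : 2 * (n : ℚ) + 1 ≠ 0 := by positivity
  have hn' : (n : ℚ) ≠ 0 := by exact_mod_cast hn
  obtain ⟨s', hs', e⟩ := assignProg_spec (l := oneBlock) (s := s)
    (by simp [oneBlock, AssignBelow]) (by
      simp only [oneBlock, AssignDefined, Function.update_apply, defined_add, defined_sub, defined_mul, defined_div, defined_reg,
    defined_const, eval_add, eval_mul, eval_sub,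
    eval_div, eval_pow, eval_reg, eval_const, Nat.reduceEqDiff, if_true, if_false,
    Int.cast_ofNat, Int.cast_one, Int.cast_zero, h20]
      simp [h1, hn'])
  refine ⟨s', hs', ?_⟩
  simp only [oneBlock, assignState, Function.update_apply, eval_add, eval_mul, eval_sub,
    eval_div, eval_pow, eval_reg, eval_const, Nat.reduceEqDiff, if_true, if_false,
    Int.cast_ofNat, Int.cast_one, Int.cast_zero, h20, h21] at e
  constructor
  case sums => simpa [e] using hU
  case coefP' => rw [e _ (by norm_num)]; simp [ratP]
  case coefQ' => rw [e _ (by norm_num)]; simp [ratQ]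
  all_goals rw [e _ (by norm_num)]; simp [*]

/-- The loop carries two consecutive coefficients and so computes one entry more than is output. Its
last pass, at j = m - 1, may have j = n - 1, outside the range of `recA2_ne_zero`. -/
theorem recA2_ne_zero_of_lt {n j : ℕ} (h : j < n) : recA2 n j ≠ 0 := by
  have h' : (j : ℚ) + 1 ≤ n := by exact_mod_cast h
  have hj : (0 : ℚ) ≤ j := by positivity
  have h1 : 2 * (n : ℚ) - j - 1 ≠ 0 := by
    have : (0 : ℚ) < 2 * n - j - 1 := by linarith
    exact this.ne'
  have h2 : 4 * (n : ℚ) - j ≠ 0 := by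
    have : (0 : ℚ) < 4 * n - j := by linarith
    exact this.ne'
  have h3 : (j : ℚ) + 2 ≠ 0 := by positivity
  rw [recA2, neg_mul, neg_mul]
  exact neg_ne_zero.2 (mul_ne_zero (mul_ne_zero (pow_ne_zero 3 h1) h2) h3)

theorem recBlock_spec {n m j : ℕ} (hj : j < n) {s : ℕ → ℚ} (h : RecState n m j s) :
    ∃ s', Exec (assignProg recBlock) s (assignCost recBlock) s' ∧ RecState n m (j + 1) s' := by
  obtain ⟨h20, h27, h28, h30, h31, h32, h33, h34, h35, hU⟩ := h
  have a0 : (2 * (n : ℚ) - j) ^ 5 = recA0 n j := rfl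
  have a1 : (0 - (4 * (n : ℚ) - 2 * j - 1)) *
      (6 * (n : ℚ) ^ 4 - 24 * n ^ 3 * j + 22 * n ^ 2 * j ^ 2 - 8 * n * j ^ 3 + j ^ 4 - 24 * n ^ 3
      + 30 * n ^ 2 * j - 14 * n * j ^ 2 + 2 * j ^ 3 + 8 * n ^ 2 - 10 * n * j + 2 * j ^ 2
      - 4 * n + j) = recA1 n j := by rw [recA1]; ring
  have a2 : (0 - (2 * (n : ℚ) - j - 1) ^ 3) * (4 * n - j) * (j + 2) = recA2 n j := by
    rw [recA2]; ring
  have h2 := recA2_ne_zero_of_lt hj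
  obtain ⟨s', hs', e⟩ := assignProg_spec (l := recBlock) (s := s)
    (by simp [recBlock, AssignBelow]) (by
      simp only [recBlock, AssignDefined, Function.update_apply, defined_add, defined_sub, defined_mul, defined_div, defined_reg,
    defined_const, eval_add, eval_mul, eval_sub,
    eval_div, eval_pow, eval_reg, eval_const, Nat.reduceEqDiff, if_true, if_false,
    Int.cast_ofNat, Int.cast_one, Int.cast_zero, h20, h34, a2]
      simp [h2])
  refine ⟨s', hs', ?_⟩
  simp only [recBlock, assignState, Function.update_apply, eval_add, eval_mul, eval_sub,
    eval_div, eval_pow, eval_reg, eval_const, Nat.reduceEqDiff, if_true, if_false,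
    Int.cast_ofNat, Int.cast_one, Int.cast_zero, h20, h34, a0, a1, a2, h30, h31,
    h32, h33, h35] at e
  constructor
  case sums => simpa [e] using hU
  case coefP' => rw [e _ (by norm_num), ratP]; simp [zero_sub]
  case coefQ' => rw [e _ (by norm_num), ratQ]; simp [zero_sub]
  case count => rw [e _ (by norm_num)]; simp; ring
  all_goals rw [e _ (by norm_num)]; simp [*]

theorem outputBlock_spec {n m : ℕ} {s : ℕ → ℚ} (h : CoefState n m s) :
    ∃ s', Exec (assignProg outputBlock) s (assignCost outputBlock) s' ∧
      s' 0 = coefZeta n m ∧ s' 1 = coefOne n m ∧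
      (∀ k ∈ Icc 4 9, s' k = coefU k n m ∧ s' (10 + k) = nestedU k n) ∧
      s' 2 = ∑ k ∈ Icc 4 9, coefU k n m * nestedU k n + coefOne n m := by
  obtain ⟨h27, h28, h30, h32, h14, h15, h16, h17, h18, h19⟩ := h
  obtain ⟨s', hs', e⟩ := assignProg_spec (l := outputBlock) (s := s)
    (by simp [outputBlock, AssignBelow]) (by simp [outputBlock, AssignDefined])
  refine ⟨s', hs', ?_⟩
  simp only [outputBlock, assignState, Function.update_apply, eval_add, eval_mul, eval_sub,
    eval_div, eval_pow, eval_reg, eval_const, Nat.reduceEqDiff, if_true, if_false,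
    Int.cast_ofNat, Int.cast_one, Int.cast_zero, Int.cast_neg, h27, h28, h30,
    h32, h14, h15, h16, h17, h18, h19] at e
  have hI : Icc 4 9 = ({4, 5, 6, 7, 8, 9} : Finset ℕ) := rfl
  refine ⟨?_, ?_, ?_, ?_⟩
  · rw [e _ (by norm_num)]; simp [coefZeta]
  · rw [e _ (by norm_num)]; simp [coefOne]
  · intro k hk
    rw [hI] at hk
    simp only [mem_insert, mem_singleton] at hk
    rcases hk with rfl | rfl | rfl | rfl | rfl | rfl <;>
      exact ⟨by rw [e _ (by norm_num)]; simp [coefU, weightU],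
        by rw [e _ (by norm_num)]; simp [*]⟩
  · rw [e _ (by norm_num), hI]
    simp [coefU, coefOne, weightU]
    ring

theorem sumLoop_spec {n m : ℕ} {s : ℕ → ℚ} (h : SumState n m 0 s) :
    ∃ s', Exec (.whileNonzero 22 (assignProg sumBlock)) s (n * (1 + assignCost sumBlock) + 1) s' ∧
      SumState n m n s' := by
  refine exec_while (SumState n m) (fun i hi s hs => ⟨?_, sumBlock_spec hs⟩) (fun s hs => ?_) h
  · rw [hs.count, sub_ne_zero]
    exact_mod_cast hi.ne'
  · rw [hs.count, sub_self]

theorem recProg_spec {n m : ℕ} (hn : n ≠ 0) (hm : m ≤ n) {s : ℕ → ℚ} (h : CoefState n 0 s)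
    (h20 : s 20 = n) (h21 : s 21 = m) :
    ∃ s', Exec recProg s (assignCost oneBlock + (m * (1 + assignCost recBlock) + 1)) s' ∧
      CoefState n m s' := by
  obtain ⟨s₁, e₁, h₁⟩ := oneBlock_spec hn h h20 h21
  obtain ⟨s₂, e₂, h₂⟩ := exec_while (c := assignProg recBlock) (r := 35) (n := m) (RecState n m)
    (fun j hj s hs => ⟨by rw [hs.count, sub_ne_zero]; exact_mod_cast hj.ne',
      recBlock_spec (by omega) hs⟩) (fun s hs => by rw [hs.count, sub_self]) h₁
  exact ⟨s₂, Exec.seq e₁ e₂, h₂.prodA, h₂.prodB, h₂.coefP, h₂.coefQ, h₂.sums⟩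

theorem mainProg_spec : ∃ C : ℕ, ∀ n m : ℕ, m ≤ n →
    ∃ (t : ℕ) (s : ℕ → ℚ), t ≤ C * (n + 1) ∧ Exec mainProg (inputNM n m) t s ∧
      s 0 = coefZeta n m ∧ s 1 = coefOne n m ∧
      (∀ k ∈ Icc 4 9, s k = coefU k n m ∧ s (10 + k) = nestedU k n) ∧
      s 2 = ∑ k ∈ Icc 4 9, coefU k n m * nestedU k n + coefOne n m := by
  refine ⟨assignCost initBlock + assignCost sumBlock + assignCost zeroBlock + assignCost []
    + assignCost oneBlock + assignCost recBlock + assignCost outputBlock + 4, fun n m hm => ?_⟩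
  obtain ⟨s₁, e₁, h₁⟩ := initBlock_spec n m
  obtain ⟨s₂, e₂, h₂⟩ := sumLoop_spec h₁
  obtain ⟨s₃, e₃, h₃, h20, h21⟩ := zeroBlock_spec h₂
  have hmid : ∃ t s₄, t ≤ 1 + assignCost [] + assignCost oneBlock
      + (m * (1 + assignCost recBlock) + 1) ∧
      Exec (.ifZero 20 (assignProg []) recProg) s₃ t s₄ ∧ CoefState n m s₄ := by
    rcases eq_or_ne n 0 with rfl | hn
    · obtain rfl : m = 0 := by omega
      obtain ⟨s₄, e₄, h₄⟩ := assignProg_spec (l := []) (s := s₃) trivial trivial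
      refine ⟨_, s₄, ?_, Exec.ifTrue (by simpa using h20) e₄, ?_⟩
      · omega
      · obtain ⟨a, b, c, d, u⟩ := h₃
        exact ⟨by rw [h₄ _ (by norm_num)]; exact a, by rw [h₄ _ (by norm_num)]; exact b,
          by rw [h₄ _ (by norm_num)]; exact c, by rw [h₄ _ (by norm_num)]; exact d,
          by simpa [h₄, assignState] using u⟩
    · obtain ⟨s₄, e₄, h₄⟩ := recProg_spec hn hm h₃ h20 h21
      refine ⟨_, s₄, ?_, Exec.ifFalse (by rw [h20]; exact_mod_cast hn) e₄, h₄⟩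
      omega
  obtain ⟨t, s₄, ht, e₄, h₄⟩ := hmid
  obtain ⟨s₅, e₅, h₅⟩ := outputBlock_spec h₄
  refine ⟨_, s₅, ?_, Exec.seq e₁ (Exec.seq e₂ (Exec.seq e₃ (Exec.seq e₄ e₅))), h₅⟩
  generalize assignCost initBlock = c₁ at *
  generalize assignCost sumBlock = c₂ at *
  generalize assignCost zeroBlock = c₃ at *
  generalize assignCost [] = c₄ at *
  generalize assignCost oneBlock = c₅ at *
  generalize assignCost recBlock = c₆ at *
  generalize assignCost outputBlock = c₇ at *
  -- The recurrence loop makes m ≤ n passes, so both loops are linear in n.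
  have h6 : m * (1 + c₆) ≤ n * (1 + c₆) := Nat.mul_le_mul_right _ hm
  have h7 : 0 ≤ n * (c₁ + c₃ + c₄ + c₅ + c₇ + 2) := Nat.zero_le _
  nlinarith

end Program

theorem theorem2 :
    (∀ n m : ℕ, m ≤ n →
      Summable (termL n m) ∧ Summable (termR n m) ∧ Zl n m = Zr n m ∧
      Zl n m = (coefZeta n m : ℝ) * zetaFour
        + ∑ k ∈ Finset.Icc 4 9, (coefU k n m : ℝ) * (nestedU k n : ℝ)
        + (coefOne n m : ℝ)) ∧
    ∃ (c : Prog) (C : ℕ), ∀ n m : ℕ, m ≤ n →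
      ∃ (t : ℕ) (s : ℕ → ℚ), t ≤ C * (n + 1) ∧ Exec c (inputNM n m) t s ∧
        s 0 = coefZeta n m ∧
        s 1 = coefOne n m ∧
        (∀ k ∈ Finset.Icc 4 9, s k = coefU k n m ∧ s (10 + k) = nestedU k n) ∧
        s 2 = ∑ k ∈ Finset.Icc 4 9, coefU k n m * nestedU k n + coefOne n m := by
  refine ⟨fun n m hm => ⟨?_, summable_termR hm, Zl_eq_Zr hm, ?_⟩, mainProg, mainProg_spec⟩
  · rw [termL_eq hm]
    exact summable_deriv_ratR hm _
  · rw [Zl_eq_closedForm hm, closedForm_eq]
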